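/- Let $d\in\{2,3\}$. There is $s_0=s_0(d)\in\mathbb R$ such that the following holds. Let $\mathtt m>0$, $\kappa>0$ and $g\in C^\infty((0,\infty);\mathbb R)$ with $g(\mathtt m)=0$ and $g'(\mathtt m)>0$. Then for almost every $\nu\in[1,2]^d$ and every $s\ge s_0$ there is $\varepsilon_0>0$ (depending on $d,\mathtt m,\kappa,g,\nu,s$) such that for every $\varepsilon\in(0,\varepsilon_0)$, every $T>0$ and every solution $w$ on $[0,T)$ of the equation (E) below: if $$\|w(0)\|_{H^s}\le\varepsilon,\qquad \sup_{t\in[0,T)}\|w(t)\|_{H^s}\le 2\varepsilon,\qquad T\le \varepsilon^{-1-\frac1{d-1}}\,\log^{-\frac{d+1}{2}}\big(1+\varepsilon^{\frac1{1-d}}\big),$$ then $$\sup_{t\in[0,T)}\|w(t)\|_{H^s}\le \tfrac32\,\varepsilon .$$ Notation. Functions on $\mathbb T^d=(\mathbb R/2\pi\mathbb Z)^d$ are written $u(x)=(2\pi)^{-d/2}\sum_{j\in\mathbb Z^d}u_je^{\mathrm i j\cdot x}$; $\|u\|_{H^s}^2=\sum_j(1+|j|^2)^{s}|u_j|^2$,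 and $H^s_0(\mathbb T^d;\mathbb C)$ is the space of $u$ with $\|u\|_{H^s}<\infty$ and $u_0=0$. Put $\hbar=2\sqrt\kappa$, $|j|_\nu^2=\sum_i\nu_i^2j_i^2$, $b=\mathtt m g'(\mathtt m)/\hbar$, and for $j\ne0$ $$\omega(j)=\sqrt{\tfrac{\hbar^2}{4}|j|_\nu^4+\mathtt m g'(\mathtt m)|j|_\nu^2},\qquad A(j)=\omega(j)+\tfrac\hbar2|j|_\nu^2+b .$$ Let $G(y)=\int_{\mathtt m}^y g$, let $|D|_\nu^2$ be the Fourier multiplier with symbol $|j|_\nu^2$, and for zero-mean $z$ let $$\mathcal K_{\mathtt m}(z)=\frac\hbar2\int_{\mathbb T^d}|D|_\nu^2z\cdot\overline z\,dx+\frac1\hbar\int_{\mathbb T^d}G\big(|\alpha+z|^2\big)dx,\qquad \alpha=\Big(\mathtt m-\frac1{(2\pi)^d}\int_{\mathbb T^d}|z|^2dx\Big)^{1/2}.$$ The diagonalizing change of variables $w\mapsto z$ is $$z_j=\frac{A(j)\,w_j-b\,\overline{w_{-j}}}{\sqrt{2\omega(j)A(j)}}\quad(j\ne0),\qquad z_0=0,$$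 and $\widetilde{\mathcal K}_{\mathtt m}(w)=\mathcal K_{\mathtt m}(z)$ is the Hamiltonian in the variable $w$. The diagonalized equation is $$\text{(E)}\qquad \mathrm i\,\partial_tw=\partial_{\overline w}\widetilde{\mathcal K}_{\mathtt m}(w,\overline w),$$ that is, $\mathrm i\,\partial_tw_j=\partial_{\overline{w_j}}\widetilde{\mathcal K}_{\mathtt m}$ for all $j\neq0$, where $\partial_{\overline{w_j}}=\frac12(\partial_{\mathrm{Re}\,w_j}+\mathrm i\,\partial_{\mathrm{Im}\,w_j})$. A solution on $[0,T)$ is a function $w$ with $w(t)\in H^s_0(\mathbb T^d;\mathbb C)$ for all $t\in[0,T)$ whose Fourier coefficients $w_j$, $j\ne0$, are differentiable on $[0,T)$ (from the right at $0$) and satisfy these equations. -/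

import Mathlib

open MeasureTheory
open scoped ContDiff

noncomputable section

namespace QHD

/-- Frequencies `j ∈ ℤ^d`. A function on `𝕋^d` is represented by its Fourier coefficients
`(u_j)_{j ∈ ℤ^d}` with respect to the orthonormal system `(2π)^{-d/2} e^{i j·x}`. -/
abbrev Freq (d : ℕ) : Type := Fin d → ℤ

/-- The Japanese bracket `⟨j⟩ = √(1 + |j|²)` (Euclidean norm of `j`). -/
def bracket {d : ℕ} (j : Freq d) : ℝ := Real.sqrt (1 + ∑ i, (j i : ℝ) ^ 2)

/-- Membership in `H^s_0(𝕋^d; ℂ)`: zero mean and `∑_j ⟨j⟩^{2s} |u_j|² < ∞`. -/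
def MemSobolevZero {d : ℕ} (s : ℝ) (u : Freq d → ℂ) : Prop :=
  u 0 = 0 ∧ Summable fun j : Freq d => bracket j ^ (2 * s) * ‖u j‖ ^ 2

/-- The Sobolev norm `‖u‖_{H^s} = (∑_j ⟨j⟩^{2s} |u_j|²)^{1/2}`. -/
def sobolevNorm {d : ℕ} (s : ℝ) (u : Freq d → ℂ) : ℝ :=
  Real.sqrt (∑' j : Freq d, bracket j ^ (2 * s) * ‖u j‖ ^ 2)

/-- `|j|_ν² = ∑_i ν_i² j_i²`, the symbol of `|D|_ν²`. -/
def symbSq {d : ℕ} (ν : Fin d → ℝ) (j : Freq d) : ℝ := ∑ i, ν i ^ 2 * (j i : ℝ) ^ 2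

/-- `ħ = 2 √κ`. -/
def hbar (κ : ℝ) : ℝ := 2 * Real.sqrt κ

/-- The function `u(x) = (2π)^{-d/2} ∑_j u_j e^{i j·x}`. -/
def torusFun {d : ℕ} (u : Freq d → ℂ) (x : Fin d → ℝ) : ℂ :=
  (((2 * Real.pi) ^ (-(d : ℝ) / 2) : ℝ) : ℂ) *
    ∑' j : Freq d, u j * Complex.exp (Complex.I * ((∑ i, (j i : ℝ) * x i : ℝ) : ℂ))

/-- The primitive `G` of `g` (normalized by `G(m) = 0`). -/
def primitive (g : ℝ → ℝ) (m y : ℝ) : ℝ := ∫ u in m..y, g u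

/-- The (constant, nonnegative) zero mode `α`, recovered from the zero-mean part `z` by
conservation of the mean of `|α + z|²`: `α² + (2π)^{-d} ∫_{𝕋^d} |z|² dx = m`. -/
def zeroMode {d : ℕ} (m : ℝ) (z : Freq d → ℂ) : ℝ :=
  Real.sqrt (m - ((2 * Real.pi) ^ d)⁻¹ * ∑' j : Freq d, ‖z j‖ ^ 2)

/-- The Hamiltonian of the reduced system in the zero-mean variable `z`,
`𝒦_m(z) = (ħ/2) ∫ |D|_ν² z · z̄ dx + (1/ħ) ∫ G(|α + z|²) dx`, with `α = zeroMode m z`. The integrals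
are over `𝕋^d = (ℝ/2πℤ)^d`; the first one is written in Fourier variables. -/
def hamZ {d : ℕ} (ν : Fin d → ℝ) (m κ : ℝ) (g : ℝ → ℝ) (z : Freq d → ℂ) : ℝ :=
  hbar κ / 2 * ∑' j : Freq d, symbSq ν j * ‖z j‖ ^ 2 +
    1 / hbar κ *
      ∫ x in Set.Icc (fun _ : Fin d => (0 : ℝ)) (fun _ => 2 * Real.pi),
        primitive g m (‖((zeroMode m z : ℝ) : ℂ) + torusFun z x‖ ^ 2)

/-- The dispersion relation `ω(j) = √(ħ²/4 |j|_ν⁴ + m g'(m) |j|_ν²)`. -/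
def omega {d : ℕ} (ν : Fin d → ℝ) (m κ : ℝ) (g : ℝ → ℝ) (j : Freq d) : ℝ :=
  Real.sqrt (hbar κ ^ 2 / 4 * symbSq ν j ^ 2 + m * deriv g m * symbSq ν j)

/-- The off-diagonal coefficient `b = m g'(m) / ħ` of the linearized operator
`[[ħ/2 |D|_ν² + b, b], [b, ħ/2 |D|_ν² + b]]`. -/
def offDiag (m κ : ℝ) (g : ℝ → ℝ) : ℝ := m * deriv g m / hbar κ

/-- `A(j) = ω(j) + ħ/2 |j|_ν² + b`. -/
def symbA {d : ℕ} (ν : Fin d → ℝ) (m κ : ℝ) (g : ℝ → ℝ) (j : Freq d) : ℝ :=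
  omega ν m κ g j + hbar κ / 2 * symbSq ν j + offDiag m κ g

/-- The first component `z` of `𝒞 (w, w̄)`, where `𝒞` is the diagonalizing symplectic matrix of Fourier
multipliers `(2 ω A)^{-1/2} [[A, -b], [-b, A]]` acting on zero-mean functions. The `j`-th Fourier
coefficient of `w̄` is the conjugate of `w_{-j}`. The second component of `𝒞 (w, w̄)` is `z̄`. -/
def undiag {d : ℕ} (ν : Fin d → ℝ) (m κ : ℝ) (g : ℝ → ℝ) (w : Freq d → ℂ) : Freq d → ℂ :=
  fun j =>
    if j = 0 then 0
    else
      ((symbA ν m κ g j : ℝ) * w j - (offDiag m κ g : ℝ) * (starRingEnd ℂ) (w (-j))) /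
        ((Real.sqrt (2 * omega ν m κ g j * symbA ν m κ g j) : ℝ) : ℂ)

/-- The Hamiltonian in the diagonalizing variable, `𝒦_m(𝒞 (w, w̄))`. -/
def hamW {d : ℕ} (ν : Fin d → ℝ) (m κ : ℝ) (g : ℝ → ℝ) (w : Freq d → ℂ) : ℝ :=
  hamZ ν m κ g (undiag ν m κ g w)

/-- The Wirtinger derivative `∂_{w̄_j} F = (∂_{Re w_j} F + i ∂_{Im w_j} F) / 2` of a real-valued
function of the Fourier coefficients. -/
def dbar {d : ℕ} (F : (Freq d → ℂ) → ℝ) (w : Freq d → ℂ) (j : Freq d) : ℂ :=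
  ((deriv (fun h : ℝ => F (w + Pi.single j (h : ℂ))) 0 : ℝ) +
    Complex.I * (deriv (fun h : ℝ => F (w + Pi.single j ((h : ℂ) * Complex.I))) 0 : ℝ)) / 2

/-- `w` is a solution on `[0, T)`, with values in `H^s_0(𝕋^d; ℂ)`, of the Hamiltonian equation
`i ∂_t w = ∂_{w̄} K(w, w̄)`, where `K` is the Hamiltonian `hamW`: every nonzero Fourier coefficient is
differentiable in time on `[0, T)` (from the right at `0`) and satisfies
`∂_t w_j = -i ∂_{w̄_j} K`. -/
structure IsSolution {d : ℕ} (ν : Fin d → ℝ) (m κ : ℝ) (g : ℝ → ℝ) (s T : ℝ)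
    (w : ℝ → Freq d → ℂ) : Prop where
  mem : ∀ t ∈ Set.Ico 0 T, MemSobolevZero s (w t)
  eqn : ∀ t ∈ Set.Ico 0 T, ∀ j : Freq d, j ≠ 0 →
    HasDerivWithinAt (fun τ => w τ j) (-Complex.I * dbar (hamW ν m κ g) (w t) j)
      (Set.Ico 0 T) t

end QHD

end

/-! In the diagonal variable the equation reads `i ∂_t w_j = ω(j) w_j + Q_j(w) + O(ε³)` in `H^s`,
where `Q` is quadratic with bounded, symmetric interaction coefficients. A plain `H^s` energy
estimate gives growth `ε³` per unit time and stops at times of order `1/ε`. The longer time comes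
from adding to the energy a cubic correction that removes part of the three-wave interactions
(`energy_estimate`).

A triple of signed frequencies with zero sum enters the derivative of the energy with a factor `κ`,
the signed sum of the energy weights; correcting it divides `κ` by `Ω`, the signed sum of the `ω`.
Either `|Ω|` is bounded below, or two comparable high frequencies `b, c` carry opposite signs. In
the latter case the commutator `κ` gains a factor `⟨b⟩⁻¹`, while for almost every `ν` one has `|Ω| ≥
γ ⟨a⟩^{-2d} ⟨b⟩^{1-d} (1+log⟨b⟩)^{-5/4}`. Triples with `⟨b⟩ ≤ N` are removed at a cost `K =
N^{d-2}(1+log N)^{5/4}`; the others keep a gain `1/N` (`dichotomy`). Altogether `‖w(t)‖² ≤ ‖w(0)‖² +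
C (K ε³ + T (ε³/N + K ε⁴))`. For `N = ε^{-1/(d-1)}` one has `ε K = N⁻¹ (1+log N)^{5/4}` and `T ≤
(N/ε) log(1+N)^{-(d+1)/2}`, so the increment is `o(ε²)` because `5/4 < 3/2 ≤ (d+1)/2`
(`exists_small_loss`).

The small divisor bound (`ae_small_divisors`) is a measure estimate. Moving `ν_i` changes the
resonance function at a rate of order `|j_i k_i|` when this product is large; dilating `ν` changes
it at a rate bounded below for all pairs, by strict subadditivity of `l ↦ l / √(c²l² + 2τc)`. Each
`i` with `k_i ≠ 0` thus saves a factor `(1+|j_i|)⁻¹`, and the exponent `5/4 > 1` makes the dyadic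
sum over `j` converge.

The expansion of the vector field (`dbar_expansion`) needs `h(y)` in `H^s` for smooth `h` and small
real `y`. It is obtained by writing `h(y) = ∑ c_n e^{iny}` with rapidly decaying `c_n`; the norm of
`e^{iny}` grows only polynomially in `n` (`exists_funcCalc`). Since solutions are differentiable
only coefficientwise, energy weights are truncated at height `M`, so that all differentiated sums
are finite, and `M → ∞` at the end. -/

noncomputable section

/-! ### Norms of `ℓ²` type with values in `[0, ∞]` -/

namespace QHD

open scoped ENNReal

/-- The `ℓ²` norm of a family of extended nonnegative reals. -/
def l2 {ι : Type*} (p : ι → ℝ≥0∞) : ℝ≥0∞ := (∑' i, p i ^ 2) ^ (1 / 2 : ℝ)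

section L2
variable {ι κ : Type*}

lemma l2_sq (p : ι → ℝ≥0∞) : l2 p ^ 2 = ∑' i, p i ^ 2 := by
  rw [l2, ← ENNReal.rpow_natCast, ← ENNReal.rpow_mul]; norm_num

lemma l2_mono {p q : ι → ℝ≥0∞} (h : ∀ i, p i ≤ q i) : l2 p ≤ l2 q := by
  unfold l2; gcongr; exact h _

lemma le_of_sq_le {a b : ℝ≥0∞} (h : a ^ 2 ≤ b ^ 2) : a ≤ b :=
  (ENNReal.pow_le_pow_left_iff (n := 2) two_ne_zero).1 h

lemma l2_le_of_sq {p : ι → ℝ≥0∞} {b : ℝ≥0∞} (h : ∑' i, p i ^ 2 ≤ b ^ 2) : l2 p ≤ b :=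
  le_of_sq_le (by rwa [l2_sq])

lemma le_l2 (p : ι → ℝ≥0∞) (i : ι) : p i ≤ l2 p :=
  le_of_sq_le (by rw [l2_sq]; exact ENNReal.le_tsum i)

lemma tsum_mul_le_l2 (p q : ι → ℝ≥0∞) : ∑' i, p i * q i ≤ l2 p * l2 q := by
  rw [ENNReal.tsum_eq_iSup_sum]
  refine iSup_le fun s => ?_
  refine (ENNReal.inner_le_Lp_mul_Lq s p q Real.HolderConjugate.two_two).trans ?_
  unfold l2
  gcongr <;> exact_mod_cast ENNReal.sum_le_tsum s

/-- Minkowski's inequality: expand the square into a double sum and apply Cauchy–Schwarz to each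
pair. With values in `ℝ≥0∞` all interchanges of sums are free. -/
lemma l2_tsum_le (p : κ → ι → ℝ≥0∞) : l2 (fun i => ∑' k, p k i) ≤ ∑' k, l2 (p k) := by
  refine l2_le_of_sq ?_
  calc ∑' i, (∑' k, p k i) ^ 2 = ∑' i, ∑' k, ∑' l, p k i * p l i := by
        simp_rw [sq, ← ENNReal.tsum_mul_right, ← ENNReal.tsum_mul_left]
    _ = ∑' k, ∑' l, ∑' i, p k i * p l i := by
        rw [ENNReal.tsum_comm]; congr 1; ext k; rw [ENNReal.tsum_comm]
    _ ≤ ∑' k, ∑' l, l2 (p k) * l2 (p l) := by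
        gcongr; exact tsum_mul_le_l2 _ _
    _ = (∑' k, l2 (p k)) ^ 2 := by
        simp_rw [sq, ← ENNReal.tsum_mul_right, ← ENNReal.tsum_mul_left]

lemma l2_add_le (p q : ι → ℝ≥0∞) : l2 (fun i => p i + q i) ≤ l2 p + l2 q := by
  have := l2_tsum_le (fun (b : Bool) i => cond b (p i) (q i))
  simpa [tsum_bool, add_comm] using this

lemma l2_const_mul (c : ℝ≥0∞) (p : ι → ℝ≥0∞) : l2 (fun i => c * p i) = c * l2 p := by
  have h : l2 (fun i => c * p i) ^ 2 = (c * l2 p) ^ 2 := by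
    simp only [mul_pow, l2_sq, ENNReal.tsum_mul_left]
  exact le_antisymm (le_of_sq_le h.le) (le_of_sq_le h.ge)

lemma l2_comp_equiv (e : κ ≃ ι) (p : ι → ℝ≥0∞) : l2 (fun k => p (e k)) = l2 p := by
  unfold l2; congr 1; exact e.tsum_eq (fun i => p i ^ 2)

/-- Young's inequality `ℓ¹ * ℓ² → ℓ²`: the convolution is a superposition of translates of `q` with
weights `p k`, so Minkowski applies. -/
lemma l2_conv_le {G : Type*} [AddCommGroup G] (p q : G → ℝ≥0∞) :
    l2 (fun j => ∑' k, p (j - k) * q k) ≤ (∑' k, p k) * l2 q := by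
  have h : ∀ j, ∑' k, p (j - k) * q k = ∑' k, p k * q (j - k) := fun j =>
    (Equiv.subLeft j).tsum_eq (fun k => p k * q (j - k)) |>.symm.trans
      (by simp) |>.symm
  simp_rw [h]
  refine (l2_tsum_le _).trans (le_of_eq ?_)
  rw [← ENNReal.tsum_mul_right]
  congr 1; ext k
  rw [l2_const_mul]; congr 1
  exact l2_comp_equiv (Equiv.subRight k) q

end L2

end QHD
end

/-! ### Fourier coefficients of continuous functions on the torus -/

noncomputable section

namespace QHD

open scoped ENNReal ComplexConjugate
open UnitAddTorus

section Coef

local instance : MeasureSpace UnitAddCircle := ⟨AddCircle.haarAddCircle⟩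

local instance : IsProbabilityMeasure (volume : Measure UnitAddCircle) :=
  inferInstanceAs (IsProbabilityMeasure AddCircle.haarAddCircle)

variable {d : ℕ}

/-- The Fourier coefficients of a continuous function on the unit torus. -/
def coef (F : C(UnitAddTorus (Fin d), ℂ)) (j : Freq d) : ℂ := mFourierCoeff F j

lemma coef_eq_repr (F : C(UnitAddTorus (Fin d), ℂ)) (j : Freq d) :
    coef F j = mFourierBasis.repr (ContinuousMap.toLp 2 volume ℂ F) j := by
  rw [mFourierBasis_repr, mFourierCoeff_toLp, coef]

/-- The `j`-th Fourier coefficient as a continuous linear functional. -/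
def coefCLM (j : Freq d) : C(UnitAddTorus (Fin d), ℂ) →L[ℂ] ℂ :=
  LinearMap.mkContinuous
    { toFun := fun F => coef F j
      map_add' := fun F G => by simp [coef_eq_repr]
      map_smul' := fun c F => by simp [coef_eq_repr] }
    ‖(ContinuousMap.toLp 2 volume ℂ : C(UnitAddTorus (Fin d), ℂ) →L[ℂ] _)‖
    (fun F => by
      simp only [LinearMap.coe_mk, AddHom.coe_mk, coef_eq_repr]
      refine (lp.norm_apply_le_norm two_ne_zero _ j).trans ?_
      rw [LinearIsometryEquiv.norm_map]
      exact ContinuousLinearMap.le_opNorm _ _)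

@[simp] lemma coefCLM_apply (j : Freq d) (F : C(UnitAddTorus (Fin d), ℂ)) :
    coefCLM j F = coef F j := rfl

lemma coef_add (F G : C(UnitAddTorus (Fin d), ℂ)) (j : Freq d) :
    coef (F + G) j = coef F j + coef G j := map_add (coefCLM j) F G

lemma coef_smul (c : ℂ) (F : C(UnitAddTorus (Fin d), ℂ)) (j : Freq d) :
    coef (c • F) j = c * coef F j := map_smul (coefCLM j) c F

lemma coef_hasSum {ι : Type*} {F : ι → C(UnitAddTorus (Fin d), ℂ)}
    {G : C(UnitAddTorus (Fin d), ℂ)} (h : HasSum F G) (j : Freq d) :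
    HasSum (fun i => coef (F i) j) (coef G j) := (coefCLM j).hasSum h

lemma coef_mFourier_mul (k : Freq d) (G : C(UnitAddTorus (Fin d), ℂ)) (j : Freq d) :
    coef (mFourier k * G) j = coef G (j - k) := by
  unfold coef mFourierCoeff
  congr 1; ext t
  have : -(j - k) = -j + k := by abel
  rw [this, mFourier_add]
  simp [mul_assoc]

lemma coef_mFourier (k j : Freq d) :
    coef (mFourier k : C(UnitAddTorus (Fin d), ℂ)) j = if j = k then 1 else 0 := by
  have h := mFourierBasis.repr_self (𝕜 := ℂ) k
  rw [coe_mFourierBasis] at h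
  rw [coef_eq_repr]
  change (mFourierBasis.repr (mFourierLp 2 k)) j = _
  rw [h, lp.single_apply, Pi.single_apply]

lemma coef_one (j : Freq d) :
    coef (1 : C(UnitAddTorus (Fin d), ℂ)) j = if j = 0 then 1 else 0 := by
  rw [← mFourier_zero, coef_mFourier]

lemma coef_star (F : C(UnitAddTorus (Fin d), ℂ)) (j : Freq d) :
    coef (star F) j = conj (coef F (-j)) := by
  unfold coef mFourierCoeff
  rw [← integral_conj]
  congr 1; ext t
  simp [mFourier_neg]

lemma hasSum_coef {F : C(UnitAddTorus (Fin d), ℂ)} (h : Summable (coef F)) :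
    HasSum (fun k => coef F k • (mFourier k : C(UnitAddTorus (Fin d), ℂ))) F :=
  hasSum_mFourier_series_of_summable h

/-- Only `F` needs summable coefficients: its Fourier series converges uniformly, and multiplying by
`G` and taking a coefficient are continuous operations. -/
lemma hasSum_coef_mul {F : C(UnitAddTorus (Fin d), ℂ)} (h : Summable (coef F))
    (G : C(UnitAddTorus (Fin d), ℂ)) (j : Freq d) :
    HasSum (fun k => coef F (j - k) * coef G k) (coef (F * G) j) := by
  have h1 := coef_hasSum ((hasSum_coef h).mul_right G) j
  have h2 : ∀ k, coef (coef F k • (mFourier k : C(UnitAddTorus (Fin d), ℂ)) * G) j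
      = coef F k * coef G (j - k) := fun k => by
    rw [smul_mul_assoc, coef_smul, coef_mFourier_mul]
  simp_rw [h2] at h1
  rw [← (Equiv.subLeft j).hasSum_iff] at h1
  simpa [Function.comp_def] using h1

lemma tsum_enorm_coef_sq (F : C(UnitAddTorus (Fin d), ℂ)) :
    ∑' j, ‖coef F j‖ₑ ^ 2 = ENNReal.ofReal (∫ t : UnitAddTorus (Fin d), ‖F t‖ ^ 2) := by
  have h := hasSum_sq_mFourierCoeff (ContinuousMap.toLp 2 volume ℂ F)
  simp only [mFourierCoeff_toLp] at h
  have h2 : ∫ t : UnitAddTorus (Fin d), ‖(ContinuousMap.toLp 2 volume ℂ F) t‖ ^ 2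
      = ∫ t : UnitAddTorus (Fin d), ‖F t‖ ^ 2 := by
    refine integral_congr_ae ?_
    filter_upwards [ContinuousMap.coeFn_toLp (p := 2) (𝕜 := ℂ) volume F] with t ht
    rw [ht]
  rw [← h2, ← h.tsum_eq, ENNReal.ofReal_tsum_of_nonneg (fun _ => by positivity) h.summable]
  congr 1; ext j
  rw [ENNReal.ofReal_pow (norm_nonneg _), ofReal_norm, coef]

/-- By Parseval, the `ℓ²` norm of the coefficients sees only the modulus of the function. This is
why unimodular factors cost nothing at regularity zero. -/
lemma l2_coef_congr {F G : C(UnitAddTorus (Fin d), ℂ)} (h : ∀ t, ‖F t‖ = ‖G t‖) :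
    l2 (fun j => ‖coef F j‖ₑ) = l2 (fun j => ‖coef G j‖ₑ) := by
  unfold l2
  rw [tsum_enorm_coef_sq, tsum_enorm_coef_sq]
  simp_rw [h]

lemma l2_coef_unimodular {F : C(UnitAddTorus (Fin d), ℂ)} (h : ∀ t, ‖F t‖ = 1) :
    l2 (fun j => ‖coef F j‖ₑ) = 1 := by
  rw [l2_coef_congr (G := 1) (by simpa using h), l2]
  rw [tsum_eq_single 0 (fun j hj => by simp [coef_one, hj])]
  simp [coef_one]

lemma coef_zero_eq_integral (F : C(UnitAddTorus (Fin d), ℂ)) (j : Freq d) :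
    coef F j = ∫ x in {x : Fin d → ℝ | ∀ i, x i ∈ Set.Ioc (0 : ℝ) (0 + 1)},
      mFourier (-j) (fun i => (x i : UnitAddCircle)) * F (fun i => (x i : UnitAddCircle)) :=
  mFourierCoeff_eq_integral F j (fun _ => 0)

end Coef

/-- Multiplication by a unimodular function is an `ℓ²`-isometry on Fourier coefficients. -/
lemma l2_unimodular_conv_le {d : ℕ} {v : C(UnitAddTorus (Fin d), ℂ)} (hv : ∀ t, ‖v t‖ = 1)
    (hs : Summable (coef v)) (x : Freq d → ℂ) :
    l2 (fun j => ‖∑' k, coef v (j - k) * x k‖ₑ) ≤ l2 (fun k => ‖x k‖ₑ) := by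
  by_cases hx : l2 (fun k => ‖x k‖ₑ) = ⊤
  · rw [hx]; exact le_top
  have hxb : ∀ k, ‖x k‖ ≤ (l2 (fun k => ‖x k‖ₑ)).toReal := fun k => by
    have := ENNReal.toReal_mono hx (le_l2 (fun k => ‖x k‖ₑ) k)
    simpa using this
  have hsum : ∀ j, Summable fun k => coef v (j - k) * x k := fun j => by
    refine Summable.of_norm_bounded (g := fun k => ‖coef v (j - k)‖ *
      (l2 (fun k => ‖x k‖ₑ)).toReal)
      (((Equiv.subLeft j).summable_iff.2 hs.norm).mul_right _) (fun k => ?_)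
    rw [norm_mul]; gcongr; exact hxb k
  -- The sequence `x` is merely square summable and need not come from a continuous function, so
  -- Parseval is applied to its truncation to a finite set `B`, and `B` is then exhausted.
  have hfin : ∀ B : Finset (Freq d),
      ∑' j, ‖∑ k ∈ B, coef v (j - k) * x k‖ₑ ^ 2 ≤ l2 (fun k => ‖x k‖ₑ) ^ 2 := fun B => by
    let P : C(UnitAddTorus (Fin d), ℂ) := ∑ k ∈ B, x k • mFourier k
    have hP : ∀ j, coef P j = if j ∈ B then x j else 0 := fun j => by
      rw [← coefCLM_apply]; simp [P, coef_mFourier]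
    have hvP : ∀ j, coef (v * P) j = ∑ k ∈ B, coef v (j - k) * x k := fun j => by
      rw [← (hasSum_coef_mul hs P j).tsum_eq, tsum_eq_sum (s := B)]
      · exact Finset.sum_congr rfl fun k hk => by rw [hP, if_pos hk]
      · intro k hk; rw [hP, if_neg hk, mul_zero]
    simp_rw [← hvP]
    rw [← l2_sq (fun j => ‖coef (v * P) j‖ₑ), l2_coef_congr (G := P) (by simp [hv])]
    refine pow_le_pow_left₀ zero_le (l2_mono fun j => ?_) 2
    rw [hP]; split_ifs <;> simp
  refine l2_le_of_sq ?_
  rw [ENNReal.tsum_eq_iSup_sum]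
  refine iSup_le fun A => ?_
  have ht : Filter.Tendsto (fun B : Finset (Freq d) =>
      ∑ j ∈ A, ‖∑ k ∈ B, coef v (j - k) * x k‖ₑ ^ 2) Filter.atTop
      (nhds (∑ j ∈ A, ‖∑' k, coef v (j - k) * x k‖ₑ ^ 2)) := by
    refine tendsto_finsetSum _ fun j _ => ?_
    exact ((ENNReal.continuous_pow 2).comp continuous_enorm).continuousAt.tendsto.comp
      (hsum j).hasSum
  exact le_of_tendsto ht (Filter.Eventually.of_forall fun B =>
    (ENNReal.sum_le_tsum A).trans (hfin B))

end QHD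
end

/-! ### Japanese brackets and weighted `ℓ²` norms -/

noncomputable section

namespace QHD

open scoped ENNReal ComplexConjugate
open UnitAddTorus

section Bracket
variable {d : ℕ}

/-- The Euclidean length of a frequency. -/
def elen (j : Freq d) : ℝ := Real.sqrt (∑ i, (j i : ℝ) ^ 2)

lemma elen_eq_norm (j : Freq d) :
    elen j = ‖(WithLp.toLp 2 (fun i => (j i : ℝ)) : EuclideanSpace ℝ (Fin d))‖ := by
  simp [elen, EuclideanSpace.norm_eq]

lemma elen_nonneg (j : Freq d) : 0 ≤ elen j := Real.sqrt_nonneg _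

lemma elen_sq (j : Freq d) : elen j ^ 2 = ∑ i, (j i : ℝ) ^ 2 :=
  Real.sq_sqrt (Finset.sum_nonneg fun _ _ => sq_nonneg _)

lemma elen_add_le (j k : Freq d) : elen (j + k) ≤ elen j + elen k := by
  simp only [elen_eq_norm]
  refine le_trans (le_of_eq ?_) (norm_add_le _ _)
  congr 1; ext i; simp

lemma elen_neg (j : Freq d) : elen (-j) = elen j := by simp [elen]

lemma bracket_sq (j : Freq d) : bracket j ^ 2 = 1 + elen j ^ 2 := by
  rw [elen_sq, bracket, Real.sq_sqrt]
  exact add_nonneg zero_le_one (Finset.sum_nonneg fun _ _ => sq_nonneg _)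

lemma one_le_bracket (j : Freq d) : 1 ≤ bracket j := by
  rw [bracket, Real.one_le_sqrt]
  linarith [Finset.sum_nonneg (s := Finset.univ) fun i _ => sq_nonneg (j i : ℝ)]

lemma bracket_pos (j : Freq d) : 0 < bracket j := zero_lt_one.trans_le (one_le_bracket j)

lemma bracket_neg (j : Freq d) : bracket (-j) = bracket j := by simp [bracket]

lemma elen_le_bracket (j : Freq d) : elen j ≤ bracket j :=
  abs_le_of_sq_le_sq' (by rw [bracket_sq]; linarith) (bracket_pos j).le |>.2

lemma bracket_add_le' (j k : Freq d) : bracket (j + k) ≤ bracket j + elen k := by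
  refine abs_le_of_sq_le_sq' ?_ (add_nonneg (bracket_pos j).le (elen_nonneg k)) |>.2
  rw [bracket_sq]
  nlinarith [elen_add_le j k, elen_nonneg (j + k), elen_nonneg j, elen_nonneg k, bracket_sq j,
    mul_le_mul_of_nonneg_right (elen_le_bracket j) (elen_nonneg k)]

lemma bracket_add_le (j k : Freq d) : bracket (j + k) ≤ bracket j + bracket k :=
  (bracket_add_le' j k).trans (by linarith [elen_le_bracket k])

lemma abs_bracket_sub_le (j k : Freq d) : |bracket j - bracket k| ≤ elen (j - k) := by
  rw [abs_le]
  constructor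
  · have := bracket_add_le' j (k - j)
    rw [add_sub_cancel, ← neg_sub j k, elen_neg] at this
    linarith
  · have := bracket_add_le' k (j - k)
    rw [add_sub_cancel] at this
    linarith

lemma abs_coord_le_elen (j : Freq d) (i : Fin d) : |(j i : ℝ)| ≤ elen j := by
  refine Real.abs_le_sqrt ?_
  exact Finset.single_le_sum (f := fun i => (j i : ℝ) ^ 2) (fun _ _ => sq_nonneg _)
    (Finset.mem_univ i)

lemma one_le_elen {j : Freq d} (hj : j ≠ 0) : 1 ≤ elen j := by
  obtain ⟨i, hi⟩ := Function.ne_iff.1 hj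
  refine le_trans ?_ (abs_coord_le_elen j i)
  exact_mod_cast Int.one_le_abs hi

lemma summable_pi_prod {f : ℤ → ℝ} (hf : Summable f) (h0 : ∀ n, 0 ≤ f n) :
    Summable fun j : Freq d => ∏ i, f (j i) := by
  classical
  refine summable_of_sum_le (c := (∑' n, f n) ^ d)
    (fun j => Finset.prod_nonneg fun i _ => h0 _) fun u => ?_
  calc ∑ j ∈ u, ∏ i, f (j i)
      ≤ ∑ j ∈ Fintype.piFinset (fun i => u.image (fun j => j i)), ∏ i, f (j i) := by
        refine Finset.sum_le_sum_of_subset_of_nonneg (fun j hj => ?_)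
          fun _ _ _ => Finset.prod_nonneg fun i _ => h0 _
        exact Fintype.mem_piFinset.2 fun i => Finset.mem_image_of_mem _ hj
    _ = ∏ i, ∑ n ∈ u.image (fun j => j i), f n := (Finset.prod_univ_sum _ _).symm
    _ ≤ ∏ _i : Fin d, ∑' n, f n := by
        refine Finset.prod_le_prod (fun i _ => Finset.sum_nonneg fun _ _ => h0 _) fun i _ => ?_
        exact hf.sum_le_tsum _ fun _ _ => h0 _
    _ = _ := by simp

/-- Since `⟨j⟩²` dominates every `1 + j_i²`, the summand is below `∏ (1 + j_i²)⁻¹`, whose sum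
factorizes over the coordinates. -/
lemma summable_bracket : Summable fun j : Freq d => bracket j ^ (-(2 * d : ℝ)) := by
  have h1 : Summable fun n : ℤ => (1 + (n : ℝ) ^ 2)⁻¹ := by
    have h2 : Summable fun n : ℤ => 2 * (1 / (n : ℝ) ^ 2) :=
      (Real.summable_one_div_int_pow.2 one_lt_two).mul_left 2
    refine Summable.of_norm_bounded_eventually (g := fun n : ℤ => 2 * (1 / (n : ℝ) ^ 2)) h2 ?_
    rw [Filter.eventually_cofinite]
    refine (Set.finite_singleton (0 : ℤ)).subset fun n hn => ?_
    by_contra h0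
    refine hn ?_
    have : (n : ℝ) ≠ 0 := by exact_mod_cast h0
    have h3 : (0:ℝ) < (n : ℝ) ^ 2 := by positivity
    rw [Real.norm_of_nonneg (by positivity), mul_one_div, inv_eq_one_div,
      div_le_div_iff₀ (by positivity) h3]
    nlinarith
  refine (summable_pi_prod (d := d) h1 (fun n => by positivity)).of_nonneg_of_le
    (fun j => Real.rpow_nonneg (bracket_pos j).le _) fun j => ?_
  rw [Real.rpow_neg (bracket_pos j).le, Finset.prod_inv_distrib]
  refine inv_anti₀ (Finset.prod_pos fun i _ => by positivity) ?_
  rw [Real.rpow_mul (bracket_pos j).le, Real.rpow_natCast, Real.rpow_two]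
  calc ∏ i, (1 + (j i : ℝ) ^ 2) ≤ ∏ _i : Fin d, bracket j ^ 2 := by
        refine Finset.prod_le_prod (fun i _ => by positivity) fun i _ => ?_
        rw [bracket_sq]
        have := abs_coord_le_elen j i
        nlinarith [abs_nonneg (j i : ℝ), sq_abs (j i : ℝ)]
    _ = _ := by simp

end Bracket

section Rpow

lemma add_rpow_le {a b s : ℝ} (ha : 0 ≤ a) (hb : 0 ≤ b) (hs : 0 ≤ s) :
    (a + b) ^ s ≤ 2 ^ s * (a ^ s + b ^ s) := by
  have h1 : (a + b) ^ s ≤ (2 * max a b) ^ s :=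
    Real.rpow_le_rpow (by positivity) (by linarith [le_max_left a b, le_max_right a b]) hs
  rw [Real.mul_rpow zero_le_two (le_max_of_le_left ha)] at h1
  refine h1.trans (mul_le_mul_of_nonneg_left ?_ (by positivity))
  have := Real.rpow_nonneg ha s
  have := Real.rpow_nonneg hb s
  rcases max_choice a b with h | h <;> rw [h] <;> linarith

/-- Bernoulli's inequality for `(a/b)^s` plays the role of the mean value theorem. -/
lemma rpow_sub_rpow_le {a b s : ℝ} (ha : 0 < a) (hab : a ≤ b) (hs : 1 ≤ s) :
    b ^ s - a ^ s ≤ s * b ^ (s - 1) * (b - a) := by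
  have hb : 0 < b := ha.trans_le hab
  have h := one_add_mul_self_le_rpow_one_add (s := a / b - 1) (p := s)
    (by have := div_nonneg ha.le hb.le; linarith) hs
  rw [add_sub_cancel, Real.div_rpow ha.le hb.le, le_div_iff₀ (Real.rpow_pos_of_pos hb s)] at h
  have h2 : b ^ s = b ^ (s - 1) * b := by
    rw [← Real.rpow_add_one hb.ne']; ring_nf
  have h3 : (1 + s * (a / b - 1)) * b ^ s = b ^ s - s * b ^ (s - 1) * (b - a) := by
    rw [h2]; field_simp; ring
  linarith

lemma abs_rpow_sub_rpow_le {a b s : ℝ} (ha : 0 < a) (hb : 0 < b) (hs : 1 ≤ s) :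
    |b ^ s - a ^ s| ≤ s * max a b ^ (s - 1) * |b - a| := by
  rcases le_total a b with h | h
  · rw [max_eq_right h, abs_of_nonneg (sub_nonneg.2 h), abs_of_nonneg]
    · exact rpow_sub_rpow_le ha h hs
    · exact sub_nonneg.2 (Real.rpow_le_rpow ha.le h (by linarith))
  · rw [max_eq_left h, abs_sub_comm, abs_sub_comm b, abs_of_nonneg (sub_nonneg.2 h), abs_of_nonneg]
    · exact rpow_sub_rpow_le hb h hs
    · exact sub_nonneg.2 (Real.rpow_le_rpow hb.le h (by linarith))

end Rpow

section Weighted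
variable {d : ℕ}

/-- The Sobolev weight `⟨j⟩^a` as an extended nonnegative real. -/
def wt (a : ℝ) (j : Freq d) : ℝ≥0∞ := ENNReal.ofReal (bracket j ^ a)

/-- The weighted `ℓ²` norm of a family of Fourier coefficients. -/
def wl2 (a : ℝ) (u : Freq d → ℂ) : ℝ≥0∞ := l2 fun j => wt a j * ‖u j‖ₑ

lemma wt_zero (j : Freq d) : wt 0 j = 1 := by simp [wt]

lemma wt_mono {a b : ℝ} (h : a ≤ b) (j : Freq d) : wt a j ≤ wt b j :=
  ENNReal.ofReal_le_ofReal (Real.rpow_le_rpow_of_exponent_le (one_le_bracket j) h)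

lemma wt_neg (a : ℝ) (j : Freq d) : wt a (-j) = wt a j := by simp [wt, bracket_neg]

lemma wt_mul_wt (a b : ℝ) (j : Freq d) : wt a j * wt b j = wt (a + b) j := by
  rw [wt, wt, wt, ← ENNReal.ofReal_mul (Real.rpow_nonneg (bracket_pos j).le _),
    Real.rpow_add (bracket_pos j)]

lemma one_le_wt {a : ℝ} (ha : 0 ≤ a) (j : Freq d) : 1 ≤ wt a j := by
  rw [← wt_zero j]; exact wt_mono ha j

lemma wl2_mono {a b : ℝ} (h : a ≤ b) (u : Freq d → ℂ) : wl2 a u ≤ wl2 b u :=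
  l2_mono fun j => by gcongr; exact wt_mono h j

lemma wl2_zero (u : Freq d → ℂ) : wl2 0 u = l2 fun j => ‖u j‖ₑ := by simp [wl2, wt_zero]

/-- The constant `(∑ ⟨j⟩^{-2d})^{1/2}` of the embedding of `H^d` into the Wiener algebra. -/
def wienerConst (d : ℕ) : ℝ≥0∞ := l2 (wt (d := d) (-d))

lemma wienerConst_ne_top : wienerConst d ≠ ⊤ := by
  refine ENNReal.rpow_ne_top_of_nonneg (by norm_num) ?_
  have h : ∀ j : Freq d, wt (-d) j ^ 2 = ENNReal.ofReal (bracket j ^ (-(2 * d : ℝ))) := fun j => by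
    rw [sq, wt_mul_wt, wt]; ring_nf
  simp_rw [h]
  exact summable_bracket.tsum_ofReal_ne_top

lemma tsum_le_wl2 (u : Freq d → ℂ) : ∑' j, ‖u j‖ₑ ≤ wienerConst d * wl2 d u := by
  refine le_trans (le_of_eq ?_) (tsum_mul_le_l2 _ _)
  congr 1; ext j
  rw [← mul_assoc, wt_mul_wt, neg_add_cancel, wt_zero, one_mul]

lemma tsum_wt_le_wl2 (a : ℝ) (u : Freq d → ℂ) :
    ∑' j, wt a j * ‖u j‖ₑ ≤ wienerConst d * wl2 (a + d) u := by
  refine le_trans (le_of_eq ?_) (tsum_mul_le_l2 _ _)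
  congr 1; ext j
  rw [← mul_assoc, wt_mul_wt]; congr 2; ring

lemma summable_of_wl2 {a : ℝ} (ha : d ≤ a) {u : Freq d → ℂ} (h : wl2 a u ≠ ⊤) : Summable u := by
  refine Summable.of_norm ?_
  have h1 : ∑' j, ‖u j‖ₑ ≠ ⊤ := ne_top_of_le_ne_top
    (ENNReal.mul_ne_top wienerConst_ne_top (ne_top_of_le_ne_top h (wl2_mono ha u))) (tsum_le_wl2 u)
  simpa using ENNReal.summable_toReal h1

lemma wt_sub_add_le {s : ℝ} (hs : 0 ≤ s) (j k : Freq d) :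
    wt s j ≤ ENNReal.ofReal (2 ^ s) * (wt s (j - k) + wt s k) := by
  unfold wt
  rw [← ENNReal.ofReal_add (Real.rpow_nonneg (bracket_pos _).le _)
    (Real.rpow_nonneg (bracket_pos _).le _), ← ENNReal.ofReal_mul (by positivity)]
  refine ENNReal.ofReal_le_ofReal (le_trans ?_
    (add_rpow_le (bracket_pos _).le (bracket_pos _).le hs))
  refine Real.rpow_le_rpow (bracket_pos _).le ?_ hs
  simpa using bracket_add_le (j - k) k

/-- This is the symbol of the commutator of `⟨D⟩^s` with a multiplication: whenever the weight falls
on the frequency `k`, one power of `⟨k⟩` is gained. -/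
lemma abs_weight_sub_le {s : ℝ} (hs : 1 ≤ s) (j k : Freq d) :
    |bracket j ^ s - bracket k ^ s| ≤ s * 2 ^ (s - 1) *
      (bracket (j - k) ^ s + bracket (j - k) * bracket k ^ (s - 1)) := by
  have hB := bracket_pos (j - k)
  have hk := bracket_pos k
  have h1 := abs_rpow_sub_rpow_le (bracket_pos k) (bracket_pos j) hs
  have h2 : |bracket j - bracket k| ≤ bracket (j - k) :=
    (abs_bracket_sub_le j k).trans (elen_le_bracket _)
  have h3 : max (bracket k) (bracket j) ≤ bracket (j - k) + bracket k :=
    max_le (by linarith) (by simpa using bracket_add_le (j - k) k)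
  have h4 : max (bracket k) (bracket j) ^ (s - 1) ≤
      2 ^ (s - 1) * (bracket (j - k) ^ (s - 1) + bracket k ^ (s - 1)) :=
    (Real.rpow_le_rpow (le_max_of_le_left (bracket_pos k).le) h3 (by linarith)).trans
      (add_rpow_le hB.le (bracket_pos _).le (by linarith))
  have h5 : bracket (j - k) ^ s = bracket (j - k) ^ (s - 1) * bracket (j - k) := by
    rw [← Real.rpow_add_one hB.ne']; ring_nf
  calc _ ≤ s * (2 ^ (s - 1) * (bracket (j - k) ^ (s - 1) + bracket k ^ (s - 1))) *
        bracket (j - k) := by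
        refine h1.trans ?_; gcongr
    _ = _ := by rw [h5]; ring

end Weighted

end QHD
end

/-! ### Sobolev norms: algebra property and powers of unimodular functions -/

noncomputable section

namespace QHD

open scoped ENNReal ComplexConjugate
open UnitAddTorus

section Sob
variable {d : ℕ}

/-- The Sobolev norm of a continuous function on the unit torus. -/
def sob (a : ℝ) (F : C(UnitAddTorus (Fin d), ℂ)) : ℝ≥0∞ := wl2 a (coef F)

lemma sob_add_le (a : ℝ) (F G : C(UnitAddTorus (Fin d), ℂ)) :
    sob a (F + G) ≤ sob a F + sob a G := by
  refine le_trans (l2_mono fun j => ?_) (l2_add_le _ _)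
  rw [coef_add, ← mul_add]; gcongr; exact enorm_add_le _ _

lemma sob_smul (a : ℝ) (c : ℂ) (F : C(UnitAddTorus (Fin d), ℂ)) :
    sob a (c • F) = ‖c‖ₑ * sob a F := by
  unfold sob wl2
  rw [← l2_const_mul]
  congr 1; ext j
  rw [coef_smul, enorm_mul]; ring

lemma sob_star (a : ℝ) (F : C(UnitAddTorus (Fin d), ℂ)) : sob a (star F) = sob a F := by
  unfold sob wl2
  rw [← l2_comp_equiv (Equiv.neg (Freq d))]
  congr 1; ext j
  rw [Equiv.neg_apply, coef_star, neg_neg, wt_neg, RCLike.enorm_conj]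

lemma sob_one (a : ℝ) : sob a (1 : C(UnitAddTorus (Fin d), ℂ)) = 1 := by
  unfold sob wl2 l2
  rw [tsum_eq_single 0 (fun j hj => by simp [coef_one, hj])]
  simp [coef_one, wt, bracket]

lemma sob_tsum_le {ι : Type*} (a : ℝ) {F : ι → C(UnitAddTorus (Fin d), ℂ)}
    {G : C(UnitAddTorus (Fin d), ℂ)} (h : HasSum F G) : sob a G ≤ ∑' i, sob a (F i) := by
  refine le_trans (l2_mono fun j => ?_) (l2_tsum_le _)
  rw [ENNReal.tsum_mul_left]
  gcongr
  rw [← (coef_hasSum h j).tsum_eq]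
  exact enorm_tsum_le_tsum_enorm

lemma summable_coef {a : ℝ} (ha : d ≤ a) {F : C(UnitAddTorus (Fin d), ℂ)} (h : sob a F ≠ ⊤) :
    Summable (coef F) := summable_of_wl2 ha h

/-- Absolute convergence of the Fourier series through the Wiener algebra. The maximum with `1`
keeps the constant nonzero, so that the bound survives when the Sobolev norm is `⊤`. -/
lemma norm_le_sob {a : ℝ} (ha : d ≤ a) (F : C(UnitAddTorus (Fin d), ℂ)) :
    ‖F‖ₑ ≤ max 1 (wienerConst d) * sob a F := by
  by_cases h : sob a F = ⊤
  · rw [h, ENNReal.mul_top (by simp)]; exact le_top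
  refine (congrArg (fun G => ‖G‖ₑ) (hasSum_coef (summable_coef ha h)).tsum_eq).ge.trans ?_
  refine (enorm_tsum_le_tsum_enorm
    (f := fun k => coef F k • (mFourier k : C(UnitAddTorus (Fin d), ℂ)))).trans ?_
  have : ∀ k, ‖coef F k • (mFourier k : C(UnitAddTorus (Fin d), ℂ))‖ₑ = ‖coef F k‖ₑ := fun k => by
    rw [enorm_smul, ← ofReal_norm (mFourier k), mFourier_norm]
    simp
  simp_rw [this]
  refine (tsum_le_wl2 _).trans ?_
  gcongr
  · exact le_max_right _ _
  · exact wl2_mono ha _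

/-- The constant in the algebra property of `H^s`. -/
def algConst (d : ℕ) (s : ℝ) : ℝ≥0∞ := ENNReal.ofReal (2 ^ s) * (2 * wienerConst d) + 1

lemma algConst_ne_top (s : ℝ) : algConst d s ≠ ⊤ := by
  have := wienerConst_ne_top (d := d)
  unfold algConst
  finiteness

/-- The weight `⟨j⟩^s` is distributed on the two factors by `wt_sub_add_le`; the factor left without
weight is measured in `ℓ¹`, the other in `ℓ²`. -/
lemma sob_mul_le {s : ℝ} (hs : d ≤ s) {F G : C(UnitAddTorus (Fin d), ℂ)} (hF : sob s F ≠ ⊤) :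
    sob s (F * G) ≤ algConst d s * (sob s F * sob s G) := by
  have hs0 : 0 ≤ s := le_trans (by positivity) hs
  have key : ∀ j, wt s j * ‖coef (F * G) j‖ₑ ≤ ENNReal.ofReal (2 ^ s) *
      ((∑' k, ‖coef G (j - k)‖ₑ * (wt s k * ‖coef F k‖ₑ)) +
        ∑' k, ‖coef F (j - k)‖ₑ * (wt s k * ‖coef G k‖ₑ)) := fun j => by
    have h0 : ∑' k, ‖coef G (j - k)‖ₑ * (wt s k * ‖coef F k‖ₑ) =
        ∑' k, ‖coef G k‖ₑ * (wt s (j - k) * ‖coef F (j - k)‖ₑ) := by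
      rw [← (Equiv.subLeft j).tsum_eq]; simp
    rw [h0, ← ENNReal.tsum_add, ← ENNReal.tsum_mul_left,
      ← (hasSum_coef_mul (summable_coef hs hF) G j).tsum_eq]
    refine (mul_le_mul_right enorm_tsum_le_tsum_enorm _).trans ?_
    rw [← ENNReal.tsum_mul_left]
    refine ENNReal.tsum_le_tsum fun k => ?_
    rw [enorm_mul]
    refine (mul_le_mul_left (wt_sub_add_le hs0 j k) _).trans (le_of_eq ?_)
    ring
  refine (l2_mono key).trans ?_
  rw [l2_const_mul]
  refine (mul_le_mul_right (l2_add_le _ _) _).trans ?_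
  have h1 := l2_conv_le (fun k => ‖coef G k‖ₑ) (fun k => wt s k * ‖coef F k‖ₑ)
  have h2 := l2_conv_le (fun k => ‖coef F k‖ₑ) (fun k => wt s k * ‖coef G k‖ₑ)
  have h3 := (tsum_le_wl2 (coef G)).trans (mul_le_mul_right (wl2_mono hs _) _)
  have h4 := (tsum_le_wl2 (coef F)).trans (mul_le_mul_right (wl2_mono hs _) _)
  calc _ ≤ ENNReal.ofReal (2 ^ s) * ((wienerConst d * sob s G) * sob s F +
        (wienerConst d * sob s F) * sob s G) := by
        gcongr
        · exact h1.trans (mul_le_mul_left h3 _)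
        · exact h2.trans (mul_le_mul_left h4 _)
    _ = ENNReal.ofReal (2 ^ s) * (2 * wienerConst d) * (sob s F * sob s G) := by ring
    _ ≤ _ := by unfold algConst; gcongr; exact le_self_add

/-- Multiplying by a unimodular function of class `H^s` costs only a lower order term. -/
lemma sob_unimodular_mul_le {s : ℝ} (hs : d + 1 ≤ s) :
    ∃ C : ℝ≥0∞, C ≠ ⊤ ∧ ∀ v w : C(UnitAddTorus (Fin d), ℂ), (∀ t, ‖v t‖ = 1) → sob s v ≠ ⊤ →
      sob s w ≠ ⊤ → sob s (v * w) ≤ sob s w + C * sob s v * sob (s - 1) w := by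
  set A : ℝ≥0∞ := ENNReal.ofReal (s * 2 ^ (s - 1)) with hA
  have hs1 : 1 ≤ s := by linarith [(Nat.cast_nonneg d : (0:ℝ) ≤ d)]
  refine ⟨A * (wienerConst d + wienerConst d), by
    have := wienerConst_ne_top (d := d); finiteness, fun v w hv hvs hws => ?_⟩
  have hsv := summable_coef (by linarith) hvs
  have hsw := summable_coef (by linarith) hws
  have hbd : ∀ x : Freq d → ℂ, wl2 0 x ≠ ⊤ → ∀ j, Summable fun k => coef v (j - k) * x k := by
    intro x hx j
    have hxb : ∀ k, ‖x k‖ ≤ (wl2 0 x).toReal := fun k => by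
      have := ENNReal.toReal_mono hx ((le_l2 (fun k => ‖x k‖ₑ) k).trans (wl2_zero x).ge)
      simpa using this
    refine Summable.of_norm_bounded (g := fun k => ‖coef v (j - k)‖ * (wl2 0 x).toReal)
      (((Equiv.subLeft j).summable_iff.2 hsv.norm).mul_right _) (fun k => ?_)
    rw [norm_mul]; gcongr; exact hxb k
  -- The sequence `x` represents `⟨D⟩^s w`. Convolution with `v` contracts it in `ℓ²`, which gives
  -- the leading constant exactly `1`; what remains is the commutator of `⟨D⟩^s` with `v`.
  let x : Freq d → ℂ := fun k => ((bracket k ^ s : ℝ) : ℂ) * coef w k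
  have hxe : ∀ k, ‖x k‖ₑ = wt s k * ‖coef w k‖ₑ := fun k => by
    simp only [x, enorm_mul, wt]
    congr 1
    rw [← ofReal_norm, Complex.norm_real, Real.norm_of_nonneg (Real.rpow_nonneg (bracket_pos _).le _)]
  have hx0 : wl2 0 x = sob s w := by rw [wl2_zero]; simp_rw [hxe]; rfl
  have hxs := hbd x (by rw [hx0]; exact hws)
  have key : ∀ j, wt s j * ‖coef (v * w) j‖ₑ ≤ ‖∑' k, coef v (j - k) * x k‖ₑ +
      A * ((∑' k, ‖coef w (j - k)‖ₑ * (wt s k * ‖coef v k‖ₑ)) +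
        ∑' k, (wt 1 (j - k) * ‖coef v (j - k)‖ₑ) * (wt (s - 1) k * ‖coef w k‖ₑ)) := fun j => by
    have h0 : ∑' k, ‖coef w (j - k)‖ₑ * (wt s k * ‖coef v k‖ₑ) =
        ∑' k, ‖coef w k‖ₑ * (wt s (j - k) * ‖coef v (j - k)‖ₑ) := by
      rw [← (Equiv.subLeft j).tsum_eq]; simp
    have hm := hasSum_coef_mul hsv w j
    have h1 : wt s j * ‖coef (v * w) j‖ₑ = ‖((bracket j ^ s : ℝ) : ℂ) * coef (v * w) j‖ₑ := by
      rw [enorm_mul, wt]; congr 1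
      rw [← ofReal_norm, Complex.norm_real,
        Real.norm_of_nonneg (Real.rpow_nonneg (bracket_pos _).le _)]
    have h2 : ((bracket j ^ s : ℝ) : ℂ) * coef (v * w) j = (∑' k, coef v (j - k) * x k) +
        ∑' k, (((bracket j ^ s - bracket k ^ s : ℝ)) : ℂ) * (coef v (j - k) * coef w k) := by
      rw [← hm.tsum_eq, ← tsum_mul_left]
      rw [← sub_eq_iff_eq_add', ← (hm.summable.mul_left _).tsum_sub (hxs j)]
      congr 1; ext k; simp only [x]; push_cast; ring
    rw [h1, h2]
    refine (enorm_add_le _ _).trans (add_le_add_right ?_ _)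
    rw [h0, ← ENNReal.tsum_add, ← ENNReal.tsum_mul_left]
    refine enorm_tsum_le_tsum_enorm.trans (ENNReal.tsum_le_tsum fun k => ?_)
    rw [enorm_mul, enorm_mul]
    have h3 : ‖(((bracket j ^ s - bracket k ^ s : ℝ)) : ℂ)‖ₑ ≤
        A * (wt s (j - k) + wt 1 (j - k) * wt (s - 1) k) := by
      have hb1 := bracket_pos (j - k)
      have hb2 := bracket_pos k
      rw [← ofReal_norm, Complex.norm_real, Real.norm_eq_abs, hA, wt, wt, wt,
        ← ENNReal.ofReal_mul (by positivity), ← ENNReal.ofReal_add (by positivity) (by positivity),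
        ← ENNReal.ofReal_mul (by positivity)]
      refine ENNReal.ofReal_le_ofReal ?_
      rw [Real.rpow_one]
      exact abs_weight_sub_le hs1 j k
    refine (mul_le_mul_left h3 _).trans (le_of_eq ?_)
    ring
  have hl1 := l2_conv_le (fun k => ‖coef w k‖ₑ) (fun k => wt s k * ‖coef v k‖ₑ)
  have hl2 := l2_conv_le (fun k => wt 1 k * ‖coef v k‖ₑ) (fun k => wt (s - 1) k * ‖coef w k‖ₑ)
  have h3 := (tsum_le_wl2 (coef w)).trans
    (mul_le_mul_right (wl2_mono (by linarith : (d:ℝ) ≤ s - 1) _) _)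
  have h4 := (tsum_wt_le_wl2 1 (coef v)).trans
    (mul_le_mul_right (wl2_mono (by linarith : 1 + (d:ℝ) ≤ s) _) _)
  calc sob s (v * w) ≤ _ := l2_mono key
    _ ≤ l2 (fun j => ‖∑' k, coef v (j - k) * x k‖ₑ) + _ := l2_add_le _ _
    _ ≤ sob s w + A * ((wienerConst d * sob (s - 1) w) * sob s v +
        (wienerConst d * sob s v) * sob (s - 1) w) := by
        gcongr
        · refine (l2_unimodular_conv_le hv hsv x).trans (le_of_eq ?_)
          rw [← hx0, wl2_zero]
        · rw [l2_const_mul]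
          gcongr
          refine (l2_add_le _ _).trans (add_le_add ?_ ?_)
          · exact hl1.trans (mul_le_mul_left h3 _)
          · exact hl2.trans (mul_le_mul_left h4 _)
    _ = _ := by ring

/-- Interpolation by splitting frequencies at `⟨j⟩ = 1/η`: above it one power of the bracket is
worth a factor `η`, below it the weight is at most `η^{1-s}`. -/
lemma sob_sub_one_le {s η : ℝ} (hs : 1 ≤ s) (hη : 0 < η) (F : C(UnitAddTorus (Fin d), ℂ)) :
    sob (s - 1) F ≤ ENNReal.ofReal η * sob s F + ENNReal.ofReal (η ^ (1 - s)) * sob 0 F := by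
  unfold sob wl2
  rw [← l2_const_mul, ← l2_const_mul]
  refine le_trans (l2_mono fun j => ?_) (l2_add_le _ _)
  rw [← mul_assoc, ← mul_assoc, ← add_mul]
  gcongr
  have hb := bracket_pos j
  rw [wt_zero, mul_one, wt, wt, ← ENNReal.ofReal_mul hη.le,
    ← ENNReal.ofReal_add (by positivity) (by positivity)]
  refine ENNReal.ofReal_le_ofReal ?_
  have e1 : bracket j ^ s = bracket j ^ (s - 1) * bracket j := by
    rw [← Real.rpow_add_one hb.ne']; ring_nf
  have p1 : 0 < bracket j ^ (s - 1) := Real.rpow_pos_of_pos hb _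
  have p2 : 0 < η ^ (1 - s) := Real.rpow_pos_of_pos hη _
  rcases le_total 1 (η * bracket j) with h | h
  · rw [e1]; nlinarith
  · have : bracket j ^ (s - 1) ≤ (η⁻¹) ^ (s - 1) :=
      Real.rpow_le_rpow hb.le (by rw [← one_div, le_div_iff₀ hη]; linarith) (by linarith)
    rw [Real.inv_rpow hη.le, ← Real.rpow_neg hη.le, neg_sub] at this
    have : 0 ≤ η * bracket j ^ s := by positivity
    linarith

/-- The powers of a unimodular function grow at most polynomially in `H^s`. -/
lemma sob_unimodular_pow_le {s : ℝ} (hs : d + 1 ≤ s) (R : ℝ≥0∞) (hR : R ≠ ⊤) :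
    ∃ B : ℕ, ∀ v : C(UnitAddTorus (Fin d), ℂ), (∀ t, ‖v t‖ = 1) → sob s v ≤ R →
      ∀ n : ℕ, sob s (v ^ n) ≤ ENNReal.ofReal (((n : ℝ) + 1) ^ B) := by
  obtain ⟨C, hC, hmul⟩ := sob_unimodular_mul_le (d := d) hs
  have hs1 : 1 ≤ s := by linarith [(Nat.cast_nonneg d : (0:ℝ) ≤ d)]
  obtain ⟨D, hD⟩ := ENNReal.exists_nat_gt (ENNReal.mul_ne_top hC hR)
  obtain ⟨S, hS⟩ := exists_nat_ge s
  -- With `η = 1/(n+1)` and `‖v^n‖` equal to `1` at regularity zero, the norms satisfy `a_{n+1} ≤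
  -- a_n + D (a_n/(n+1) + (n+1)^{s-1})`. An exponent that is at least `2D` and at least `s` closes
  -- the induction, by Bernoulli's inequality for `(1 + 1/(n+1))^B`.
  refine ⟨2 * D + S, fun v hv hvR n => ?_⟩
  have hun : ∀ n : ℕ, ∀ t, ‖(v ^ n) t‖ = 1 := fun n t => by simp [hv]
  induction n with
  | zero => simp [sob_one]
  | succ n ih =>
    have hfin : sob s (v ^ n) ≠ ⊤ := ne_top_of_le_ne_top ENNReal.ofReal_ne_top ih
    have h1 := hmul v (v ^ n) hv (ne_top_of_le_ne_top hR hvR) hfin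
    have hn : (0:ℝ) < n + 1 := by positivity
    have h2 := sob_sub_one_le hs1 (inv_pos.2 hn) (v ^ n)
    have h3 : sob 0 (v ^ n) = 1 := by
      rw [sob, wl2_zero]; exact l2_coef_unimodular (hun n)
    rw [h3, mul_one] at h2
    rw [pow_succ']
    calc sob s (v * v ^ n) ≤ sob s (v ^ n) + D * sob (s - 1) (v ^ n) := by
          refine h1.trans ?_
          gcongr
          exact (mul_le_mul_right hvR C).trans hD.le
      _ ≤ ENNReal.ofReal (((n : ℝ) + 1) ^ (2 * D + S)) + D * (ENNReal.ofReal (((n:ℝ) + 1)⁻¹) *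
          ENNReal.ofReal (((n : ℝ) + 1) ^ (2 * D + S)) +
            ENNReal.ofReal ((((n:ℝ) + 1)⁻¹) ^ (1 - s))) := by
          gcongr
          refine h2.trans ?_
          gcongr
      _ = ENNReal.ofReal (((n : ℝ) + 1) ^ (2 * D + S) + D * (((n:ℝ) + 1)⁻¹ *
          ((n : ℝ) + 1) ^ (2 * D + S) + (((n:ℝ) + 1)⁻¹) ^ (1 - s))) := by
          rw [← ENNReal.ofReal_mul (by positivity), ← ENNReal.ofReal_add (by positivity)
            (by positivity), ← ENNReal.ofReal_natCast D, ← ENNReal.ofReal_mul (by positivity),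
            ← ENNReal.ofReal_add (by positivity) (by positivity)]
      _ ≤ _ := by
          refine ENNReal.ofReal_le_ofReal ?_
          push_cast
          set m : ℝ := (n : ℝ) + 1 with hm
          have hm1 : 1 ≤ m := by rw [hm]; linarith [(Nat.cast_nonneg n : (0:ℝ) ≤ n)]
          set b : ℕ := 2 * D + S with hb
          have e1 : (m⁻¹) ^ (1 - s) = m ^ (s - 1) := by
            rw [Real.inv_rpow hn.le, ← Real.rpow_neg hn.le, neg_sub]
          have e2 : m ^ (s - 1) ≤ m⁻¹ * m ^ b := by
            rw [← Real.rpow_natCast, ← Real.rpow_neg_one, ← Real.rpow_add hn]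
            refine Real.rpow_le_rpow_of_exponent_le hm1 ?_
            have : (S:ℝ) ≤ b := by rw [hb]; push_cast; linarith [(Nat.cast_nonneg D : (0:ℝ) ≤ D)]
            linarith
          have e3 := one_add_mul_le_pow (a := m⁻¹) (by have := inv_pos.2 hn; linarith) b
          have e4 : (1 + m⁻¹) ^ b * m ^ b = (m + 1) ^ b := by
            rw [← mul_pow]; congr 1; field_simp
          have e5 : (2 * D : ℝ) ≤ b := by rw [hb]; push_cast; linarith [(Nat.cast_nonneg S : (0:ℝ) ≤ S)]
          have pm : 0 < m⁻¹ * m ^ b := by positivity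
          rw [e1, ← e4]
          have e6 := mul_le_mul_of_nonneg_right e3 (pow_nonneg hn.le b)
          have e7 := mul_le_mul_of_nonneg_right e5 pm.le
          have e8 := mul_le_mul_of_nonneg_left e2 (Nat.cast_nonneg D : (0:ℝ) ≤ D)
          nlinarith
end Sob

end QHD
end

/-! ### Composition with smooth functions in `H^s` -/

noncomputable section

namespace QHD

open scoped ENNReal ComplexConjugate
open UnitAddTorus

section FuncCalc

lemma neg_pi_lt : -Real.pi < -Real.pi + 2 * Real.pi := by linarith [Real.pi_pos]

/-- Fourier coefficients of a smooth function supported inside a period decay rapidly. -/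
lemma fourierCoeffOn_decay (m : ℕ) : ∀ f : ℝ → ℂ, ContDiff ℝ ∞ f → (∀ x, 2 < |x| → f x = 0) →
    ∃ K : ℝ, ∀ n : ℤ, n ≠ 0 → ‖fourierCoeffOn neg_pi_lt f n‖ ≤ K / |(n : ℝ)| ^ m := by
  induction m with
  | zero =>
    intro f hf _
    obtain ⟨M, hM⟩ := (isCompact_Icc (a := -Real.pi) (b := -Real.pi + 2 * Real.pi)).exists_bound_of_continuousOn
      hf.continuous.continuousOn
    refine ⟨M, fun n _ => ?_⟩
    rw [fourierCoeffOn_eq_integral, pow_zero, div_one, norm_smul]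
    have h1 := intervalIntegral.norm_integral_le_of_norm_le_const (a := -Real.pi)
      (b := -Real.pi + 2 * Real.pi) (C := M)
      (f := fun x : ℝ => (fourier (-n)) (x : AddCircle (-Real.pi + 2 * Real.pi - -Real.pi)) • f x)
      (fun x hx => by
        rw [Set.uIoc_of_le neg_pi_lt.le] at hx
        rw [norm_smul, fourier_apply, Circle.norm_coe, one_mul]
        exact hM x ⟨hx.1.le, hx.2⟩)
    have h2 : -Real.pi + 2 * Real.pi - -Real.pi = 2 * Real.pi := by ring
    rw [h2] at h1 ⊢
    rw [abs_of_pos Real.two_pi_pos] at h1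
    rw [Real.norm_of_nonneg (by positivity)]
    calc _ ≤ 1 / (2 * Real.pi) * (M * (2 * Real.pi)) := by gcongr
      _ = M := by field_simp
  | succ m ih =>
    intro f hf h0
    rw [contDiff_infty_iff_deriv] at hf
    have h0' : ∀ x, 2 < |x| → deriv f x = 0 := fun x hx => by
      have : f =ᶠ[nhds x] fun _ => 0 := by
        filter_upwards [(isOpen_lt continuous_const continuous_abs).mem_nhds hx] with y hy
        exact h0 y hy
      rw [this.deriv_eq, deriv_const]
    obtain ⟨K, hK⟩ := ih _ hf.2 h0'
    refine ⟨K, fun n hn => ?_⟩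
    have hpi := Real.pi_gt_three
    -- Integration by parts; the boundary terms vanish because `±π` lie outside the support, as `π >
    -- 2`.
    rw [fourierCoeffOn_of_hasDerivAt neg_pi_lt hn (fun x _ => (hf.1 x).hasDerivAt)
      (hf.2.continuous.intervalIntegrable _ _), h0 (-Real.pi) (by rw [abs_neg, abs_of_pos] <;> linarith),
      h0 (-Real.pi + 2 * Real.pi) (by rw [abs_of_pos] <;> linarith)]
    have hnR : (0:ℝ) < |(n : ℝ)| := by positivity
    have e : (1 / (-2 * (Real.pi : ℂ) * Complex.I * n) * ((fourier (-n))
        ((-Real.pi : ℝ) : AddCircle (-Real.pi + 2 * Real.pi - -Real.pi)) * ((0:ℂ) - 0) -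
        (((-Real.pi + 2 * Real.pi : ℝ) : ℂ) - ((-Real.pi : ℝ) : ℂ)) *
          fourierCoeffOn neg_pi_lt (deriv f) n)) =
        (1 / (Complex.I * n)) * fourierCoeffOn neg_pi_lt (deriv f) n := by
      have : (n : ℂ) ≠ 0 := by exact_mod_cast hn
      have : (Real.pi : ℂ) ≠ 0 := by exact_mod_cast Real.pi_ne_zero
      push_cast
      field_simp
      ring
    rw [e, norm_mul, norm_div, norm_mul, Complex.norm_I, norm_one, one_mul, Complex.norm_intCast,
      pow_succ, mul_comm, div_mul_eq_div_div]
    have := hK n hn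
    rw [mul_one_div]
    gcongr

/-- The support lies inside one period, so the periodic extension of `f` agrees with `f` on `[-2,
2]`. Decay of order `B + 2` absorbs the weight of degree `B` and leaves a summable `n⁻²`. -/
lemma exists_exp_series {f : ℝ → ℂ} (hf : ContDiff ℝ ∞ f) (h0 : ∀ x, 2 < |x| → f x = 0) (B : ℕ) :
    ∃ c : ℤ → ℂ, (Summable fun n : ℤ => ‖c n‖ * (|(n : ℝ)| + 1) ^ B) ∧
      ∀ x : ℝ, |x| ≤ 2 → HasSum (fun n : ℤ => c n * Complex.exp (Complex.I * n * x)) (f x) := by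
  have hpi := Real.pi_gt_three
  obtain ⟨K, hK⟩ := fourierCoeffOn_decay (B + 2) f hf h0
  have hs : Summable fun n : ℤ => ‖fourierCoeffOn neg_pi_lt f n‖ * (|(n : ℝ)| + 1) ^ B := by
    refine Summable.of_norm_bounded_eventually (g := fun n : ℤ => |K| * 2 ^ B * (1 / (n : ℝ) ^ 2))
      ((Real.summable_one_div_int_pow.2 one_lt_two).mul_left _) ?_
    rw [Filter.eventually_cofinite]
    refine (Set.finite_singleton (0 : ℤ)).subset fun n hn => ?_
    by_contra hn0
    refine hn ?_
    have hn1 : (1:ℝ) ≤ |(n:ℝ)| := by exact_mod_cast Int.one_le_abs hn0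
    have hn2 : (0:ℝ) < |(n:ℝ)| := by linarith
    rw [Real.norm_of_nonneg (by positivity)]
    calc _ ≤ (|K| / |(n : ℝ)| ^ (B + 2)) * (2 * |(n : ℝ)|) ^ B := by
          gcongr
          · exact (hK n hn0).trans (by gcongr; exact le_abs_self K)
          · linarith
      _ = _ := by rw [← sq_abs (n : ℝ), mul_pow, pow_add]; field_simp
  refine ⟨fourierCoeffOn neg_pi_lt f, hs, fun x hx => ?_⟩
  have hT : Fact (0 < 2 * Real.pi) := ⟨Real.two_pi_pos⟩
  have hc : Continuous (AddCircle.liftIco (2 * Real.pi) (-Real.pi) f) := by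
    refine AddCircle.liftIco_continuous ?_ hf.continuous.continuousOn
    rw [h0 (-Real.pi) (by rw [abs_neg, abs_of_pos] <;> linarith),
      h0 (-Real.pi + 2 * Real.pi) (by rw [abs_of_pos] <;> linarith)]
  have hcoef : ∀ n, fourierCoeff (AddCircle.liftIco (2 * Real.pi) (-Real.pi) f) n =
      fourierCoeffOn neg_pi_lt f n := fun n => fourierCoeff_liftIco_eq f n
  have hsum : Summable (fourierCoeff (⟨_, hc⟩ : C(AddCircle (2 * Real.pi), ℂ))) := by
    refine Summable.of_norm ?_
    refine hs.of_nonneg_of_le (fun _ => norm_nonneg _) fun n => ?_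
    rw [ContinuousMap.coe_mk, hcoef]
    exact le_mul_of_one_le_right (norm_nonneg _) (one_le_pow₀ (by linarith [abs_nonneg (n:ℝ)]))
  have h1 := has_pointwise_sum_fourier_series_of_summable hsum (x : AddCircle (2 * Real.pi))
  rw [abs_le] at hx
  simp only [ContinuousMap.coe_mk, hcoef] at h1
  rw [AddCircle.liftIco_coe_apply ⟨by linarith, by linarith⟩] at h1
  refine h1.congr_fun fun n => ?_
  rw [smul_eq_mul, fourier_coe_apply]
  congr 2
  have : (Real.pi : ℂ) ≠ 0 := by exact_mod_cast Real.pi_ne_zero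
  push_cast
  field_simp

/-- Multiplication by a bump equal to `1` on `|x| ≤ r` and supported in `|x| ≤ 2r`; the choice `r =
min ρ 1 / 4` keeps the support inside both `(-ρ, ρ)` and `[-2, 2]`. -/
lemma exists_cutoff {h : ℝ → ℝ} {ρ : ℝ} (hρ : 0 < ρ) (hh : ContDiffOn ℝ ∞ h (Set.Ioo (-ρ) ρ)) :
    ∃ (f : ℝ → ℂ) (r : ℝ), 0 < r ∧ r < ρ ∧ r ≤ 2 ∧ ContDiff ℝ ∞ f ∧ (∀ x, 2 < |x| → f x = 0) ∧
      ∀ x, |x| ≤ r → f x = h x := by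
  set r := min ρ 1 / 4 with hr
  have hm : 0 < min ρ 1 := lt_min hρ one_pos
  have hm1 : min ρ 1 ≤ ρ := min_le_left _ _
  have hm2 : min ρ 1 ≤ 1 := min_le_right _ _
  let χ : ContDiffBump (0 : ℝ) := ⟨r, 2 * r, by linarith, by linarith⟩
  refine ⟨fun x => ((χ x * h x : ℝ) : ℂ), r, by linarith, by linarith, by linarith, ?_, ?_, ?_⟩
  · refine Complex.ofRealCLM.contDiff.comp ?_
    rw [contDiff_iff_contDiffAt]
    intro x
    by_cases hx : |x| < ρ
    · exact χ.contDiffAt.mul (hh.contDiffAt (isOpen_Ioo.mem_nhds (abs_lt.1 hx)))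
    · have : (fun x => χ x * h x) =ᶠ[nhds x] fun _ => 0 := by
        have h2 : 2 * r < |x| := by linarith
        filter_upwards [(isOpen_lt continuous_const continuous_abs).mem_nhds h2] with y hy
        have hy' : 2 * r < |y| := hy
        rw [χ.zero_of_le_dist (by simpa using hy'.le), zero_mul]
      exact contDiffAt_const.congr_of_eventuallyEq this
  · intro x hx
    have : χ x = 0 := χ.zero_of_le_dist (by
      have : (2 * r) ≤ |x| := by linarith
      simpa using this)
    simp [this]
  · intro x hx
    have : χ x = 1 := χ.one_of_mem_closedBall (by simpa using hx)
    simp [this]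

variable {d : ℕ}

/-- The exponential series is summed in `H^s` using the algebra constant. The function `v` is
unimodular as soon as `y` is real, which is checked at the point of use. -/
lemma exists_unimodular_exp {s : ℝ} (hs : d ≤ s) :
    ∃ R : ℝ≥0∞, R ≠ ⊤ ∧ ∀ y : C(UnitAddTorus (Fin d), ℂ), sob s y ≤ 1 →
      ∃ v : C(UnitAddTorus (Fin d), ℂ), (∀ t, v t = Complex.exp (Complex.I * y t)) ∧
        sob s v ≤ R := by
  have hA := algConst_ne_top (d := d) s
  set A : ℝ := (algConst d s).toReal with hA'
  refine ⟨∑' n : ℕ, ENNReal.ofReal (A ^ n / n.factorial),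
    (Real.summable_pow_div_factorial A).tsum_ofReal_ne_top, fun y hy => ?_⟩
  have hx := NormedSpace.exp_series_hasSum_exp' (𝕂 := ℂ) (Complex.I • y)
  refine ⟨NormedSpace.exp (Complex.I • y), fun t => ?_, ?_⟩
  · have h1 := (ContinuousMap.evalCLM ℂ t).hasSum hx
    have h2 := NormedSpace.exp_series_hasSum_exp' (𝕂 := ℂ) (Complex.I * y t)
    rw [← Complex.exp_eq_exp_ℂ] at h2
    refine h1.unique (h2.congr_fun fun n => ?_)
    simp
  · refine (sob_tsum_le s hx).trans (ENNReal.tsum_le_tsum fun n => ?_)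
    have hpow : sob s ((Complex.I • y) ^ n) ≤ algConst d s ^ n := by
      have h1 : sob s (Complex.I • y) ≤ 1 := by
        rw [sob_smul, ← ofReal_norm Complex.I, Complex.norm_I]; simpa using hy
      induction n with
      | zero => simp [sob_one]
      | succ n ih =>
        rw [pow_succ', pow_succ']
        refine (sob_mul_le hs (ne_top_of_le_ne_top ENNReal.one_ne_top h1)).trans ?_
        gcongr
        calc _ ≤ 1 * sob s ((Complex.I • y) ^ n) := by gcongr
          _ ≤ _ := by rw [one_mul]; exact ih
    rw [sob_smul, div_eq_inv_mul, ENNReal.ofReal_mul (by positivity), ENNReal.ofReal_pow (by positivity),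
      hA', ENNReal.ofReal_toReal hA]
    gcongr
    rw [← ofReal_norm]; simp

/-- Composition with a smooth function is bounded on a small ball of `H^s`. -/
lemma exists_funcCalc {s : ℝ} (hs : d + 1 ≤ s) {h : ℝ → ℝ} {ρ : ℝ} (hρ : 0 < ρ)
    (hh : ContDiffOn ℝ ∞ h (Set.Ioo (-ρ) ρ)) :
    ∃ r : ℝ, 0 < r ∧ ∃ C : ℝ≥0∞, C ≠ ⊤ ∧ ∀ y : C(UnitAddTorus (Fin d), ℂ), (∀ t, (y t).im = 0) →
      sob s y ≤ ENNReal.ofReal r → ∃ H : C(UnitAddTorus (Fin d), ℂ),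
        (∀ t, H t = ((h (y t).re : ℝ) : ℂ)) ∧ sob s H ≤ C ∧ ∀ t, |(y t).re| < ρ := by
  obtain ⟨f, r₀, hr₀, hr₀ρ, hr₀2, hf, hf0, hfh⟩ := exists_cutoff hρ hh
  have hsd : (d : ℝ) ≤ s := by linarith
  obtain ⟨R, hR, hexp⟩ := exists_unimodular_exp (d := d) hsd
  obtain ⟨B, hB⟩ := sob_unimodular_pow_le (d := d) hs R hR
  obtain ⟨c, hc, hcf⟩ := exists_exp_series hf hf0 B
  set W := max 1 (wienerConst d) with hW
  have hWt : W ≠ ⊤ := by simp [hW, wienerConst_ne_top]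
  have hW1 : 1 ≤ W.toReal := by
    have := ENNReal.toReal_mono hWt (le_max_left 1 (wienerConst d))
    simpa using this
  -- The bound `1` on the norm controls `e^{iy}`; the bound `r₀ / W` forces `|y| ≤ r₀` pointwise,
  -- where the cut-off function coincides with `h`.
  refine ⟨min 1 (r₀ / W.toReal), lt_min one_pos (by positivity),
    ∑' n : ℤ, ENNReal.ofReal (‖c n‖ * (|(n : ℝ)| + 1) ^ B), hc.tsum_ofReal_ne_top,
    fun y hy hys => ?_⟩
  have hy1 : sob s y ≤ 1 := hys.trans (by
    rw [← ENNReal.ofReal_one]; exact ENNReal.ofReal_le_ofReal (min_le_left _ _))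
  have hynorm : ∀ t, |(y t).re| ≤ r₀ := fun t => by
    have h1 : ‖y‖ₑ ≤ ENNReal.ofReal r₀ := by
      refine (norm_le_sob hsd y).trans ?_
      rw [← hW]
      calc W * sob s y ≤ ENNReal.ofReal W.toReal * ENNReal.ofReal (r₀ / W.toReal) := by
            rw [ENNReal.ofReal_toReal hWt]; gcongr
            exact hys.trans (ENNReal.ofReal_le_ofReal (min_le_right _ _))
        _ = ENNReal.ofReal r₀ := by
            rw [← ENNReal.ofReal_mul (by positivity)]; congr 1; field_simp
    rw [← ofReal_norm, ENNReal.ofReal_le_ofReal_iff hr₀.le] at h1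
    exact (Complex.abs_re_le_norm _).trans ((y.norm_coe_le_norm t).trans h1)
  have hyre : ∀ t, y t = ((y t).re : ℂ) := fun t => by
    apply Complex.ext <;> simp [hy t]
  obtain ⟨v, hv, hvs⟩ := hexp y hy1
  have hv1 : ∀ t, ‖v t‖ = 1 := fun t => by
    rw [hv, hyre, mul_comm, Complex.norm_exp_ofReal_mul_I]
  have hpow := hB v hv1 hvs
  -- `E n` is `e^{iny}`; a negative power of a unimodular function is a conjugate, and conjugation
  -- preserves the Sobolev norm.
  let E : ℤ → C(UnitAddTorus (Fin d), ℂ) := fun n => if 0 ≤ n then v ^ n.natAbs else star (v ^ n.natAbs)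
  have hEt : ∀ n t, E n t = Complex.exp (Complex.I * n * ((y t).re : ℝ)) := fun n t => by
    simp only [E]
    split_ifs with hn
    · rw [ContinuousMap.pow_apply, hv, ← Complex.exp_nat_mul, hyre]
      congr 1
      have : ((n.natAbs : ℤ) : ℂ) = n := by rw [Int.natAbs_of_nonneg hn]
      simp only [Int.cast_natCast] at this
      rw [this]; simp; ring
    · rw [ContinuousMap.star_apply, ContinuousMap.pow_apply, hv, ← Complex.exp_nat_mul,
        Complex.star_def, ← Complex.exp_conj, hyre]
      congr 1
      have : ((n.natAbs : ℤ) : ℂ) = -n := by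
        rw [Int.ofNat_natAbs_of_nonpos (by omega)]; simp
      simp only [Int.cast_natCast] at this
      simp [this]; ring
  have hEs : ∀ n, sob s (E n) ≤ ENNReal.ofReal ((|(n : ℝ)| + 1) ^ B) := fun n => by
    have h1 : sob s (E n) = sob s (v ^ n.natAbs) := by
      simp only [E]; split_ifs
      · rfl
      · exact sob_star _ _
    rw [h1]
    refine (hpow n.natAbs).trans (le_of_eq ?_)
    rw [Nat.cast_natAbs, Int.cast_abs]
  have hEn : ∀ n, ‖E n‖ ≤ 1 := fun n => (ContinuousMap.norm_le _ zero_le_one).2 fun t => by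
    rw [hEt, show Complex.I * n * ((y t).re : ℝ) = ((n * (y t).re : ℝ) : ℂ) * Complex.I by
      push_cast; ring, Complex.norm_exp_ofReal_mul_I]
  have hsum : Summable fun n => c n • E n := by
    refine Summable.of_norm_bounded hc fun n => ?_
    rw [norm_smul]
    gcongr
    exact (hEn n).trans (one_le_pow₀ (by linarith [abs_nonneg (n : ℝ)]))
  refine ⟨∑' n, c n • E n, fun t => ?_, ?_, fun t => (hynorm t).trans_lt hr₀ρ⟩
  · have h1 := (ContinuousMap.evalCLM ℂ t).hasSum hsum.hasSum
    have h2 := hcf (y t).re ((hynorm t).trans hr₀2)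
    rw [← hfh _ (hynorm t)]
    refine h1.unique (h2.congr_fun fun n => ?_)
    simp [hEt]
  · refine (sob_tsum_le s hsum.hasSum).trans (ENNReal.tsum_le_tsum fun n => ?_)
    rw [sob_smul, ENNReal.ofReal_mul (norm_nonneg _), ofReal_norm]
    gcongr
    exact hEs n

end FuncCalc

end QHD
end

/-! ### Differentiating the potential energy under the integral sign -/

noncomputable section

namespace QHD

open scoped ENNReal ComplexConjugate Topology
open UnitAddTorus

section DerivIntegral

lemma hasDerivAt_primitive {g : ℝ → ℝ} (hg : ContinuousOn g (Set.Ioi 0)) {m y : ℝ} (hm : 0 < m)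
    (hy : 0 < y) : HasDerivAt (primitive g m) (g y) y := by
  refine intervalIntegral.integral_hasDerivAt_right ?_
    (hg.stronglyMeasurableAtFilter isOpen_Ioi y hy) (hg.continuousAt (Ioi_mem_nhds hy))
  refine (hg.mono fun x hx => ?_).intervalIntegrable
  exact lt_of_lt_of_le (lt_min hm hy) hx.1

lemma hasDerivAt_normSq {α α' : ℝ → ℝ} {h : ℝ} (hα : HasDerivAt α (α' h) h) (Z ζ : ℂ) :
    HasDerivAt (fun h : ℝ => ‖(α h : ℂ) + (Z + h * ζ)‖ ^ 2)
      (2 * (conj ((α h : ℂ) + (Z + h * ζ)) * (α' h + ζ)).re) h := by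
  have h1 : HasDerivAt (fun h : ℝ => (α h : ℂ) + (Z + h * ζ)) (α' h + ζ) h := by
    refine hα.ofReal_comp.add ?_
    have := ((hasDerivAt_id h).ofReal_comp.mul_const ζ).const_add Z
    simpa using this
  have h2 := h1.norm_sq
  refine h2.congr_deriv ?_
  rw [Complex.inner, mul_comm]
  simp
  ring

/-- Here `0.7 √m ≤ |u| ≤ 1.25 √m`, and a displacement of at most `√m / 10` keeps `|v|²` inside a
compact subset of `(0, ∞)`. -/
lemma norm_sq_mem_of_close {m e : ℝ} (hm : 0 < m) {u v : ℂ} (hu : |‖u‖ ^ 2 - m| ≤ m / 2)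
    (he : ‖v - u‖ ≤ e) (hem : e ≤ Real.sqrt m / 10) : m / 4 ≤ ‖v‖ ^ 2 ∧ ‖v‖ ^ 2 ≤ 2 * m := by
  have hs := Real.sq_sqrt hm.le
  have hs0 := Real.sqrt_pos.2 hm
  set σ := Real.sqrt m
  rw [abs_le] at hu
  have h1 : ‖u‖ - ‖v‖ ≤ σ / 10 := by
    have := norm_sub_norm_le u v; rw [norm_sub_rev] at this; linarith
  have h2 : ‖v‖ - ‖u‖ ≤ σ / 10 := by have := norm_sub_norm_le v u; linarith
  have hu0 := norm_nonneg u
  have hv0 := norm_nonneg v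
  have hu1 : 0.7 * σ ≤ ‖u‖ := abs_le_of_sq_le_sq' (by nlinarith) hu0 |>.2
  have hu2 : ‖u‖ ≤ 1.25 * σ := abs_le_of_sq_le_sq' (by nlinarith) (by positivity) |>.2
  constructor <;> nlinarith

/-- Dominated differentiation. As `g` is controlled only on `(0, ∞)`, the dominating constant relies
on `|α + Z + hζ|²` staying in `[m/4, 2m]` for all small `h`, uniformly in the space variable. -/
lemma hasDerivAt_integral_primitive {X : Type*} [TopologicalSpace X] [MeasurableSpace X]
    [OpensMeasurableSpace X] {μ : Measure X} [IsFiniteMeasure μ] {g : ℝ → ℝ} {m : ℝ} (hm : 0 < m)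
    (hg : ContinuousOn g (Set.Ioi 0)) {α α' : ℝ → ℝ} (hα : ∀ᶠ h in 𝓝 0, HasDerivAt α (α' h) h)
    (hα' : ContinuousAt α' 0) {Z ζ : X → ℂ} (hZ : Continuous Z) (hζ : Continuous ζ) {B : ℝ}
    (hB : ∀ x, ‖ζ x‖ ≤ B) (hρ : ∀ x, |‖(α 0 : ℂ) + Z x‖ ^ 2 - m| ≤ m / 2) :
    HasDerivAt (fun h : ℝ => ∫ x, primitive g m (‖(α h : ℂ) + (Z x + h * ζ x)‖ ^ 2) ∂μ)
      (∫ x, g (‖(α 0 : ℂ) + Z x‖ ^ 2) * (2 * (conj ((α 0 : ℂ) + Z x) * (α' 0 + ζ x)).re) ∂μ) 0 := by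
  have hs0 := Real.sqrt_pos.2 hm
  have hα0 : ContinuousAt α 0 := hα.self_of_nhds.continuousAt
  have hclose : ∀ᶠ h in 𝓝 (0:ℝ), |α h - α 0| + |h| * |B| ≤ Real.sqrt m / 10 := by
    have : ContinuousAt (fun h => |α h - α 0| + |h| * |B|) 0 := by fun_prop
    have h2 := this.eventually_lt_const (u := Real.sqrt m / 10) (by simp; positivity)
    filter_upwards [h2] with h hh using hh.le
  have hbd : ∀ᶠ h in 𝓝 (0:ℝ), |α' h| ≤ |α' 0| + 1 := by
    have := hα'.abs.eventually_lt_const (u := |α' 0| + 1) (by simp)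
    filter_upwards [this] with h hh using hh.le
  obtain ⟨Mg, hMg⟩ := (isCompact_Icc (a := m / 4) (b := 2 * m)).exists_bound_of_continuousOn
    (hg.mono fun y hy => lt_of_lt_of_le (by positivity) hy.1)
  have hmem : ∀ h : ℝ, |α h - α 0| + |h| * |B| ≤ Real.sqrt m / 10 → ∀ x,
      m / 4 ≤ ‖(α h : ℂ) + (Z x + h * ζ x)‖ ^ 2 ∧ ‖(α h : ℂ) + (Z x + h * ζ x)‖ ^ 2 ≤ 2 * m :=
    fun h hh x => by
    refine norm_sq_mem_of_close hm (hρ x) ?_ hh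
    have : (α h : ℂ) + (Z x + h * ζ x) - ((α 0 : ℂ) + Z x) = ((α h - α 0 : ℝ) : ℂ) + (h : ℂ) * ζ x := by
      push_cast; ring
    rw [this]
    refine (norm_add_le _ _).trans ?_
    rw [norm_mul, Complex.norm_real, Complex.norm_real, Real.norm_eq_abs, Real.norm_eq_abs]
    gcongr
    exact (hB x).trans (le_abs_self B)
  have hcont : ∀ h : ℝ, |α h - α 0| + |h| * |B| ≤ Real.sqrt m / 10 →
      Continuous fun x => primitive g m (‖(α h : ℂ) + (Z x + h * ζ x)‖ ^ 2) := fun h hh => by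
    rw [continuous_iff_continuousAt]
    intro x
    have h1 : ContinuousAt (primitive g m) (‖(α h : ℂ) + (Z x + h * ζ x)‖ ^ 2) :=
      (hasDerivAt_primitive hg hm (lt_of_lt_of_le (by positivity) (hmem h hh x).1)).continuousAt
    have h2 : Continuous fun x => ‖(α h : ℂ) + (Z x + h * ζ x)‖ ^ 2 := by fun_prop
    exact ContinuousAt.comp (f := fun x => ‖(α h : ℂ) + (Z x + h * ζ x)‖ ^ 2) h1 h2.continuousAt
  have hclose0 : |α 0 - α 0| + |(0:ℝ)| * |B| ≤ Real.sqrt m / 10 := by simp; positivity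
  set K := (|α' 0| + 1) + |B|
  have hgρ : Continuous fun x => g (‖(α 0 : ℂ) + Z x‖ ^ 2) := by
    rw [continuous_iff_continuousAt]
    intro x
    have h3 := (hmem 0 hclose0 x).1
    simp only [Complex.ofReal_zero, zero_mul, add_zero] at h3
    have h1 : ContinuousAt g (‖(α 0 : ℂ) + Z x‖ ^ 2) :=
      hg.continuousAt (Ioi_mem_nhds (lt_of_lt_of_le (by positivity) h3))
    have h2 : Continuous fun x => ‖(α 0 : ℂ) + Z x‖ ^ 2 := by fun_prop
    exact ContinuousAt.comp (f := fun x => ‖(α 0 : ℂ) + Z x‖ ^ 2) h1 h2.continuousAt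
  have key := hasDerivAt_integral_of_dominated_loc_of_deriv_le (μ := μ) (x₀ := (0:ℝ))
    (F := fun h x => primitive g m (‖(α h : ℂ) + (Z x + h * ζ x)‖ ^ 2))
    (F' := fun h x => g (‖(α h : ℂ) + (Z x + h * ζ x)‖ ^ 2) *
      (2 * (conj ((α h : ℂ) + (Z x + h * ζ x)) * (α' h + ζ x)).re))
    (bound := fun _ => Mg * (2 * ((2 * m + 1) * K)))
    (Filter.inter_mem hα (Filter.inter_mem hclose hbd)) ?_ ?_ ?_ ?_ (integrable_const _) ?_
  · have h2 := key.2
    simp only [Complex.ofReal_zero, zero_mul, add_zero] at h2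
    exact h2
  · filter_upwards [hclose] with h hh using (hcont h hh).aestronglyMeasurable
  · refine Integrable.of_bound (hcont 0 hclose0).aestronglyMeasurable
      ((⨆ y : Set.Icc (m / 4) (2 * m), ‖primitive g m y‖)) (Filter.Eventually.of_forall fun x => ?_)
    have hc : ContinuousOn (fun y => ‖primitive g m y‖) (Set.Icc (m / 4) (2 * m)) := fun y hy =>
      (hasDerivAt_primitive hg hm (lt_of_lt_of_le (by positivity) hy.1)).continuousAt.norm.continuousWithinAt
    have hbdd : BddAbove (Set.range fun y : Set.Icc (m / 4) (2 * m) => ‖primitive g m y‖) := by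
      have := (isCompact_Icc.image_of_continuousOn hc).bddAbove
      rwa [Set.image_eq_range] at this
    exact le_ciSup hbdd ⟨_, hmem 0 hclose0 x⟩
  · refine Continuous.aestronglyMeasurable ?_
    simp only [Complex.ofReal_zero, zero_mul, add_zero]
    refine hgρ.mul (continuous_const.mul (Complex.continuous_re.comp ?_))
    exact (Complex.continuous_conj.comp (by fun_prop)).mul (by fun_prop)
  · refine Filter.Eventually.of_forall fun x h hh => ?_
    obtain ⟨h1, h2, h3⟩ := hh
    have hx := hmem h h2 x
    rw [norm_mul]
    have e1 := hMg _ hx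
    have e2 : ‖(α h : ℂ) + (Z x + h * ζ x)‖ ≤ 2 * m + 1 := by
      have := sq_nonneg (‖(α h : ℂ) + (Z x + h * ζ x)‖ - 1)
      nlinarith [norm_nonneg ((α h : ℂ) + (Z x + h * ζ x))]
    have e3 : ‖(α' h : ℂ) + ζ x‖ ≤ K := by
      refine (norm_add_le _ _).trans ?_
      rw [Complex.norm_real, Real.norm_eq_abs]
      exact add_le_add h3 ((hB x).trans (le_abs_self B))
    have e4 : ‖2 * (conj ((α h : ℂ) + (Z x + h * ζ x)) * (α' h + ζ x)).re‖ ≤ 2 * ((2 * m + 1) * K) := by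
      rw [norm_mul, Real.norm_two, Real.norm_eq_abs]
      gcongr
      refine (Complex.abs_re_le_norm _).trans ?_
      rw [norm_mul, RCLike.norm_conj]
      gcongr
    exact mul_le_mul e1 e4 (norm_nonneg _) ((norm_nonneg _).trans e1)
  · refine Filter.Eventually.of_forall fun x h hh => ?_
    obtain ⟨h1, h2, h3⟩ := hh
    have hx := hmem h h2 x
    exact (hasDerivAt_primitive hg hm (lt_of_lt_of_le (by positivity) hx.1)).comp h
      (hasDerivAt_normSq h1 (Z x) (ζ x))

end DerivIntegral

end QHD
end

/-! ### The gradient of the Hamiltonian in the variable `z` -/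

noncomputable section

namespace QHD

open scoped ENNReal ComplexConjugate Topology Pointwise
open UnitAddTorus

section Torus
variable {d : ℕ}

/-- The normalization constant `(2π)^{-d/2}`. -/
def tc (d : ℕ) : ℝ := (2 * Real.pi) ^ (-(d : ℝ) / 2)

lemma tc_pos : 0 < tc d := Real.rpow_pos_of_pos Real.two_pi_pos _

lemma tc_sq : tc d ^ 2 = ((2 * Real.pi) ^ d)⁻¹ := by
  rw [tc, ← Real.rpow_natCast, ← Real.rpow_mul Real.two_pi_pos.le, ← Real.rpow_natCast,
    ← Real.rpow_neg Real.two_pi_pos.le]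
  congr 1; push_cast; ring

/-- The point of the unit torus corresponding to `x ∈ ℝ^d` modulo `2π`. -/
def toTor (x : Fin d → ℝ) : UnitAddTorus (Fin d) := fun i => ((x i / (2 * Real.pi) : ℝ) : UnitAddCircle)

lemma continuous_toTor : Continuous (toTor (d := d)) := by
  refine continuous_pi fun i => ?_
  exact (AddCircle.continuous_mk' 1).comp (by fun_prop)

lemma mFourier_toTor (j : Freq d) (x : Fin d → ℝ) :
    mFourier j (toTor x) = Complex.exp (Complex.I * ((∑ i, (j i : ℝ) * x i : ℝ) : ℂ)) := by
  simp only [mFourier, ContinuousMap.coe_mk, toTor, fourier_coe_apply]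
  rw [← Complex.exp_sum]
  congr 1
  push_cast
  rw [Finset.mul_sum]
  refine Finset.sum_congr rfl fun i _ => ?_
  have : (Real.pi : ℂ) ≠ 0 := by exact_mod_cast Real.pi_ne_zero
  field_simp

/-- The continuous function on the unit torus with `L²`-normalized Fourier coefficients `z`. -/
def synth (z : Freq d → ℂ) : C(UnitAddTorus (Fin d), ℂ) := ∑' j, ((tc d : ℂ) * z j) • mFourier j

lemma summable_synth {z : Freq d → ℂ} (hz : Summable z) :
    Summable fun j => ((tc d : ℂ) * z j) • (mFourier j : C(UnitAddTorus (Fin d), ℂ)) := by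
  refine Summable.of_norm ?_
  simp only [norm_smul, mFourier_norm, mul_one, norm_mul]
  exact hz.norm.mul_left _

lemma coef_synth {z : Freq d → ℂ} (hz : Summable z) (j : Freq d) :
    coef (synth z) j = tc d * z j := by
  unfold synth
  rw [← (coef_hasSum (summable_synth hz).hasSum j).tsum_eq, tsum_eq_single j]
  · rw [coef_smul, coef_mFourier, if_pos rfl, mul_one]
  · intro k hk
    rw [coef_smul, coef_mFourier, if_neg (Ne.symm hk), mul_zero]

lemma torusFun_eq {z : Freq d → ℂ} (hz : Summable z) (x : Fin d → ℝ) :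
    torusFun z x = synth z (toTor x) := by
  have h := (ContinuousMap.evalCLM ℂ (toTor x)).hasSum (summable_synth hz).hasSum
  change HasSum _ (synth z (toTor x)) at h
  rw [← h.tsum_eq, torusFun, ← tsum_mul_left]
  congr 1; ext j
  simp [mFourier_toTor, tc, mul_assoc]

lemma integral_toTor (F : C(UnitAddTorus (Fin d), ℂ)) :
    ∫ x in Set.Icc (fun _ : Fin d => (0 : ℝ)) (fun _ => 2 * Real.pi), F (toTor x) =
      (2 * Real.pi) ^ d * coef F 0 := by
  have h2 := Real.two_pi_pos
  have h1 := Measure.setIntegral_comp_smul_of_pos (volume : Measure (Fin d → ℝ))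
    (fun x => F (fun i => (x i : UnitAddCircle)))
    (Set.Icc (fun _ : Fin d => (0 : ℝ)) (fun _ => 2 * Real.pi)) (inv_pos.2 h2)
  have h3 : (2 * Real.pi)⁻¹ • Set.Icc (fun _ : Fin d => (0 : ℝ)) (fun _ => 2 * Real.pi) =
      Set.Icc (fun _ => 0) (fun _ => 1) := by
    ext x
    rw [Set.mem_inv_smul_set_iff₀ h2.ne']
    simp only [Set.mem_Icc, Pi.le_def, Pi.smul_apply, smul_eq_mul]
    constructor
    · rintro ⟨ha, hb⟩
      exact ⟨fun i => nonneg_of_mul_nonneg_right (ha i) h2, fun i => by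
        have := hb i; nlinarith⟩
    · rintro ⟨ha, hb⟩
      exact ⟨fun i => mul_nonneg h2.le (ha i), fun i => by have := hb i; nlinarith⟩
  rw [h3] at h1
  have h4 : ∀ x : Fin d → ℝ, (fun i => (((2 * Real.pi)⁻¹ • x) i : UnitAddCircle)) = toTor x :=
    fun x => by ext i; simp [toTor, div_eq_inv_mul]
  simp only [h4] at h1
  rw [h1, coef_zero_eq_integral]
  have h5 : {x : Fin d → ℝ | ∀ i, x i ∈ Set.Ioc (0 : ℝ) (0 + 1)} =
      Set.univ.pi fun _ => Set.Ioc (0:ℝ) 1 := by ext x; simp [Set.mem_pi]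
  rw [h5, volume_pi, ← setIntegral_congr_set (Measure.univ_pi_Ioc_ae_eq_Icc (f := fun _ : Fin d => (0:ℝ))
    (g := fun _ => 1) (μ := fun _ => volume))]
  rw [neg_zero, mFourier_zero]
  simp
  left
  rw [← mul_inv, inv_pow, inv_inv, mul_comm]

end Torus

section HamDeriv
variable {d : ℕ}

/-- A direction `ζ` of finite support makes the infinite sum an exact quadratic polynomial in `h`,
so no series has to be differentiated. -/
lemma tsum_weight_perturb {q : Freq d → ℝ} {z ζ : Freq d → ℂ} (hz : Summable fun k => q k * ‖z k‖ ^ 2)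
    {S : Finset (Freq d)} (hζ : ∀ k, k ∉ S → ζ k = 0) (h : ℝ) :
    (∑' k, q k * ‖z k + h * ζ k‖ ^ 2) = (∑' k, q k * ‖z k‖ ^ 2) +
      h * (2 * ∑ k ∈ S, q k * (conj (z k) * ζ k).re) + h ^ 2 * ∑ k ∈ S, q k * ‖ζ k‖ ^ 2 := by
  have e : ∀ k, q k * ‖z k + h * ζ k‖ ^ 2 = q k * ‖z k‖ ^ 2 +
      (h * (2 * (q k * (conj (z k) * ζ k).re)) + h ^ 2 * (q k * ‖ζ k‖ ^ 2)) := fun k => by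
    rw [Complex.sq_norm, Complex.sq_norm, Complex.sq_norm, Complex.normSq_apply,
      Complex.normSq_apply, Complex.normSq_apply]
    simp
    ring
  have h0 : ∀ k ∉ S, (h * (2 * (q k * (conj (z k) * ζ k).re)) + h ^ 2 * (q k * ‖ζ k‖ ^ 2)) = 0 :=
    fun k hk => by simp [hζ k hk]
  simp_rw [e]
  rw [hz.tsum_add (summable_of_ne_finset_zero h0), tsum_eq_sum h0, Finset.sum_add_distrib,
    ← Finset.mul_sum, ← Finset.mul_sum, ← Finset.mul_sum]
  ring

/-- The `L²` gradient `∂_{z̄}𝒦_m` of the Hamiltonian; `F` stands for `g(|α+z|²)(α+z)`. -/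
def gradZ (ν : Fin d → ℝ) (m κ : ℝ) (z : Freq d → ℂ) (F : C(UnitAddTorus (Fin d), ℂ))
    (k : Freq d) : ℂ :=
  (hbar κ / 2 * symbSq ν k : ℝ) * z k +
    (1 / hbar κ : ℝ) * ((tc d : ℂ)⁻¹ * coef F k - ((zeroMode m z)⁻¹ * (coef F 0).re : ℝ) * z k)

/-- Besides the direct variation of `z`, the zero mode varies through the mass constraint, with `α'
= -(2π)^{-d} Re ⟨z, ζ⟩ / α`. This produces the term of `gradZ` that contains the mean of `F`. -/
lemma hasDerivAt_hamZ {ν : Fin d → ℝ} {m κ : ℝ} {g : ℝ → ℝ} (hm : 0 < m)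
    (hg : ContinuousOn g (Set.Ioi 0)) {z ζ : Freq d → ℂ} (hz : Summable z)
    (hz2 : Summable fun k => ‖z k‖ ^ 2) (hzq : Summable fun k => symbSq ν k * ‖z k‖ ^ 2)
    {S : Finset (Freq d)} (hζ : ∀ k, k ∉ S → ζ k = 0)
    (hα : 0 < m - ((2 * Real.pi) ^ d)⁻¹ * ∑' j : Freq d, ‖z j‖ ^ 2)
    (hρ : ∀ t, |‖(zeroMode m z : ℂ) + synth z t‖ ^ 2 - m| ≤ m / 2)
    {F : C(UnitAddTorus (Fin d), ℂ)}
    (hF : ∀ t, F t = (g (‖(zeroMode m z : ℂ) + synth z t‖ ^ 2) : ℝ) * ((zeroMode m z : ℂ) + synth z t)) :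
    HasDerivAt (fun h : ℝ => hamZ ν m κ g (fun k => z k + h * ζ k))
      (2 * ∑ k ∈ S, (conj (gradZ ν m κ z F k) * ζ k).re) 0 := by
  have htc := tc_pos (d := d)
  have hζs : Summable ζ := summable_of_ne_finset_zero hζ
  set P : ℝ → ℝ := fun h => m - ((2 * Real.pi) ^ d)⁻¹ * ((∑' k, ‖z k‖ ^ 2) +
      h * (2 * ∑ k ∈ S, (conj (z k) * ζ k).re) + h ^ 2 * ∑ k ∈ S, ‖ζ k‖ ^ 2) with hP
  have hzm : ∀ h : ℝ, zeroMode m (fun k => z k + h * ζ k) = Real.sqrt (P h) := fun h => by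
    have := tsum_weight_perturb (q := fun _ => 1) (by simpa using hz2) hζ h
    simp only [one_mul] at this
    rw [zeroMode, this]
  have hz0 : zeroMode m z = Real.sqrt (P 0) := by
    have := hzm 0; simpa using this
  set P' : ℝ → ℝ := fun h => - (((2 * Real.pi) ^ d)⁻¹ * ((2 * ∑ k ∈ S, (conj (z k) * ζ k).re) +
    2 * h * ∑ k ∈ S, ‖ζ k‖ ^ 2)) with hP'
  have hPd : ∀ h, HasDerivAt P (P' h) h := fun h => by
    have h1 := ((((hasDerivAt_id h).mul_const (2 * ∑ k ∈ S, (conj (z k) * ζ k).re)).const_add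
      (∑' k, ‖z k‖ ^ 2)).add ((hasDerivAt_pow 2 h).mul_const (∑ k ∈ S, ‖ζ k‖ ^ 2))).const_mul
      (((2 * Real.pi) ^ d)⁻¹) |>.const_sub m
    refine h1.congr_deriv ?_
    simp [hP']
  have hP0 : 0 < P 0 := by simpa [hP] using hα
  have hPc : Continuous P := by fun_prop
  have hPpos : ∀ᶠ h in 𝓝 (0:ℝ), 0 < P h := hPc.continuousAt.eventually_const_lt hP0
  set α' : ℝ → ℝ := fun h => P' h / (2 * Real.sqrt (P h)) with hα'
  have hαd : ∀ᶠ h in 𝓝 (0:ℝ), HasDerivAt (fun h => Real.sqrt (P h)) (α' h) h := by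
    filter_upwards [hPpos] with h hh using (hPd h).sqrt hh.ne'
  have hα'c : ContinuousAt α' 0 := by
    refine ContinuousAt.div (by fun_prop) (by fun_prop) ?_
    have := Real.sqrt_pos.2 hP0
    positivity
  rw [hz0] at hρ hF
  have : IsFiniteMeasure
      (volume.restrict (Set.Icc (fun _ : Fin d => (0 : ℝ)) (fun _ => 2 * Real.pi))) :=
    ⟨by rw [Measure.restrict_apply_univ]; exact isCompact_Icc.measure_lt_top⟩
  have hint := hasDerivAt_integral_primitive
    (μ := volume.restrict (Set.Icc (fun _ : Fin d => (0 : ℝ)) (fun _ => 2 * Real.pi)))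
    hm hg hαd hα'c ((synth z).continuous.comp continuous_toTor)
    ((synth ζ).continuous.comp continuous_toTor) (B := ‖synth ζ‖)
    (fun x => (synth ζ).norm_coe_le_norm _) (fun x => hρ _)
  have hfun : (fun h : ℝ => hamZ ν m κ g (fun k => z k + h * ζ k)) = fun h : ℝ =>
      hbar κ / 2 * ((∑' k, symbSq ν k * ‖z k‖ ^ 2) +
      h * (2 * ∑ k ∈ S, symbSq ν k * (conj (z k) * ζ k).re) + h ^ 2 * ∑ k ∈ S, symbSq ν k * ‖ζ k‖ ^ 2) +
      1 / hbar κ * ∫ x in Set.Icc (fun _ : Fin d => (0 : ℝ)) (fun _ => 2 * Real.pi),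
        primitive g m (‖((Real.sqrt (P h) : ℝ) : ℂ) +
          (synth z (toTor x) + h * synth ζ (toTor x))‖ ^ 2) := by
    ext h
    rw [hamZ, tsum_weight_perturb hzq hζ h, hzm]
    congr 3
    ext x
    have : torusFun (fun k => z k + h * ζ k) x = synth z (toTor x) + h * synth ζ (toTor x) := by
      rw [← torusFun_eq hz, ← torusFun_eq hζs]
      have hs : ∀ {u : Freq d → ℂ}, Summable u → Summable fun j =>
          u j * Complex.exp (Complex.I * ((∑ i, (j i : ℝ) * x i : ℝ) : ℂ)) := fun {u} hu => by
        refine Summable.of_norm ?_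
        simp only [norm_mul, mul_comm Complex.I, Complex.norm_exp_ofReal_mul_I, mul_one]
        exact hu.norm
      simp only [torusFun]
      simp_rw [add_mul, mul_assoc]
      rw [(hs hz).tsum_add ((hs hζs).mul_left _), tsum_mul_left]
      ring
    rw [this]
  rw [hfun]
  have hpoly : HasDerivAt (fun h : ℝ => hbar κ / 2 * ((∑' k, symbSq ν k * ‖z k‖ ^ 2) +
      h * (2 * ∑ k ∈ S, symbSq ν k * (conj (z k) * ζ k).re) + h ^ 2 * ∑ k ∈ S, symbSq ν k * ‖ζ k‖ ^ 2))
      (hbar κ / 2 * (2 * ∑ k ∈ S, symbSq ν k * (conj (z k) * ζ k).re)) 0 := by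
    have h1 := ((((hasDerivAt_id (0:ℝ)).mul_const
      (2 * ∑ k ∈ S, symbSq ν k * (conj (z k) * ζ k).re)).const_add
      (∑' k, symbSq ν k * ‖z k‖ ^ 2)).add ((hasDerivAt_pow 2 (0:ℝ)).mul_const
      (∑ k ∈ S, symbSq ν k * ‖ζ k‖ ^ 2))).const_mul (hbar κ / 2)
    refine h1.congr_deriv ?_
    simp
  refine (hpoly.add (hint.const_mul (1 / hbar κ))).congr_deriv ?_
  set a := Real.sqrt (P 0) with ha
  have ha0 : 0 < a := Real.sqrt_pos.2 hP0
  -- the integral of the derivative, in Fourier variables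
  have hval : ∫ x in Set.Icc (fun _ : Fin d => (0 : ℝ)) (fun _ => 2 * Real.pi),
      g (‖(a : ℂ) + synth z (toTor x)‖ ^ 2) *
        (2 * (conj ((a : ℂ) + synth z (toTor x)) * (α' 0 + synth ζ (toTor x))).re) =
      2 * ∑ k ∈ S, ((tc d)⁻¹ * (conj (coef F k) * ζ k).re - a⁻¹ * (coef F 0).re * (conj (z k) * ζ k).re) := by
    -- `Ψ` is `F̄ (α' + ζ)`, twice whose real part is the integrand; its integral is its zeroth
    -- Fourier coefficient, which is a finite sum since `ζ` is a trigonometric polynomial.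
    set Ψ : C(UnitAddTorus (Fin d), ℂ) := (α' 0 : ℂ) • star F +
      ∑ k ∈ S, ((tc d : ℂ) * ζ k) • (mFourier k * star F) with hΨ
    have hsyn : ∀ t, synth ζ t = ∑ k ∈ S, (tc d : ℂ) * ζ k * mFourier k t := fun t => by
      rw [synth, tsum_eq_sum (s := S) (fun k hk => by ext t; simp [hζ k hk])]
      simp
    have h1 : ∀ x, g (‖(a : ℂ) + synth z (toTor x)‖ ^ 2) *
        (2 * (conj ((a : ℂ) + synth z (toTor x)) * (α' 0 + synth ζ (toTor x))).re) =
        2 * (Ψ (toTor x)).re := fun x => by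
      have : Ψ (toTor x) = conj (F (toTor x)) * (α' 0 + synth ζ (toTor x)) := by
        rw [hsyn, mul_add, Finset.mul_sum]
        simp only [hΨ, ContinuousMap.add_apply, ContinuousMap.smul_apply, ContinuousMap.star_apply,
          ContinuousMap.coe_sum, Finset.sum_apply, ContinuousMap.mul_apply, smul_eq_mul,
          Complex.star_def]
        congr 1
        · ring
        · exact Finset.sum_congr rfl fun k _ => by ring
      rw [this, hF, map_mul, Complex.conj_ofReal, mul_assoc, Complex.re_ofReal_mul]
      ring
    simp_rw [h1]
    rw [integral_const_mul]
    congr 1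
    have hΨi : Integrable (fun x => Ψ (toTor x))
        (volume.restrict (Set.Icc (fun _ : Fin d => (0 : ℝ)) (fun _ => 2 * Real.pi))) :=
      (Ψ.continuous.comp continuous_toTor).continuousOn.integrableOn_compact isCompact_Icc
    have h2 : ∫ x in Set.Icc (fun _ : Fin d => (0 : ℝ)) (fun _ => 2 * Real.pi), (Ψ (toTor x)).re =
        ((2 * Real.pi) ^ d * coef Ψ 0).re := by
      rw [← integral_toTor]
      exact integral_re hΨi
    have h3 : coef Ψ 0 = (α' 0 : ℂ) * conj (coef F 0) +
        ∑ k ∈ S, (tc d : ℂ) * ζ k * conj (coef F k) := by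
      rw [← coefCLM_apply]
      simp only [hΨ, map_add, map_sum, map_smul, coefCLM_apply, coef_mFourier_mul, coef_star,
        smul_eq_mul]
      simp
    have h4 : ((2 * Real.pi) ^ d : ℝ) = (tc d ^ 2)⁻¹ := by rw [tc_sq, inv_inv]
    have h5 : ((2 * Real.pi : ℂ) ^ d) = (((tc d ^ 2)⁻¹ : ℝ) : ℂ) := by rw [← h4]; push_cast; rfl
    have h6 : α' 0 = - (tc d ^ 2 * ∑ k ∈ S, (conj (z k) * ζ k).re) / a := by
      simp only [hα', hP', ← ha, ← tc_sq]
      field_simp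
      ring
    rw [h2, h5, Complex.re_ofReal_mul, h3, Complex.add_re, Complex.re_ofReal_mul, Complex.re_sum, h6,
      Complex.conj_re, Finset.sum_sub_distrib, ← Finset.mul_sum, ← Finset.mul_sum]
    have h7 : ∀ k, ((tc d : ℂ) * ζ k * conj (coef F k)).re = tc d * (conj (coef F k) * ζ k).re :=
      fun k => by rw [mul_assoc, Complex.re_ofReal_mul, mul_comm (ζ k)]
    simp_rw [h7]
    rw [← Finset.mul_sum]
    field_simp
    ring
  have hval' := hval
  simp only [Function.comp_apply]
  rw [hval', Finset.mul_sum, Finset.mul_sum, Finset.mul_sum, Finset.mul_sum, Finset.mul_sum,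
    ← Finset.sum_add_distrib]
  refine Finset.sum_congr rfl fun k _ => ?_
  have h8 : (conj (gradZ ν m κ z F k) * ζ k).re = hbar κ / 2 * symbSq ν k * (conj (z k) * ζ k).re +
      1 / hbar κ * ((tc d)⁻¹ * (conj (coef F k) * ζ k).re - a⁻¹ * (coef F 0).re * (conj (z k) * ζ k).re) := by
    simp only [gradZ, hz0, map_add, map_mul, map_sub, map_inv₀, Complex.conj_ofReal]
    have : ∀ (x y u v : ℝ) (p q r : ℂ), (((x : ℂ) * p + (y : ℂ) * ((u : ℂ)⁻¹ * q - (v : ℂ) * p)) * r).re =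
        x * (p * r).re + y * (u⁻¹ * (q * r).re - v * (p * r).re) := fun x y u v p q r => by
      have : ((x : ℂ) * p + (y : ℂ) * ((u : ℂ)⁻¹ * q - (v : ℂ) * p)) * r =
          (x : ℂ) * (p * r) + (y : ℂ) * (((u⁻¹ : ℝ) : ℂ) * (q * r) - (v : ℂ) * (p * r)) := by
        push_cast; ring
      rw [this, Complex.add_re, Complex.re_ofReal_mul, Complex.re_ofReal_mul, Complex.sub_re,
        Complex.re_ofReal_mul, Complex.re_ofReal_mul]
    rw [this]
  rw [h8]
  ring

end HamDeriv

end QHD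
end

/-! ### The gradient in the diagonalizing variable -/

noncomputable section

namespace QHD

open scoped ENNReal ComplexConjugate Topology Pointwise
open UnitAddTorus

section Diag
variable {d : ℕ} (ν : Fin d → ℝ) (m κ : ℝ) (g : ℝ → ℝ)

/-- The diagonal entry of the diagonalizing matrix, extended by zero to the zero mode. -/
def diagA (j : Freq d) : ℝ :=
  if j = 0 then 0 else symbA ν m κ g j / Real.sqrt (2 * omega ν m κ g j * symbA ν m κ g j)

/-- Minus the off-diagonal entry of the diagonalizing matrix, extended by zero to the zero mode. -/
def diagB (j : Freq d) : ℝ :=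
  if j = 0 then 0 else offDiag m κ g / Real.sqrt (2 * omega ν m κ g j * symbA ν m κ g j)

lemma symbSq_neg (j : Freq d) : symbSq ν (-j) = symbSq ν j := by simp [symbSq]

lemma omega_neg (j : Freq d) : omega ν m κ g (-j) = omega ν m κ g j := by
  simp [omega, symbSq_neg]

lemma symbA_neg (j : Freq d) : symbA ν m κ g (-j) = symbA ν m κ g j := by
  simp [symbA, omega_neg, symbSq_neg]

lemma diagA_neg (j : Freq d) : diagA ν m κ g (-j) = diagA ν m κ g j := by
  simp [diagA, omega_neg, symbA_neg]

lemma diagB_neg (j : Freq d) : diagB ν m κ g (-j) = diagB ν m κ g j := by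
  simp [diagB, omega_neg, symbA_neg]

lemma undiag_apply (w : Freq d → ℂ) (j : Freq d) :
    undiag ν m κ g w j = diagA ν m κ g j * w j - diagB ν m κ g j * conj (w (-j)) := by
  unfold undiag diagA diagB
  split_ifs with h
  · simp
  · push_cast; ring

lemma undiag_add_real_smul (w v : Freq d → ℂ) (h : ℝ) :
    undiag ν m κ g (fun k => w k + h * v k) =
      fun k => undiag ν m κ g w k + h * undiag ν m κ g v k := by
  ext k
  simp only [undiag_apply, map_add, map_mul, Complex.conj_ofReal]
  ring

/-- Moving `w_j` moves `z` only at `j` and `-j`, which are distinct because `j ≠ 0`. Differentiating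
in the directions `1` and `i` and combining them transposes the real-linear map `undiag`. -/
lemma dbar_hamW {m : ℝ} (hm : 0 < m)
    (hg : ContinuousOn g (Set.Ioi 0)) {w z : Freq d → ℂ} (hzw : z = undiag ν m κ g w)
    (hz : Summable z)
    (hz2 : Summable fun k => ‖z k‖ ^ 2) (hzq : Summable fun k => symbSq ν k * ‖z k‖ ^ 2)
    (hα : 0 < m - ((2 * Real.pi) ^ d)⁻¹ * ∑' j : Freq d, ‖z j‖ ^ 2)
    (hρ : ∀ t, |‖(zeroMode m z : ℂ) + synth z t‖ ^ 2 - m| ≤ m / 2)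
    {F : C(UnitAddTorus (Fin d), ℂ)}
    (hF : ∀ t, F t = (g (‖(zeroMode m z : ℂ) + synth z t‖ ^ 2) : ℝ) * ((zeroMode m z : ℂ) + synth z t))
    {j : Freq d} (hj : j ≠ 0) :
    dbar (hamW ν m κ g) w j = diagA ν m κ g j * gradZ ν m κ z F j -
      diagB ν m κ g j * conj (gradZ ν m κ z F (-j)) := by
  classical
  have hjn : j ≠ -j := fun h => hj (by
    ext i
    have := congrFun h i
    simp only [Pi.neg_apply] at this
    simp only [Pi.zero_apply]; omega)
  have hj' : -j ≠ j := hjn.symm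
  have key : ∀ e : ℂ, HasDerivAt (fun h : ℝ => hamW ν m κ g (w + Pi.single j ((h : ℂ) * e)))
      (2 * ((conj (gradZ ν m κ z F j) * (diagA ν m κ g j * e)).re +
        (conj (gradZ ν m κ z F (-j)) * (-(diagB ν m κ g j * conj e))).re)) 0 := fun e => by
    have h1 := hasDerivAt_hamZ (ν := ν) (κ := κ) (ζ := undiag ν m κ g (Pi.single j e)) (S := {j, -j})
      hm hg hz hz2 hzq (fun k hk => by
        simp only [Finset.mem_insert, Finset.mem_singleton, not_or] at hk
        have : -k ≠ j := fun h => hk.2 (by rw [← h, neg_neg])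
        rw [undiag_apply, Pi.single_eq_of_ne hk.1, Pi.single_eq_of_ne this]
        simp) hα hρ hF
    rw [Finset.sum_pair hjn] at h1
    have e1 : undiag ν m κ g (Pi.single j e) j = diagA ν m κ g j * e := by
      rw [undiag_apply, Pi.single_eq_same, Pi.single_eq_of_ne hj']; simp
    have e2 : undiag ν m κ g (Pi.single j e) (-j) = -(diagB ν m κ g j * conj e) := by
      rw [undiag_apply, neg_neg, Pi.single_eq_same, Pi.single_eq_of_ne hj', diagB_neg]; simp
    rw [e1, e2] at h1
    have e3 : (fun h : ℝ => hamW ν m κ g (w + Pi.single j ((h : ℂ) * e))) =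
        fun h : ℝ => hamZ ν m κ g (fun k => z k + h * undiag ν m κ g (Pi.single j e) k) := by
      ext h
      rw [hamW, hzw, ← undiag_add_real_smul]
      congr 2
      ext k
      rw [Pi.add_apply]
      congr 1
      by_cases hk : k = j
      · subst hk; simp
      · simp [hk]
    rw [e3]
    exact h1
  have k1 := (key 1).deriv
  have k2 := (key Complex.I).deriv
  simp only [mul_one] at k1
  rw [dbar, k1, k2]
  apply Complex.ext <;> simp <;> ring

end Diag

end QHD
end

/-! ### Hadamard's lemma and passage between the real and extended norms -/

noncomputable section

namespace QHD

open scoped ENNReal ComplexConjugate Topology Pointwise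
open UnitAddTorus

section Hadamard

/-- The averages `t ↦ ∫₀¹ θ^k f(θt) dθ` appearing in Hadamard's lemma. -/
def avg (k : ℕ) (f : ℝ → ℝ) (t : ℝ) : ℝ := ∫ θ in (0:ℝ)..1, θ ^ k * f (θ * t)

lemma hasDerivAt_avg {f : ℝ → ℝ} (hf : ContDiff ℝ 1 f) (k : ℕ) (t : ℝ) :
    HasDerivAt (avg k f) (avg (k + 1) (deriv f) t) t := by
  have hd : Differentiable ℝ f := hf.differentiable one_ne_zero
  have hc : Continuous (deriv f) := hf.continuous_deriv le_rfl
  obtain ⟨M, hM⟩ := (isCompact_closedBall (0:ℝ) (|t| + 1)).exists_bound_of_continuousOn hc.continuousOn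
  have := intervalIntegral.hasDerivAt_integral_of_dominated_loc_of_deriv_le (𝕜 := ℝ) (μ := volume)
    (a := 0) (b := 1) (x₀ := t) (F := fun t θ => θ ^ k * f (θ * t))
    (F' := fun t θ => θ ^ (k + 1) * deriv f (θ * t)) (bound := fun _ => M)
    (Metric.ball_mem_nhds t one_pos)
    (Filter.Eventually.of_forall fun x => (by
      have := hd.continuous
      exact Continuous.aestronglyMeasurable (by fun_prop)))
    (by have := hd.continuous; exact Continuous.intervalIntegrable (by fun_prop) _ _)
    (Continuous.aestronglyMeasurable (by fun_prop)) ?_ (by simp) ?_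
  · exact this.2
  · refine Filter.Eventually.of_forall fun θ hθ x hx => ?_
    rw [Set.uIoc_of_le zero_le_one] at hθ
    have hx' : |x| ≤ |t| + 1 := by
      have h1 : |x - t| < 1 := by simpa [Real.dist_eq] using hx
      have := abs_sub_abs_le_abs_sub x t
      linarith
    have h2 : ‖deriv f (θ * x)‖ ≤ M := hM _ (by
      rw [mem_closedBall_zero_iff, norm_mul, Real.norm_of_nonneg hθ.1.le, Real.norm_eq_abs]
      nlinarith [hθ.2, abs_nonneg x])
    rw [norm_mul, norm_pow, Real.norm_of_nonneg hθ.1.le]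
    calc _ ≤ 1 * M := by gcongr; exact pow_le_one₀ hθ.1.le hθ.2
      _ = M := one_mul M
  · refine Filter.Eventually.of_forall fun θ hθ x hx => ?_
    have h1 := ((hd (θ * x)).hasDerivAt.comp x ((hasDerivAt_id x).const_mul θ)).const_mul (θ ^ k)
    refine h1.congr_deriv ?_
    simp; ring

lemma contDiff_avg {f : ℝ → ℝ} (hf : ContDiff ℝ ∞ f) (k : ℕ) : ContDiff ℝ ∞ (avg k f) := by
  rw [contDiff_infty]
  intro n
  induction n generalizing f k with
  | zero =>
    refine contDiff_zero.2 (continuous_iff_continuousAt.2 fun t => ?_)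
    exact (hasDerivAt_avg (hf.of_le (by exact_mod_cast le_top)) k t).continuousAt
  | succ n ih =>
    have hd := hasDerivAt_avg (f := f) (hf.of_le (by exact_mod_cast le_top)) k
    push_cast
    rw [contDiff_succ_iff_deriv]
    refine ⟨fun t => (hd t).differentiableAt, by simp, ?_⟩
    rw [show deriv (avg k f) = avg (k + 1) (deriv f) from funext fun t => (hd t).deriv]
    exact ih (contDiff_infty_iff_deriv.1 hf).2 (k + 1)

lemma eq_add_mul_avg {f : ℝ → ℝ} (hf : ContDiff ℝ ∞ f) (t : ℝ) :
    f t = f 0 + t * avg 0 (deriv f) t := by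
  have hd := (contDiff_infty_iff_deriv.1 hf)
  have h1 := intervalIntegral.integral_eq_sub_of_hasDerivAt (a := 0) (b := 1)
    (f := fun θ => f (θ * t)) (f' := fun θ => t * deriv f (θ * t))
    (fun θ _ => by
      have := ((hd.1 (θ * t)).hasDerivAt.comp θ ((hasDerivAt_id θ).mul_const t))
      refine this.congr_deriv ?_
      simp; ring)
    (by have := hd.2.continuous; exact Continuous.intervalIntegrable (by fun_prop) _ _)
  rw [intervalIntegral.integral_const_mul] at h1
  simp only [avg, pow_zero, one_mul]
  rw [h1]; simp

/-- Hadamard's lemma three times, applied to a cut-off of `t ↦ g (m + t)`. Integral averages are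
used so that the remainder factor `h` is itself smooth and `exists_funcCalc` can be applied to it.
-/
lemma exists_taylor {g : ℝ → ℝ} {m : ℝ} (hm : 0 < m) (hg : ContDiffOn ℝ ∞ g (Set.Ioi 0))
    (hgm : g m = 0) : ∃ (g₂ : ℝ) (h : ℝ → ℝ) (r : ℝ), 0 < r ∧ ContDiff ℝ ∞ h ∧
      ∀ t, |t| ≤ r → g (m + t) = deriv g m * t + g₂ * t ^ 2 + t ^ 3 * h t := by
  obtain ⟨f, r, hr, -, -, hf, -, hfg⟩ := exists_cutoff (h := fun t => g (m + t)) hm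
    (hg.comp (contDiff_const.add contDiff_id).contDiffOn fun t ht => by
      have := ht.1; simp only [Set.mem_Ioi]; linarith)
  set f₀ : ℝ → ℝ := fun t => (f t).re with hf₀
  have hf₀c : ContDiff ℝ ∞ f₀ := Complex.reCLM.contDiff.comp hf
  have hfg' : ∀ t, |t| ≤ r → f₀ t = g (m + t) := fun t ht => by
    simp only [hf₀]; rw [hfg t ht]; simp
  set f₁ := avg 0 (deriv f₀)
  have hf₁ : ContDiff ℝ ∞ f₁ := contDiff_avg (contDiff_infty_iff_deriv.1 hf₀c).2 0
  set f₂ := avg 0 (deriv f₁)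
  have hf₂ : ContDiff ℝ ∞ f₂ := contDiff_avg (contDiff_infty_iff_deriv.1 hf₁).2 0
  set f₃ := avg 0 (deriv f₂)
  have hf₃ : ContDiff ℝ ∞ f₃ := contDiff_avg (contDiff_infty_iff_deriv.1 hf₂).2 0
  refine ⟨f₂ 0, f₃, r, hr, hf₃, fun t ht => ?_⟩
  have e0 : f₀ 0 = 0 := by rw [hfg' 0 (by simpa using hr.le), add_zero, hgm]
  have e1 : f₁ 0 = deriv g m := by
    have h1 : f₁ 0 = deriv f₀ 0 := by simp [f₁, avg]
    have h2 : f₀ =ᶠ[𝓝 0] fun t => g (m + t) := by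
      filter_upwards [(isOpen_lt continuous_abs continuous_const).mem_nhds
        (show |(0:ℝ)| < r by simpa using hr)] with y hy using hfg' y (le_of_lt hy)
    rw [h1, h2.deriv_eq, deriv_comp_const_add]; simp
  rw [← hfg' t ht, eq_add_mul_avg hf₀c t, e0]
  change 0 + t * f₁ t = _
  rw [eq_add_mul_avg hf₁ t, e1]
  change 0 + t * (_ + t * f₂ t) = _
  rw [eq_add_mul_avg hf₂ t]
  change 0 + t * (_ + t * (_ + t * f₃ t)) = _
  ring

end Hadamard

section Convert
variable {d : ℕ}

lemma wt_mul_enorm_sq (a : ℝ) (u : Freq d → ℂ) (j : Freq d) :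
    (wt a j * ‖u j‖ₑ) ^ 2 = ENNReal.ofReal (bracket j ^ (2 * a) * ‖u j‖ ^ 2) := by
  have hb := bracket_pos j
  rw [wt, ← ofReal_norm, ← ENNReal.ofReal_mul (by positivity), ← ENNReal.ofReal_pow (by positivity),
    mul_pow, ← Real.rpow_natCast, ← Real.rpow_mul hb.le]
  congr 3; push_cast; ring

lemma summable_sq_of_wl2 {a : ℝ} {u : Freq d → ℂ} (h : wl2 a u ≠ ⊤) :
    Summable fun j => bracket j ^ (2 * a) * ‖u j‖ ^ 2 := by
  have h1 : ∑' j, ENNReal.ofReal (bracket j ^ (2 * a) * ‖u j‖ ^ 2) ≠ ⊤ := by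
    simp_rw [← wt_mul_enorm_sq]
    rw [← l2_sq]
    exact ENNReal.pow_ne_top h
  have h2 := ENNReal.summable_toReal h1
  refine h2.congr fun j => ?_
  have hb := bracket_pos j
  rw [ENNReal.toReal_ofReal (by positivity)]

lemma wl2_eq_ofReal {a : ℝ} {u : Freq d → ℂ}
    (h : Summable fun j => bracket j ^ (2 * a) * ‖u j‖ ^ 2) :
    wl2 a u = ENNReal.ofReal (sobolevNorm a u) := by
  have hnn : ∀ j, 0 ≤ bracket j ^ (2 * a) * ‖u j‖ ^ 2 := fun j => by
    have hb := bracket_pos j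
    positivity
  have h1 : wl2 a u ^ 2 = ENNReal.ofReal (sobolevNorm a u) ^ 2 := by
    rw [wl2, l2_sq, sobolevNorm, ← ENNReal.ofReal_pow (Real.sqrt_nonneg _),
      Real.sq_sqrt (tsum_nonneg hnn), ENNReal.ofReal_tsum_of_nonneg hnn h]
    simp_rw [wt_mul_enorm_sq]
  exact le_antisymm (le_of_sq_le h1.le) (le_of_sq_le h1.ge)

lemma tsum_sq_le_of_wl2 {a ε : ℝ} (ha : 0 ≤ a) (hε : 0 ≤ ε) {u : Freq d → ℂ}
    (h : wl2 a u ≤ ENNReal.ofReal ε) :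
    (Summable fun j => ‖u j‖ ^ 2) ∧ ∑' j, ‖u j‖ ^ 2 ≤ ε ^ 2 := by
  have h0 : wl2 0 u ≤ ENNReal.ofReal ε := (wl2_mono ha u).trans h
  have h1 := summable_sq_of_wl2 (ne_top_of_le_ne_top ENNReal.ofReal_ne_top h0)
  rw [wl2_eq_ofReal h1, ENNReal.ofReal_le_ofReal_iff hε, sobolevNorm] at h0
  simp only [mul_zero, Real.rpow_zero, one_mul] at h0 h1
  exact ⟨h1, (Real.sqrt_le_left hε).1 h0⟩

lemma sob_synth {a : ℝ} {z : Freq d → ℂ} (hz : Summable z) :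
    sob a (synth z) = ENNReal.ofReal (tc d) * wl2 a z := by
  unfold sob wl2
  rw [← l2_const_mul]
  congr 1; ext j
  rw [coef_synth hz, enorm_mul, ← ofReal_norm (tc d : ℂ), Complex.norm_real,
    Real.norm_of_nonneg tc_pos.le]
  ring

end Convert

end QHD
end

/-! ### Orders of vanishing and expansion of the nonlinearity -/

noncomputable section

namespace QHD

open scoped ENNReal ComplexConjugate Topology Pointwise
open UnitAddTorus

section Order
variable {d : ℕ}

/-- `Φ(z)` is of order `k` at `z = 0` in `H^s`. -/
def BigOrd (s : ℝ) (k : ℕ) (Φ : (Freq d → ℂ) → C(UnitAddTorus (Fin d), ℂ)) : Prop :=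
  ∃ C r : ℝ, 0 ≤ C ∧ 0 < r ∧ ∀ ε z, 0 ≤ ε → ε ≤ r → z 0 = 0 → wl2 s z ≤ ENNReal.ofReal ε →
    sob s (Φ z) ≤ ENNReal.ofReal (C * ε ^ k)

/-- The scalar `σ(z)` is of order `k` at `z = 0`. -/
def ScalOrd (s : ℝ) (k : ℕ) (σ : (Freq d → ℂ) → ℝ) : Prop :=
  ∃ C r : ℝ, 0 ≤ C ∧ 0 < r ∧ ∀ ε z, 0 ≤ ε → ε ≤ r → z 0 = 0 → wl2 s z ≤ ENNReal.ofReal ε →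
    |σ z| ≤ C * ε ^ k

variable {s : ℝ} {k l : ℕ} {Φ Ψ : (Freq d → ℂ) → C(UnitAddTorus (Fin d), ℂ)}
  {σ τ : (Freq d → ℂ) → ℝ}

lemma BigOrd.add (h1 : BigOrd s k Φ) (h2 : BigOrd s k Ψ) : BigOrd s k (fun z => Φ z + Ψ z) := by
  obtain ⟨C1, r1, hC1, hr1, h1⟩ := h1
  obtain ⟨C2, r2, hC2, hr2, h2⟩ := h2
  refine ⟨C1 + C2, min r1 r2, by positivity, lt_min hr1 hr2, fun ε z hε hεr hz0 hz => ?_⟩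
  refine (sob_add_le _ _ _).trans ((add_le_add
    (h1 ε z hε (hεr.trans (min_le_left _ _)) hz0 hz)
    (h2 ε z hε (hεr.trans (min_le_right _ _)) hz0 hz)).trans (le_of_eq ?_))
  rw [← ENNReal.ofReal_add (by positivity) (by positivity), add_mul]

lemma BigOrd.mul (hs : d ≤ s) (h1 : BigOrd s k Φ) (h2 : BigOrd s l Ψ) :
    BigOrd s (k + l) (fun z => Φ z * Ψ z) := by
  obtain ⟨C1, r1, hC1, hr1, h1⟩ := h1
  obtain ⟨C2, r2, hC2, hr2, h2⟩ := h2
  have hA := algConst_ne_top (d := d) s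
  refine ⟨(algConst d s).toReal * (C1 * C2), min r1 r2, by positivity, lt_min hr1 hr2,
    fun ε z hε hεr hz0 hz => ?_⟩
  have h1' := h1 ε z hε (hεr.trans (min_le_left _ _)) hz0 hz
  have h2' := h2 ε z hε (hεr.trans (min_le_right _ _)) hz0 hz
  refine (sob_mul_le hs (ne_top_of_le_ne_top ENNReal.ofReal_ne_top h1')).trans
    ((mul_le_mul_right (mul_le_mul' h1' h2') _).trans (le_of_eq ?_))
  rw [← ENNReal.ofReal_mul (by positivity), ← ENNReal.ofReal_toReal hA,
    ← ENNReal.ofReal_mul (by positivity), ENNReal.toReal_ofReal (by positivity)]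
  congr 1; ring

lemma BigOrd.star (h1 : BigOrd s k Φ) : BigOrd s k (fun z => star (Φ z)) := by
  obtain ⟨C1, r1, hC1, hr1, h1⟩ := h1
  exact ⟨C1, r1, hC1, hr1, fun ε z hε hεr hz0 hz => by
    rw [sob_star]; exact h1 ε z hε hεr hz0 hz⟩

lemma BigOrd.smul (h1 : ScalOrd s k σ) (h2 : BigOrd s l Ψ) :
    BigOrd s (k + l) (fun z => (σ z : ℂ) • Ψ z) := by
  obtain ⟨C1, r1, hC1, hr1, h1⟩ := h1
  obtain ⟨C2, r2, hC2, hr2, h2⟩ := h2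
  refine ⟨C1 * C2, min r1 r2, by positivity, lt_min hr1 hr2, fun ε z hε hεr hz0 hz => ?_⟩
  have h1' := h1 ε z hε (hεr.trans (min_le_left _ _)) hz0 hz
  have h2' := h2 ε z hε (hεr.trans (min_le_right _ _)) hz0 hz
  rw [sob_smul, ← ofReal_norm (σ z : ℂ), Complex.norm_real, Real.norm_eq_abs]
  refine (mul_le_mul' (ENNReal.ofReal_le_ofReal h1') h2').trans (le_of_eq ?_)
  rw [← ENNReal.ofReal_mul (by positivity)]
  congr 1; ring

lemma BigOrd.mono (h : k ≤ l) (h1 : BigOrd s l Φ) : BigOrd s k Φ := by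
  obtain ⟨C1, r1, hC1, hr1, h1⟩ := h1
  refine ⟨C1, min r1 1, hC1, lt_min hr1 one_pos, fun ε z hε hεr hz0 hz => ?_⟩
  refine (h1 ε z hε (hεr.trans (min_le_left _ _)) hz0 hz).trans (ENNReal.ofReal_le_ofReal ?_)
  exact mul_le_mul_of_nonneg_left (pow_le_pow_of_le_one hε (hεr.trans (min_le_right _ _)) h) hC1

lemma ScalOrd.const (c : ℝ) : ScalOrd (d := d) s 0 (fun _ => c) :=
  ⟨|c|, 1, abs_nonneg c, one_pos, fun ε z hε hεr hz0 hz => by simp⟩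

lemma ScalOrd.mono (h : k ≤ l) (h1 : ScalOrd s l σ) : ScalOrd s k σ := by
  obtain ⟨C1, r1, hC1, hr1, h1⟩ := h1
  refine ⟨C1, min r1 1, hC1, lt_min hr1 one_pos, fun ε z hε hεr hz0 hz => ?_⟩
  refine (h1 ε z hε (hεr.trans (min_le_left _ _)) hz0 hz).trans ?_
  exact mul_le_mul_of_nonneg_left (pow_le_pow_of_le_one hε (hεr.trans (min_le_right _ _)) h) hC1

lemma ScalOrd.add (h1 : ScalOrd s k σ) (h2 : ScalOrd s k τ) : ScalOrd s k (fun z => σ z + τ z) := by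
  obtain ⟨C1, r1, hC1, hr1, h1⟩ := h1
  obtain ⟨C2, r2, hC2, hr2, h2⟩ := h2
  refine ⟨C1 + C2, min r1 r2, by positivity, lt_min hr1 hr2, fun ε z hε hεr hz0 hz => ?_⟩
  rw [add_mul]
  exact (abs_add_le _ _).trans (add_le_add
    (h1 ε z hε (hεr.trans (min_le_left _ _)) hz0 hz)
    (h2 ε z hε (hεr.trans (min_le_right _ _)) hz0 hz))

lemma ScalOrd.mul (h1 : ScalOrd s k σ) (h2 : ScalOrd s l τ) :
    ScalOrd s (k + l) (fun z => σ z * τ z) := by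
  obtain ⟨C1, r1, hC1, hr1, h1⟩ := h1
  obtain ⟨C2, r2, hC2, hr2, h2⟩ := h2
  refine ⟨C1 * C2, min r1 r2, by positivity, lt_min hr1 hr2, fun ε z hε hεr hz0 hz => ?_⟩
  rw [abs_mul]
  refine (mul_le_mul (h1 ε z hε (hεr.trans (min_le_left _ _)) hz0 hz)
    (h2 ε z hε (hεr.trans (min_le_right _ _)) hz0 hz) (abs_nonneg _) (by positivity)).trans
      (le_of_eq ?_)
  ring

lemma BigOrd.one : BigOrd (d := d) s 0 (fun _ => 1) :=
  ⟨1, 1, zero_le_one, one_pos, fun ε z hε hεr hz0 hz => by simp [sob_one]⟩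

lemma bigOrd_synth (hs : d ≤ s) : BigOrd (d := d) s 1 synth := by
  refine ⟨tc d, 1, tc_pos.le, one_pos, fun ε z hε hεr hz0 hz => ?_⟩
  rw [sob_synth (summable_of_wl2 hs (ne_top_of_le_ne_top ENNReal.ofReal_ne_top hz)), pow_one,
    ENNReal.ofReal_mul tc_pos.le]
  gcongr

/-- The mean value of `|Z|²`. -/
def meanSq (z : Freq d → ℂ) : ℝ := ((2 * Real.pi) ^ d)⁻¹ * ∑' j : Freq d, ‖z j‖ ^ 2

lemma meanSq_nonneg (z : Freq d → ℂ) : 0 ≤ meanSq z :=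
  mul_nonneg (by positivity) (tsum_nonneg fun _ => by positivity)

lemma scalOrd_meanSq (hs : 0 ≤ s) : ScalOrd (d := d) s 2 meanSq := by
  refine ⟨((2 * Real.pi) ^ d)⁻¹, 1, by positivity, one_pos, fun ε z hε hεr hz0 hz => ?_⟩
  rw [abs_of_nonneg (meanSq_nonneg z)]
  exact mul_le_mul_of_nonneg_left (tsum_sq_le_of_wl2 hs hε hz).2 (by positivity)

lemma zeroMode_eq (m : ℝ) (z : Freq d → ℂ) : zeroMode m z = Real.sqrt (m - meanSq z) := rfl

/-- With `μ = meanSq z`, one has `√m - √(m - μ) ≤ μ / √m`. The bound also holds for `μ > m`, where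
the root of a negative number is `0` by convention. -/
lemma scalOrd_zeroMode_sub (hs : 0 ≤ s) {m : ℝ} (hm : 0 < m) :
    ScalOrd (d := d) s 2 (fun z => zeroMode m z - Real.sqrt m) := by
  obtain ⟨C, r, hC, hr, h⟩ := scalOrd_meanSq (d := d) hs
  refine ⟨C / Real.sqrt m, r, by positivity, hr, fun ε z hε hεr hz0 hz => ?_⟩
  have h1 := h ε z hε hεr hz0 hz
  rw [abs_of_nonneg (meanSq_nonneg z)] at h1
  have h2 : Real.sqrt (m - meanSq z) ≤ Real.sqrt m := Real.sqrt_le_sqrt (by linarith [meanSq_nonneg z])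
  have hm' := Real.sqrt_pos.2 hm
  change |zeroMode m z - Real.sqrt m| ≤ _
  rw [zeroMode_eq, abs_sub_comm, abs_of_nonneg (by linarith), div_mul_eq_mul_div, le_div_iff₀ hm']
  have h3 := Real.sq_sqrt hm.le
  by_cases hle : meanSq z ≤ m
  · have h4 := Real.sq_sqrt (sub_nonneg.2 hle)
    nlinarith [Real.sqrt_nonneg (m - meanSq z)]
  · rw [Real.sqrt_eq_zero_of_nonpos (x := m - meanSq z) (by linarith)]
    nlinarith

lemma scalOrd_zeroMode (hs : 0 ≤ s) {m : ℝ} (hm : 0 < m) :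
    ScalOrd (d := d) s 0 (zeroMode m) := by
  have := ((scalOrd_zeroMode_sub (d := d) hs hm).mono (Nat.zero_le 2)).add
    (ScalOrd.const (Real.sqrt m))
  simpa using this

lemma scalOrd_inv_zeroMode (hs : 0 ≤ s) {m : ℝ} (hm : 0 < m) :
    ScalOrd (d := d) s 0 (fun z => (zeroMode m z)⁻¹) := by
  obtain ⟨C, r, hC, hr, h⟩ := scalOrd_zeroMode_sub (d := d) hs hm
  have hm' := Real.sqrt_pos.2 hm
  refine ⟨(Real.sqrt m / 2)⁻¹, min r (min 1 (Real.sqrt m / 2 / (C + 1))), by positivity,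
    lt_min hr (lt_min one_pos (by positivity)), fun ε z hε hεr hz0 hz => ?_⟩
  have h1 := h ε z hε (hεr.trans (min_le_left _ _)) hz0 hz
  have h2 : ε ≤ 1 := hεr.trans ((min_le_right _ _).trans (min_le_left _ _))
  have h3 : ε ≤ Real.sqrt m / 2 / (C + 1) := hεr.trans ((min_le_right _ _).trans (min_le_right _ _))
  rw [le_div_iff₀ (by positivity)] at h3
  have h4 : C * ε ^ 2 ≤ Real.sqrt m / 2 := by nlinarith
  rw [abs_le] at h1
  have h5 : Real.sqrt m / 2 ≤ zeroMode m z := by linarith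
  rw [abs_of_pos (inv_pos.2 (by linarith)), pow_zero, mul_one]
  exact inv_anti₀ (by positivity) h5

lemma scalOrd_coef (hs : 0 ≤ s) (h : BigOrd s k Φ) (j : Freq d) :
    ScalOrd s k (fun z => (coef (Φ z) j).re) := by
  obtain ⟨C, r, hC, hr, h⟩ := h
  refine ⟨C, r, hC, hr, fun ε z hε hεr hz0 hz => ?_⟩
  have h1 := h ε z hε hεr hz0 hz
  have h2 : ‖coef (Φ z) j‖ₑ ≤ ENNReal.ofReal (C * ε ^ k) := by
    refine le_trans ?_ ((le_l2 _ j).trans h1)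
    exact le_mul_of_one_le_left zero_le (one_le_wt hs j)
  rw [← ofReal_norm, ENNReal.ofReal_le_ofReal_iff (by positivity)] at h2
  exact (Complex.abs_re_le_norm _).trans h2

end Order

section Expansion
variable {d : ℕ}

/-- The quadratic part of `g(|α+z|²)(α+z)`. -/
def quadF (p q : ℝ) (Z : C(UnitAddTorus (Fin d), ℂ)) : C(UnitAddTorus (Fin d), ℂ) :=
  (p : ℂ) • (Z * star Z + (Z + star Z) * Z) + (q : ℂ) • ((Z + star Z) * (Z + star Z))

/-- Second order expansion of `g(|α+z|²)(α+z)` with a cubic remainder in `H^s`. -/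
lemma exists_expansion {s m : ℝ} {g : ℝ → ℝ} (hs : d + 1 ≤ s) (hm : 0 < m)
    (hg : ContDiffOn ℝ ∞ g (Set.Ioi 0)) (hgm : g m = 0) :
    ∃ (p q : ℝ) (c : (Freq d → ℂ) → ℝ) (R : (Freq d → ℂ) → C(UnitAddTorus (Fin d), ℂ)),
      BigOrd s 3 R ∧ ScalOrd s 2 c ∧ ∃ r : ℝ, 0 < r ∧ ∀ z : Freq d → ℂ, z 0 = 0 →
        wl2 s z ≤ ENNReal.ofReal r → ∃ F : C(UnitAddTorus (Fin d), ℂ),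
          (∀ t, F t = (g (‖(zeroMode m z : ℂ) + synth z t‖ ^ 2) : ℝ) *
            ((zeroMode m z : ℂ) + synth z t)) ∧
          (∀ t, |‖(zeroMode m z : ℂ) + synth z t‖ ^ 2 - m| ≤ m / 2) ∧ meanSq z < m ∧
          F = ((deriv g m * m : ℝ) : ℂ) • (synth z + star (synth z)) + quadF p q (synth z) +
            (c z : ℂ) • 1 + R z := by
  have hsd : (d : ℝ) ≤ s := by linarith
  have hs0 : 0 ≤ s := le_trans (by positivity) hsd
  obtain ⟨g₂, h, rh, hrh, hh, htay⟩ := exists_taylor hm hg hgm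
  set ρ := min rh (m / 2) with hρ
  have hρ0 : 0 < ρ := lt_min hrh (by positivity)
  obtain ⟨r₁, hr₁, CH, hCH, hH⟩ := exists_funcCalc (d := d) hs hρ0 (hh.contDiffOn (s := Set.Ioo (-ρ) ρ))
  choose! H hHt hHs hHρ using hH
  set g₁ := deriv g m
  set σ := Real.sqrt m
  let Z : (Freq d → ℂ) → C(UnitAddTorus (Fin d), ℂ) := synth
  let X : (Freq d → ℂ) → C(UnitAddTorus (Fin d), ℂ) := fun z => Z z + star (Z z)
  let η : (Freq d → ℂ) → ℝ := fun z => zeroMode m z - σ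
  let Y₁ : (Freq d → ℂ) → C(UnitAddTorus (Fin d), ℂ) := fun z => (σ : ℂ) • X z
  -- Since `α² = m - meanSq z`, the density is exactly `|α + Z|² = m + Y₁ + Y₂` with `Y₁` linear and
  -- `Y₂` of order two; `η = α - √m` is itself of order two.
  let Y₂ : (Freq d → ℂ) → C(UnitAddTorus (Fin d), ℂ) := fun z =>
    (η z : ℂ) • X z + (Z z * star (Z z) + ((-1 * meanSq z : ℝ) : ℂ) • 1)
  let Y : (Freq d → ℂ) → C(UnitAddTorus (Fin d), ℂ) := fun z => Y₁ z + Y₂ z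
  let U : (Freq d → ℂ) → C(UnitAddTorus (Fin d), ℂ) := fun z => (zeroMode m z : ℂ) • 1 + Z z
  have oZ : BigOrd s 1 Z := bigOrd_synth hsd
  have oX : BigOrd s 1 X := oZ.add oZ.star
  have oη : ScalOrd s 2 η := scalOrd_zeroMode_sub hs0 hm
  have oμ : ScalOrd (d := d) s 2 meanSq := scalOrd_meanSq hs0
  have oY₁ : BigOrd s 1 Y₁ := by
    have := BigOrd.smul (ScalOrd.const σ) oX; rwa [zero_add] at this
  have oY₂ : BigOrd s 2 Y₂ := by
    refine ((BigOrd.smul oη oX).mono (by norm_num)).add ((oZ.mul hsd oZ.star).add ?_)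
    have := BigOrd.smul ((ScalOrd.const (-1)).mul oμ) (BigOrd.one (d := d) (s := s))
    exact this.mono (by norm_num)
  have oY : BigOrd s 1 Y := oY₁.add (oY₂.mono (by norm_num))
  have oU : BigOrd s 0 U := by
    have := BigOrd.smul (scalOrd_zeroMode (d := d) hs0 hm) (BigOrd.one (d := d) (s := s))
    exact this.add (oZ.mono (by norm_num))
  obtain ⟨CY, rY, hCY, hrY, hY⟩ := id oY
  have hYim : ∀ z t, (Y z t).im = 0 := fun z t => by
    simp [Y, Y₁, Y₂, X, Complex.mul_im]
    ring
  set r₂ := min rY (r₁ / (CY + 1)) with hr₂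
  have hr₂0 : 0 < r₂ := lt_min hrY (by positivity)
  have hYs : ∀ z, z 0 = 0 → wl2 s z ≤ ENNReal.ofReal r₂ → sob s (Y z) ≤ ENNReal.ofReal r₁ :=
    fun z hz0 hz => by
    refine (hY r₂ z hr₂0.le (min_le_left _ _) hz0 hz).trans (ENNReal.ofReal_le_ofReal ?_)
    have : r₂ ≤ r₁ / (CY + 1) := min_le_right _ _
    rw [le_div_iff₀ (by positivity)] at this
    rw [pow_one]; nlinarith
  have oH : BigOrd s 0 (fun z => H (Y z)) := by
    refine ⟨CH.toReal, r₂, ENNReal.toReal_nonneg, hr₂0, fun ε z hε hεr hz0 hz => ?_⟩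
    rw [pow_zero, mul_one, ENNReal.ofReal_toReal hCH]
    exact hHs _ (hYim z) (hYs z hz0 (hz.trans (ENNReal.ofReal_le_ofReal hεr)))
  -- The terms of order at least three: those of `g₁ Y U` left after using `α² = m - meanSq z`,
  -- those of `g₂ Y² U`, and the Taylor remainder `Y³ H(Y) U`.
  let R : (Freq d → ℂ) → C(UnitAddTorus (Fin d), ℂ) := fun z =>
    (g₁ : ℂ) • (((-1 * meanSq z : ℝ) : ℂ) • X z + ((η z : ℂ) • (Z z * star (Z z)) + Y₂ z * Z z)) +
    ((g₂ : ℂ) • ((Y₁ z * Y₁ z) * ((η z : ℂ) • 1 + Z z) +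
      ((Y₁ z * Y₂ z + Y₁ z * Y₂ z) + Y₂ z * Y₂ z) * U z) +
    (Y z * (Y z * Y z)) * (H (Y z) * U z))
  have oR : BigOrd s 3 R := by
    refine BigOrd.add ?_ (BigOrd.add ?_ ?_)
    · have h1 : BigOrd s 3 (fun z => ((-1 * meanSq z : ℝ) : ℂ) • X z +
          ((η z : ℂ) • (Z z * star (Z z)) + Y₂ z * Z z)) := by
        refine ((BigOrd.smul ((ScalOrd.const (-1)).mul oμ) oX).mono (by norm_num)).add
          (((BigOrd.smul oη (oZ.mul hsd oZ.star)).mono (by norm_num)).add (oY₂.mul hsd oZ))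
      exact (BigOrd.smul (ScalOrd.const g₁) h1).mono (by norm_num)
    · have h1 : BigOrd s 1 (fun z => (η z : ℂ) • 1 + Z z) :=
        ((BigOrd.smul oη BigOrd.one).mono (by norm_num)).add oZ
      have h2 : BigOrd s 3 (fun z => (Y₁ z * Y₁ z) * ((η z : ℂ) • 1 + Z z) +
          ((Y₁ z * Y₂ z + Y₁ z * Y₂ z) + Y₂ z * Y₂ z) * U z) := by
        refine ((oY₁.mul hsd oY₁).mul hsd h1).add ?_
        refine BigOrd.mul (k := 3) (l := 0) hsd ?_ oU
        exact ((oY₁.mul hsd oY₂).add (oY₁.mul hsd oY₂)).add ((oY₂.mul hsd oY₂).mono (by norm_num))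
      exact (BigOrd.smul (ScalOrd.const g₂) h2).mono (by norm_num)
    · exact (oY.mul hsd (oY.mul hsd oY)).mul hsd (oH.mul hsd oU)
  obtain ⟨Cμ, rμ, hCμ, hrμ, hμ⟩ := id oμ
  set r₃ := min r₂ (min rμ (min 1 (m / 2 / (Cμ + 1)))) with hr₃
  have hr₃0 : 0 < r₃ := lt_min hr₂0 (lt_min hrμ (lt_min one_pos (by positivity)))
  -- The quadratic coefficients come from `g₁ √m (|Z|² + X Z)` and `g₂ (√m X)² √m`. The constant
  -- `-g₁ α meanSq z` affects only the zeroth Fourier coefficient.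
  refine ⟨g₁ * σ, g₂ * m * σ, fun z => (-g₁) * (zeroMode m z * meanSq z), R, oR, ?_, r₃, hr₃0,
    fun z hz0 hz => ?_⟩
  · exact (ScalOrd.const (-g₁)).mul ((scalOrd_zeroMode (d := d) hs0 hm).mul oμ)
  have hμm : meanSq z < m := by
    have h1 := hμ r₃ z hr₃0.le ((min_le_right _ _).trans (min_le_left _ _)) hz0 hz
    rw [abs_of_nonneg (meanSq_nonneg z)] at h1
    have h2 : r₃ ≤ 1 := (min_le_right _ _).trans ((min_le_right _ _).trans (min_le_left _ _))
    have h3 : r₃ ≤ m / 2 / (Cμ + 1) :=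
      (min_le_right _ _).trans ((min_le_right _ _).trans (min_le_right _ _))
    rw [le_div_iff₀ (by positivity)] at h3
    nlinarith
  have hα2 : zeroMode m z ^ 2 = m - meanSq z :=
    Real.sq_sqrt (sub_nonneg.2 hμm.le)
  have hσ2 : σ ^ 2 = m := Real.sq_sqrt hm.le
  have hYz := hYs z hz0 (hz.trans (ENNReal.ofReal_le_ofReal (min_le_left _ _)))
  have hYt : ∀ t, ‖(zeroMode m z : ℂ) + synth z t‖ ^ 2 = m + (Y z t).re := fun t => by
    have : zeroMode m z = σ + η z := by simp [η]
    rw [this] at hα2 ⊢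
    rw [Complex.sq_norm, Complex.normSq_apply]
    simp [Y, Y₁, Y₂, X, Z]
    ring_nf
    ring_nf at hα2
    linarith
  have hYC : ∀ t, (((Y z t).re : ℝ) : ℂ) = Y z t := fun t => by
    apply Complex.ext <;> simp [hYim]
  have hYρ := hHρ _ (hYim z) hYz
  refine ⟨((g₁ : ℂ) • Y z + (g₂ : ℂ) • (Y z * Y z) + (Y z * (Y z * Y z)) * H (Y z)) * U z,
    fun t => ?_, fun t => ?_, hμm, ?_⟩
  · rw [hYt, htay _ ((hYρ t).le.trans (min_le_left _ _))]
    have hHt' := hHt _ (hYim z) hYz t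
    push_cast
    rw [hYC, ← hHt']
    simp [U, Z]
    left; ring
  · rw [hYt, add_sub_cancel_left]
    exact (hYρ t).le.trans (min_le_right _ _)
  · ext t
    have e1 : ((zeroMode m z : ℝ) : ℂ) = σ + η z := by simp [η]
    have e2 : ((σ : ℂ) + η z) ^ 2 = m - meanSq z := by
      rw [← e1]; exact_mod_cast hα2
    have e3 : (σ : ℂ) ^ 2 = m := by exact_mod_cast hσ2
    have eX : ∀ t, X z t = Z z t + conj (Z z t) := fun t => by simp [X]
    simp only [quadF, R, Y, Y₁, Y₂, U, ContinuousMap.add_apply, ContinuousMap.mul_apply,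
      ContinuousMap.smul_apply, ContinuousMap.star_apply, ContinuousMap.one_apply, smul_eq_mul,
      mul_one, Complex.star_def, eX, e1]
    push_cast
    rw [e1]
    change _ = (g₁ : ℂ) * m * (Z z t + conj (Z z t)) + ((g₁ : ℂ) * σ * (Z z t * conj (Z z t) +
      (Z z t + conj (Z z t)) * Z z t) + (g₂ : ℂ) * m * σ * ((Z z t + conj (Z z t)) *
      (Z z t + conj (Z z t)))) + _ + _
    generalize Z z t = a
    generalize conj a = b
    generalize (H _) t = hh
    have e4 : (m : ℂ) = σ ^ 2 := e3.symm
    have e5 : (meanSq z : ℂ) = σ ^ 2 - (σ + η z) ^ 2 := by rw [e2, e3]; ring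
    rw [e4, e5]
    ring

end Expansion

end QHD
end

/-! ### Symbols of the diagonalization and expansion of the vector field -/

noncomputable section

namespace QHD

open scoped ENNReal ComplexConjugate Topology Pointwise
open UnitAddTorus

section Symbols
variable {d : ℕ} {ν : Fin d → ℝ} {m κ : ℝ} {g : ℝ → ℝ}

lemma hbar_pos (hκ : 0 < κ) : 0 < hbar κ := mul_pos two_pos (Real.sqrt_pos.2 hκ)

lemma offDiag_pos (hm : 0 < m) (hκ : 0 < κ) (hg : 0 < deriv g m) : 0 < offDiag m κ g :=
  div_pos (mul_pos hm hg) (hbar_pos hκ)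

lemma symbSq_nonneg (j : Freq d) : 0 ≤ symbSq ν j :=
  Finset.sum_nonneg fun _ _ => by positivity

lemma elen_sq_le_symbSq (hν : ∀ i, 1 ≤ ν i) (j : Freq d) : elen j ^ 2 ≤ symbSq ν j := by
  rw [elen_sq]
  refine Finset.sum_le_sum fun i _ => ?_
  have : 1 ≤ ν i ^ 2 := one_le_pow₀ (hν i)
  nlinarith [sq_nonneg (j i : ℝ)]

lemma symbSq_le (hν : ∀ i, 1 ≤ ν i) (hν2 : ∀ i, ν i ≤ 2) (j : Freq d) :
    symbSq ν j ≤ 4 * elen j ^ 2 := by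
  rw [elen_sq, Finset.mul_sum]
  refine Finset.sum_le_sum fun i _ => ?_
  have : ν i ^ 2 ≤ 4 := by nlinarith [hν i, hν2 i]
  nlinarith [sq_nonneg (j i : ℝ)]

lemma one_le_symbSq (hν : ∀ i, 1 ≤ ν i) {j : Freq d} (hj : j ≠ 0) : 1 ≤ symbSq ν j :=
  le_trans (by nlinarith [one_le_elen hj]) (elen_sq_le_symbSq hν j)

lemma hbar_mul_offDiag (hκ : 0 < κ) : hbar κ * offDiag m κ g = m * deriv g m := by
  have := hbar_pos hκ
  rw [offDiag]; field_simp

lemma omega_sq (hm : 0 < m) (hg : 0 < deriv g m) (j : Freq d) :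
    omega ν m κ g j ^ 2 = hbar κ ^ 2 / 4 * symbSq ν j ^ 2 + m * deriv g m * symbSq ν j := by
  have := symbSq_nonneg (ν := ν) j
  exact Real.sq_sqrt (by positivity)

lemma omega_nonneg (j : Freq d) : 0 ≤ omega ν m κ g j := Real.sqrt_nonneg _

lemma hbar_half_symbSq_le_omega (hm : 0 < m) (hκ : 0 < κ) (hg : 0 < deriv g m) (j : Freq d) :
    hbar κ / 2 * symbSq ν j ≤ omega ν m κ g j := by
  have h1 := symbSq_nonneg (ν := ν) j
  have h2 := hbar_pos hκ
  refine abs_le_of_sq_le_sq' ?_ (omega_nonneg j) |>.2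
  rw [omega_sq hm hg]
  have : 0 ≤ m * deriv g m * symbSq ν j := by positivity
  nlinarith

lemma omega_pos (hm : 0 < m) (hκ : 0 < κ) (hg : 0 < deriv g m) (hν : ∀ i, 1 ≤ ν i) {j : Freq d}
    (hj : j ≠ 0) : 0 < omega ν m κ g j :=
  lt_of_lt_of_le (mul_pos (half_pos (hbar_pos hκ)) (lt_of_lt_of_le one_pos (one_le_symbSq hν hj)))
    (hbar_half_symbSq_le_omega hm hκ hg j)

/-- The diagonalizing matrix conjugates the linearized operator to `ω`. -/
lemma diag_identities (hm : 0 < m) (hκ : 0 < κ) (hg : 0 < deriv g m) (hν : ∀ i, 1 ≤ ν i)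
    {j : Freq d} (hj : j ≠ 0) :
    let a := diagA ν m κ g j
    let b' := diagB ν m κ g j
    let b := offDiag m κ g
    let Q := hbar κ / 2 * symbSq ν j + b
    (a * Q - b' * b) * a - (a * b - b' * Q) * b' = omega ν m κ g j ∧
      (a * b - b' * Q) * a - (a * Q - b' * b) * b' = 0 ∧ a ^ 2 - b' ^ 2 = 1 := by
  intro a b' b Q
  have hω := omega_pos (κ := κ) hm hκ hg hν hj
  have hb := offDiag_pos hm hκ hg
  have hq := symbSq_nonneg (ν := ν) j
  have hh := hbar_pos hκ
  have hA : 0 < symbA ν m κ g j := by unfold symbA; positivity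
  -- All three identities reduce to `ω² = Q² - b²` together with the normalization `D² = 2ω(ω + Q)`.
  have h1 : omega ν m κ g j ^ 2 = Q ^ 2 - b ^ 2 := by
    rw [omega_sq hm hg, ← hbar_mul_offDiag (g := g) (m := m) hκ]; ring
  have h2 : symbA ν m κ g j = omega ν m κ g j + Q := by simp only [symbA, Q, b]; ring
  have hD : 0 < 2 * omega ν m κ g j * symbA ν m κ g j := by positivity
  set D := Real.sqrt (2 * omega ν m κ g j * symbA ν m κ g j) with hDdef
  have hD0 : 0 < D := Real.sqrt_pos.2 hD
  have hDsq : D ^ 2 = 2 * omega ν m κ g j * symbA ν m κ g j := Real.sq_sqrt hD.le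
  have ea : a = symbA ν m κ g j / D := by simp only [a, diagA, if_neg hj]; rfl
  have eb : b' = b / D := by simp only [b', diagB, if_neg hj]; rfl
  rw [ea, eb]
  rw [h2] at hDsq ⊢
  set o := omega ν m κ g j
  refine ⟨?_, ?_, ?_⟩
  · field_simp
    rw [hDsq]
    linear_combination (-(2 * o + Q)) * h1
  · field_simp
    linear_combination b * h1
  · field_simp
    rw [hDsq]
    linear_combination -h1

/-- Uniform bound for the entries of the diagonalizing matrix. -/
def diagBound (m κ : ℝ) (g : ℝ → ℝ) : ℝ := 2 + offDiag m κ g / hbar κ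

lemma abs_diag_le (hm : 0 < m) (hκ : 0 < κ) (hg : 0 < deriv g m) (hν : ∀ i, 1 ≤ ν i) (j : Freq d) :
    |diagA ν m κ g j| ≤ diagBound m κ g ∧ |diagB ν m κ g j| ≤ diagBound m κ g := by
  have hh := hbar_pos hκ
  have hb := offDiag_pos hm hκ hg
  have hB : 2 ≤ diagBound m κ g := by unfold diagBound; linarith [div_pos hb hh]
  by_cases hj : j = 0
  · subst hj; simp [diagA, diagB]; linarith
  have hω := omega_pos (κ := κ) hm hκ hg hν hj
  have hq := one_le_symbSq hν hj
  have h3 : diagA ν m κ g j ^ 2 - diagB ν m κ g j ^ 2 = 1 := (diag_identities hm hκ hg hν hj).2.2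
  have hA : 0 < symbA ν m κ g j := by unfold symbA; positivity
  have h4 : diagA ν m κ g j ^ 2 ≤ diagBound m κ g := by
    rw [diagA, if_neg hj, div_pow, Real.sq_sqrt (by positivity), sq]
    rw [mul_div_mul_right _ _ hA.ne', div_le_iff₀ (by positivity)]
    have h5 := hbar_half_symbSq_le_omega (ν := ν) hm hκ hg j
    have h6 : hbar κ / 2 ≤ omega ν m κ g j := le_trans (by nlinarith) h5
    have h7 : offDiag m κ g / hbar κ * hbar κ = offDiag m κ g := by field_simp
    have h8 : 0 < offDiag m κ g / hbar κ := div_pos hb hh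
    unfold symbA diagBound
    nlinarith
  constructor
  · refine abs_le_of_sq_le_sq ?_ (by linarith); nlinarith
  · refine abs_le_of_sq_le_sq ?_ (by linarith); nlinarith

end Symbols

section WL2
variable {d : ℕ}

lemma wl2_add_le (a : ℝ) (u v : Freq d → ℂ) : wl2 a (fun j => u j + v j) ≤ wl2 a u + wl2 a v := by
  refine le_trans (l2_mono fun j => ?_) (l2_add_le _ _)
  rw [← mul_add]; gcongr; exact enorm_add_le _ _

lemma wl2_mul_le {a C : ℝ} {c : Freq d → ℝ} (hc : ∀ j, |c j| ≤ C) (u : Freq d → ℂ) :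
    wl2 a (fun j => (c j : ℂ) * u j) ≤ ENNReal.ofReal C * wl2 a u := by
  unfold wl2
  rw [← l2_const_mul]
  refine l2_mono fun j => ?_
  rw [enorm_mul, ← ofReal_norm (c j : ℂ), Complex.norm_real, Real.norm_eq_abs, mul_left_comm]
  gcongr
  exact hc j

lemma wl2_conj_neg (a : ℝ) (u : Freq d → ℂ) : wl2 a (fun j => conj (u (-j))) = wl2 a u := by
  unfold wl2
  rw [← l2_comp_equiv (Equiv.neg (Freq d))]
  congr 1; ext j
  simp only [Equiv.neg_apply, neg_neg, wt_neg, RCLike.enorm_conj]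

end WL2

section Vector
variable {d : ℕ} {ν : Fin d → ℝ} {m κ : ℝ} {g : ℝ → ℝ}

lemma wl2_undiag_le (hm : 0 < m) (hκ : 0 < κ) (hg : 0 < deriv g m) (hν : ∀ i, 1 ≤ ν i) (s : ℝ)
    {w : Freq d → ℂ} {ε : ℝ} (hε : 0 ≤ ε) (hw : wl2 s w ≤ ENNReal.ofReal ε) :
    wl2 s (undiag ν m κ g w) ≤ ENNReal.ofReal (2 * diagBound m κ g * ε) := by
  have hB : 0 ≤ diagBound m κ g := (abs_nonneg _).trans (abs_diag_le (ν := ν) hm hκ hg hν 0).1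
  have e : undiag ν m κ g w = fun j => ((diagA ν m κ g j : ℝ) : ℂ) * w j +
      ((-diagB ν m κ g j : ℝ) : ℂ) * conj (w (-j)) := by
    ext j; rw [undiag_apply]; push_cast; ring
  rw [e]
  have h1 := wl2_mul_le (a := s) (fun j => (abs_diag_le (ν := ν) hm hκ hg hν j).1) w
  have h2 := wl2_mul_le (a := s) (c := fun j => -diagB ν m κ g j)
    (fun j => (abs_neg _).trans_le (abs_diag_le (ν := ν) hm hκ hg hν j).2) (fun j => conj (w (-j)))
  rw [wl2_conj_neg] at h2
  refine (wl2_add_le _ _ _).trans ((add_le_add (h1.trans (mul_le_mul_right hw _))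
    (h2.trans (mul_le_mul_right hw _))).trans (le_of_eq ?_))
  rw [← ENNReal.ofReal_mul hB, ← ENNReal.ofReal_add (by positivity) (by positivity)]
  congr 1; ring

lemma coef_quadF_smul (c p q : ℝ) (Z : C(UnitAddTorus (Fin d), ℂ)) (j : Freq d) :
    (c : ℂ) * coef (quadF p q Z) j = coef (quadF (c * p) (c * q) Z) j := by
  rw [← coef_smul]
  congr 1
  ext t
  simp [quadF]
  ring

/-- Taylor expansion of the diagonalized vector field at the origin. -/
theorem dbar_expansion {s : ℝ} (hs : d + 1 ≤ s) (hm : 0 < m) (hκ : 0 < κ)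
    (hgs : ContDiffOn ℝ ∞ g (Set.Ioi 0)) (hgm : g m = 0) (hg : 0 < deriv g m)
    (hν : ∀ i, 1 ≤ ν i) (hν2 : ∀ i, ν i ≤ 2) :
    ∃ p q C r : ℝ, 0 ≤ C ∧ 0 < r ∧ ∀ ε w, 0 ≤ ε → ε ≤ r → w 0 = 0 → wl2 s w ≤ ENNReal.ofReal ε →
      ∃ N : Freq d → ℂ, wl2 s N ≤ ENNReal.ofReal (C * ε ^ 3) ∧ ∀ j, j ≠ 0 →
        dbar (hamW ν m κ g) w j = omega ν m κ g j * w j +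
          (diagA ν m κ g j * coef (quadF p q (synth (undiag ν m κ g w))) j -
            diagB ν m κ g j * conj (coef (quadF p q (synth (undiag ν m κ g w))) (-j))) + N j := by
  have hsd : (d : ℝ) ≤ s := by linarith
  have hs1 : 1 ≤ s := by linarith [(Nat.cast_nonneg d : (0:ℝ) ≤ d)]
  have hs0 : 0 ≤ s := by linarith
  have hh := hbar_pos hκ
  have ht := tc_pos (d := d)
  obtain ⟨p, q, c, R, oR, oc, r₁, hr₁, hexp⟩ := exists_expansion (d := d) hs hm hgs hgm
  have oZ := bigOrd_synth (d := d) hsd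
  have oQ : BigOrd (d := d) s 2 (fun z => quadF p q (synth z)) := by
    have h1 := oZ.add oZ.star
    exact ((BigOrd.smul (ScalOrd.const p) ((oZ.mul hsd oZ.star).add (h1.mul hsd oZ))).mono
      (by norm_num)).add ((BigOrd.smul (ScalOrd.const q) (h1.mul hsd h1)).mono (by norm_num))
  -- This scalar multiplies `z` in the gradient. The linear part of `F` has zero mean because `z 0 =
  -- 0`, so the scalar is of order two and its product with `z` belongs to the cubic remainder.
  have oσ : ScalOrd (d := d) s 2 (fun z => -((zeroMode m z)⁻¹ * ((coef (quadF p q (synth z)) 0).re + c z +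
      (coef (R z) 0).re))) := by
    have h1 := (scalOrd_inv_zeroMode (d := d) hs0 hm).mul
      (((scalOrd_coef hs0 oQ 0).add oc).add ((scalOrd_coef hs0 oR 0).mono (by norm_num)))
    have h2 := (ScalOrd.const (d := d) (s := s) (-1)).mul h1
    simpa using h2
  obtain ⟨CR, rR, hCR, hrR, hR⟩ := oR
  obtain ⟨Cσ, rσ, hCσ, hrσ, hσ⟩ := oσ
  set σ : (Freq d → ℂ) → ℝ := fun z => -((zeroMode m z)⁻¹ * ((coef (quadF p q (synth z)) 0).re + c z +
      (coef (R z) 0).re))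
  set B := diagBound m κ g with hBdef
  have hB : 0 < B := by
    have := offDiag_pos hm hκ hg
    rw [hBdef]; unfold diagBound; positivity
  set ρ := min r₁ (min rR rσ)
  have hρ : 0 < ρ := lt_min hr₁ (lt_min hrR hrσ)
  set t := (1 / hbar κ) * (tc d)⁻¹ with ht'
  have ht0 : 0 < t := by positivity
  refine ⟨t * p, t * q, 2 * B * (t * CR + (1 / hbar κ) * Cσ) * (2 * B) ^ 3, ρ / (2 * B), by positivity,
    by positivity, fun ε w hε hεr hw0 hw => ?_⟩
  set z := undiag ν m κ g w with hzdef
  set δ := 2 * B * ε with hδ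
  have hδ0 : 0 ≤ δ := by positivity
  have hδρ : δ ≤ ρ := by rw [le_div_iff₀ (by positivity)] at hεr; rw [hδ]; linarith
  have hz : wl2 s z ≤ ENNReal.ofReal δ := wl2_undiag_le hm hκ hg hν s hε hw
  have hz0 : z 0 = 0 := by simp [hzdef, undiag]
  have hzt : wl2 s z ≠ ⊤ := ne_top_of_le_ne_top ENNReal.ofReal_ne_top hz
  have hzs : Summable z := summable_of_wl2 hsd hzt
  obtain ⟨hz2, -⟩ := tsum_sq_le_of_wl2 hs0 hδ0 hz
  have hzq : Summable fun k => symbSq ν k * ‖z k‖ ^ 2 := by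
    refine ((summable_sq_of_wl2 hzt).mul_left 4).of_nonneg_of_le
      (fun k => mul_nonneg (symbSq_nonneg k) (by positivity)) fun k => ?_
    have h1 := symbSq_le hν hν2 k
    have h2 : bracket k ^ (2:ℝ) ≤ bracket k ^ (2 * s) :=
      Real.rpow_le_rpow_of_exponent_le (one_le_bracket k) (by linarith)
    rw [Real.rpow_two, bracket_sq] at h2
    rw [← mul_assoc]
    gcongr
    linarith
  obtain ⟨F, hF, hFρ, hμ, hFeq⟩ := hexp z hz0
    (hz.trans (ENNReal.ofReal_le_ofReal (hδρ.trans (min_le_left _ _))))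
  have hσz := hσ δ z hδ0 (hδρ.trans ((min_le_right _ _).trans (min_le_right _ _))) hz0 hz
  have hRz := hR δ z hδ0 (hδρ.trans ((min_le_right _ _).trans (min_le_left _ _))) hz0 hz
  let N₃ : Freq d → ℂ := fun k => (t : ℂ) * coef (R z) k + ((1 / hbar κ * σ z : ℝ) : ℂ) * z k
  have hN₃ : wl2 s N₃ ≤ ENNReal.ofReal ((t * CR + (1 / hbar κ) * Cσ) * δ ^ 3) := by
    refine (wl2_add_le _ _ _).trans ?_
    have h1 := wl2_mul_le (a := s) (c := fun _ => t) (C := t) (fun _ => (abs_of_pos ht0).le) (coef (R z))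
    have h2 := wl2_mul_le (a := s) (c := fun _ => 1 / hbar κ * σ z) (C := 1 / hbar κ * (Cσ * δ ^ 2))
      (fun _ => by
        rw [abs_mul, abs_of_pos (by positivity : 0 < 1 / hbar κ)]
        gcongr) z
    refine (add_le_add (h1.trans (mul_le_mul_right hRz _)) (h2.trans (mul_le_mul_right hz _))).trans
      (le_of_eq ?_)
    rw [← ENNReal.ofReal_mul (by positivity), ← ENNReal.ofReal_mul (by positivity),
      ← ENNReal.ofReal_add (by positivity) (by positivity)]
    congr 1; ring
  have hcF : ∀ k, coef F k = ((deriv g m * m : ℝ) : ℂ) * (tc d * z k + conj (tc d * z (-k))) +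
      coef (quadF p q (synth z)) k + (c z : ℂ) * (if k = 0 then 1 else 0) + coef (R z) k := fun k => by
    rw [hFeq, coef_add, coef_add, coef_add, coef_smul, coef_add, coef_star, coef_smul, coef_one,
      coef_synth hzs, coef_synth hzs]
  have hcF0 : (zeroMode m z)⁻¹ * (coef F 0).re = -σ z := by
    rw [hcF 0]
    simp [hz0, σ]
  set b := offDiag m κ g with hb
  have hgrad : ∀ k, k ≠ 0 → gradZ ν m κ z F k = ((hbar κ / 2 * symbSq ν k + b : ℝ) : ℂ) * z k +
      (b : ℂ) * conj (z (-k)) + coef (quadF (t * p) (t * q) (synth z)) k + N₃ k := fun k hk => by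
    rw [gradZ, hcF0, hcF k, if_neg hk, ← coef_quadF_smul]
    have hb' : (b : ℂ) = deriv g m * m / hbar κ := by
      rw [hb, offDiag]; push_cast; ring
    have hh' : (hbar κ : ℂ) ≠ 0 := by exact_mod_cast hh.ne'
    have htc' : (tc d : ℂ) ≠ 0 := by exact_mod_cast ht.ne'
    simp only [N₃, ht', map_mul, Complex.conj_ofReal]
    push_cast
    rw [hb']
    field_simp
    ring
  have hdb := fun j => dbar_hamW (j := j) ν κ g hm hgs.continuousOn hzdef hzs hz2 hzq (sub_pos.2 hμ) hFρ hF
  refine ⟨fun j => ((diagA ν m κ g j : ℝ) : ℂ) * N₃ j +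
    ((-diagB ν m κ g j : ℝ) : ℂ) * conj (N₃ (-j)), ?_, fun j hj => ?_⟩
  · have h1 := wl2_mul_le (a := s) (fun j => (abs_diag_le (ν := ν) hm hκ hg hν j).1) N₃
    have h2 := wl2_mul_le (a := s) (c := fun j => -diagB ν m κ g j)
      (fun j => (abs_neg _).trans_le (abs_diag_le (ν := ν) hm hκ hg hν j).2) (fun j => conj (N₃ (-j)))
    rw [wl2_conj_neg] at h2
    refine (wl2_add_le _ _ _).trans ((add_le_add (h1.trans (mul_le_mul_right hN₃ _))
      (h2.trans (mul_le_mul_right hN₃ _))).trans (le_of_eq ?_))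
    rw [← hBdef, ← ENNReal.ofReal_mul hB.le, ← ENNReal.ofReal_add (by positivity) (by positivity)]
    congr 1; rw [hδ]; ring
  · rw [hdb j hj, hgrad j hj, hgrad (-j) (neg_ne_zero.2 hj), neg_neg, symbSq_neg]
    obtain ⟨i1, i2, -⟩ := diag_identities (κ := κ) hm hκ hg hν hj
    simp only [← hb] at i1 i2
    have e1 : z j = diagA ν m κ g j * w j - diagB ν m κ g j * conj (w (-j)) := undiag_apply ..
    have e2 : conj (z (-j)) = diagA ν m κ g j * conj (w (-j)) - diagB ν m κ g j * w j := by
      rw [hzdef, undiag_apply, diagA_neg, diagB_neg, neg_neg]; simp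
    have i1' := congrArg (fun x : ℝ => (x : ℂ)) i1
    have i2' := congrArg (fun x : ℝ => (x : ℂ)) i2
    push_cast at i1' i2'
    simp only [map_add, map_mul, Complex.conj_ofReal, Complex.conj_conj, e1, e2]
    push_cast
    linear_combination w j * i1' + conj (w (-j)) * i2'

end Vector

end QHD
end

/-! ### The dispersion relation and the three-wave resonance function -/

noncomputable section

namespace QHD

open scoped ENNReal ComplexConjugate Topology Pointwise

section Disp

/-- The dispersion relation as a function of `|j|_ν²`. -/
def disp (c b q : ℝ) : ℝ := Real.sqrt (c ^ 2 * q ^ 2 + 2 * b * c * q)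

variable {c b : ℝ}

lemma disp_sq (hc : 0 < c) (hb : 0 < b) {q : ℝ} (hq : 0 ≤ q) :
    disp c b q ^ 2 = c ^ 2 * q ^ 2 + 2 * b * c * q := Real.sq_sqrt (by positivity)

lemma disp_nonneg (q : ℝ) : 0 ≤ disp c b q := Real.sqrt_nonneg _

lemma mul_le_disp (hc : 0 < c) (hb : 0 < b) {q : ℝ} (hq : 0 ≤ q) : c * q ≤ disp c b q := by
  refine abs_le_of_sq_le_sq' ?_ (disp_nonneg q) |>.2
  rw [disp_sq hc hb hq]
  have : 0 ≤ 2 * b * c * q := by positivity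
  nlinarith

lemma disp_le (hc : 0 < c) (hb : 0 < b) {q : ℝ} (hq : 0 ≤ q) : disp c b q ≤ c * q + b := by
  refine abs_le_of_sq_le_sq' ?_ (by positivity) |>.2
  rw [disp_sq hc hb hq]
  nlinarith [sq_nonneg b]

/-- Rationalize: `(A' - A)(A + A') = c (q' - q)(c (q + q') + 2b)`, with each value of `disp` between
`c q` and `c q + b`. The slope is therefore `c` up to a nonnegative error of size `b / (q + q')`. -/
lemma disp_increment (hc : 0 < c) (hb : 0 < b) {q q' : ℝ} (hq : 0 ≤ q) (h : q ≤ q') :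
    c * (q' - q) ≤ disp c b q' - disp c b q ∧
      (disp c b q' - disp c b q - c * (q' - q)) * (q + q') ≤ 2 * b * (q' - q) := by
  have hq' := hq.trans h
  rcases hq'.eq_or_lt with h0 | h0
  · have : q = 0 := by linarith
    subst this; subst h0; simp
  have a1 := mul_le_disp hc hb hq
  have a2 := mul_le_disp hc hb hq'
  have b1 := disp_le hc hb hq
  have b2 := disp_le hc hb hq'
  have s1 := disp_sq hc hb hq
  have s2 := disp_sq hc hb hq'
  set A := disp c b q
  set A' := disp c b q'
  have hA : 0 < A + A' := by nlinarith [mul_pos hc h0, mul_nonneg hc.le hq]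
  have e : (A' - A) * (A + A') = c * (q' - q) * (c * (q + q') + 2 * b) := by
    linear_combination s2 - s1
  have hd : 0 ≤ c * (q' - q) := mul_nonneg hc.le (by linarith)
  have h1 : c * (q' - q) ≤ A' - A := by
    refine le_of_mul_le_mul_right ?_ hA
    rw [e]
    exact mul_le_mul_of_nonneg_left (by linarith) hd
  refine ⟨h1, ?_⟩
  have h2 : 0 ≤ A' - A - c * (q' - q) := by linarith
  have h3 : (A' - A - c * (q' - q)) * (A + A') ≤ c * (q' - q) * (2 * b) := by
    have : (A' - A - c * (q' - q)) * (A + A') =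
      c * (q' - q) * (c * (q + q') + 2 * b - (A + A')) := by linear_combination e
    rw [this]
    exact mul_le_mul_of_nonneg_left (by linarith) hd
  have h4 : (A' - A - c * (q' - q)) * (c * (q + q')) ≤ c * (q' - q) * (2 * b) :=
    (mul_le_mul_of_nonneg_left (by linarith) h2).trans h3
  refine le_of_mul_le_mul_left ?_ hc
  linarith

/-- Quantitative strict subadditivity behind the monotonicity in the scaling parameter. -/
lemma disp_param_increment (hc : 0 < c) (hb : 0 < b) :
    ∃ h₀ : ℝ, 0 < h₀ ∧ ∀ τ τ' l₁ l₂ l₃ : ℝ, 0 < τ' → τ' ≤ τ → τ ≤ b → 1 / 2 ≤ l₁ → 1 / 2 ≤ l₂ →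
      0 ≤ l₃ → l₃ ≤ l₁ + l₂ →
      h₀ * (τ - τ') ≤ (disp c τ (l₁ ^ 2) + disp c τ (l₂ ^ 2) - disp c τ (l₃ ^ 2)) -
        (disp c τ' (l₁ ^ 2) + disp c τ' (l₂ ^ 2) - disp c τ' (l₃ ^ 2)) := by
  set K := Real.sqrt (4 * c ^ 2 + 8 * b * c) with hK
  have hK0 : 0 < K := Real.sqrt_pos.2 (by positivity)
  have hK2 : K ^ 2 = 4 * c ^ 2 + 8 * b * c := Real.sq_sqrt (by positivity)
  refine ⟨3 / 2 * c ^ 3 / K ^ 3, by positivity, ?_⟩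
  suffices H : ∀ τ τ' l₁ l₂ l₃ : ℝ, 0 < τ' → τ' ≤ τ → τ ≤ b → 1 / 2 ≤ l₁ → l₁ ≤ l₂ →
      0 ≤ l₃ → l₃ ≤ l₁ + l₂ →
      3 / 2 * c ^ 3 / K ^ 3 * (τ - τ') ≤ (disp c τ (l₁ ^ 2) + disp c τ (l₂ ^ 2) - disp c τ (l₃ ^ 2)) -
        (disp c τ' (l₁ ^ 2) + disp c τ' (l₂ ^ 2) - disp c τ' (l₃ ^ 2)) by
    intro τ τ' l₁ l₂ l₃ h1 h2 h3 h4 h5 h6 h7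
    rcases le_total l₁ l₂ with h | h
    · exact H τ τ' l₁ l₂ l₃ h1 h2 h3 h4 h h6 h7
    · have := H τ τ' l₂ l₁ l₃ h1 h2 h3 h5 h h6 (by linarith)
      linarith
  intro τ τ' l₁ l₂ l₃ hτ' hττ hτb hl1 hl12 hl3 hl
  -- Writing `disp c t (l²) = l A(t, l)` and rationalizing, the difference between `τ` and `τ'` is
  -- `2c (τ - τ') l / S(l)`; the claim becomes a quantitative subadditivity of `l / S(l)`.
  let A : ℝ → ℝ → ℝ := fun t l => Real.sqrt (c ^ 2 * l ^ 2 + 2 * t * c)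
  have hA2 : ∀ t l, 0 < t → A t l ^ 2 = c ^ 2 * l ^ 2 + 2 * t * c := fun t l ht =>
    Real.sq_sqrt (by positivity)
  have hA0 : ∀ t l, 0 < t → 0 < A t l := fun t l ht => Real.sqrt_pos.2 (by positivity)
  have hdA : ∀ t l, 0 ≤ l → disp c t (l ^ 2) = l * A t l := fun t l hl => by
    rw [disp, show c ^ 2 * (l ^ 2) ^ 2 + 2 * t * c * l ^ 2 = l ^ 2 * (c ^ 2 * l ^ 2 + 2 * t * c) by ring,
      Real.sqrt_mul (by positivity), Real.sqrt_sq hl]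
  have hτ : 0 < τ := hτ'.trans_le hττ
  let S : ℝ → ℝ := fun l => A τ l + A τ' l
  have hS0 : ∀ l, 0 < S l := fun l => add_pos (hA0 _ _ hτ) (hA0 _ _ hτ')
  have hdiff : ∀ l, 0 ≤ l → disp c τ (l ^ 2) - disp c τ' (l ^ 2) = 2 * c * (τ - τ') * (l / S l) := by
    intro l hl
    rw [hdA _ _ hl, hdA _ _ hl]
    have := hS0 l
    have e : (A τ l - A τ' l) * S l = 2 * c * (τ - τ') := by
      simp only [S]; linear_combination hA2 τ l hτ - hA2 τ' l hτ'
    rw [← mul_sub, eq_comm, ← e]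
    field_simp
  have hAmono : ∀ t l l', 0 < t → 0 ≤ l → l ≤ l' → A t l ≤ A t l' := fun t l l' ht h0 h =>
    Real.sqrt_le_sqrt (by gcongr)
  have hAratio : ∀ t l l', 0 < t → 0 ≤ l → l ≤ l' → l * A t l' ≤ l' * A t l := by
    intro t l l' ht h0 h
    refine abs_le_of_sq_le_sq' ?_ (mul_nonneg (h0.trans h) (hA0 _ _ ht).le) |>.2
    rw [mul_pow, mul_pow, hA2 _ _ ht, hA2 _ _ ht]
    have h1 : l ^ 2 ≤ l' ^ 2 := by gcongr
    have h2 : 0 < 2 * t * c := by positivity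
    nlinarith
  have hl1' : 0 ≤ l₁ := by linarith
  have hl2' : 0 ≤ l₂ := by linarith
  have hmono : l₃ / S l₃ ≤ (l₁ + l₂) / S (l₁ + l₂) := by
    rw [div_le_div_iff₀ (hS0 _) (hS0 _)]
    have := hAratio τ l₃ (l₁ + l₂) hτ hl3 hl
    have := hAratio τ' l₃ (l₁ + l₂) hτ' hl3 hl
    simp only [S]; linarith
  have hAK : ∀ t, 0 < t → t ≤ b → A t (2 * l₁) ≤ K * l₁ := by
    intro t ht htb
    refine abs_le_of_sq_le_sq' ?_ (by positivity) |>.2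
    rw [hA2 _ _ ht, mul_pow K, hK2]
    have h1 : 1 / 4 ≤ l₁ ^ 2 := by nlinarith
    have h2 : 2 * t * c ≤ 2 * b * c := by gcongr
    have h3 : 0 < 8 * b * c := by positivity
    nlinarith
  have hgap : ∀ t, 0 < t → t ≤ b → 3 * c ^ 2 * l₁ / (2 * K) ≤ A t (2 * l₁) - A t l₁ := by
    intro t ht htb
    have h1 := hAK t ht htb
    have h2 := hAmono t l₁ (2 * l₁) ht hl1' (by linarith)
    have h3 : (A t (2 * l₁) - A t l₁) * (A t (2 * l₁) + A t l₁) = 3 * c ^ 2 * l₁ ^ 2 := by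
      linear_combination hA2 t (2 * l₁) ht - hA2 t l₁ ht
    have h4 : (A t (2 * l₁) - A t l₁) * (A t (2 * l₁) + A t l₁) ≤
        (A t (2 * l₁) - A t l₁) * (2 * K * l₁) :=
      mul_le_mul_of_nonneg_left (by linarith) (by linarith)
    rw [div_le_iff₀ (by positivity)]
    have h5 : 3 * c ^ 2 * l₁ ^ 2 ≤ (A t (2 * l₁) - A t l₁) * (2 * K * l₁) := h3 ▸ h4
    refine le_of_mul_le_mul_right ?_ (by linarith : 0 < l₁)
    linarith
  have hSmono : S (2 * l₁) ≤ S (l₁ + l₂) :=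
    add_le_add (hAmono _ _ _ hτ (by linarith) (by linarith)) (hAmono _ _ _ hτ' (by linarith) (by linarith))
  have hSK : S (2 * l₁) ≤ 2 * K * l₁ := by
    have := hAK τ hτ hτb
    have := hAK τ' hτ' (hττ.trans hτb)
    simp only [S]; linarith
  have hSgap : 3 * c ^ 2 * l₁ / K ≤ S (2 * l₁) - S l₁ := by
    have h1 := hgap τ hτ hτb
    have h2 := hgap τ' hτ' (hττ.trans hτb)
    have : 3 * c ^ 2 * l₁ / K = 3 * c ^ 2 * l₁ / (2 * K) + 3 * c ^ 2 * l₁ / (2 * K) := by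
      field_simp; ring
    simp only [S]; linarith
  -- As `l / S(l)` increases, `l₃` may be replaced by `l₁ + l₂`. As `S` increases and `l₁ ≤ l₂`,
  -- there remains at least `l₁ / S(l₁) - l₁ / S(2l₁)`, bounded below because `l₁ ≥ 1/2`.
  have key : 3 / 4 * c ^ 2 / K ^ 3 ≤ l₁ / S l₁ + l₂ / S l₂ - l₃ / S l₃ := by
    have h1 : l₂ / S (l₁ + l₂) ≤ l₂ / S l₂ :=
      div_le_div_of_nonneg_left hl2' (hS0 _)
        (add_le_add (hAmono _ _ _ hτ hl2' (by linarith)) (hAmono _ _ _ hτ' hl2' (by linarith)))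
    have h2 : l₁ / S (l₁ + l₂) ≤ l₁ / S (2 * l₁) := div_le_div_of_nonneg_left hl1' (hS0 _) hSmono
    have h3 : (l₁ + l₂) / S (l₁ + l₂) = l₁ / S (l₁ + l₂) + l₂ / S (l₁ + l₂) := add_div _ _ _
    have h4 : 3 / 4 * c ^ 2 / K ^ 3 ≤ l₁ / S l₁ - l₁ / S (2 * l₁) := by
      have e1 : l₁ / S l₁ - l₁ / S (2 * l₁) = l₁ * (S (2 * l₁) - S l₁) / (S l₁ * S (2 * l₁)) := by
        rw [div_sub_div _ _ (hS0 _).ne' (hS0 _).ne']; ring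
      rw [e1, le_div_iff₀ (mul_pos (hS0 _) (hS0 _))]
      have h5 : S l₁ * S (2 * l₁) ≤ (2 * K * l₁) * (2 * K * l₁) := by
        have h6 : S l₁ ≤ 2 * K * l₁ := by
          have : 0 ≤ 3 * c ^ 2 * l₁ / K := by positivity
          linarith
        exact mul_le_mul h6 hSK (hS0 _).le (by positivity)
      calc 3 / 4 * c ^ 2 / K ^ 3 * (S l₁ * S (2 * l₁))
          ≤ 3 / 4 * c ^ 2 / K ^ 3 * ((2 * K * l₁) * (2 * K * l₁)) := by gcongr
        _ = l₁ * (3 * c ^ 2 * l₁ / K) := by field_simp; ring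
        _ ≤ _ := by gcongr
    linarith
  have e : (disp c τ (l₁ ^ 2) + disp c τ (l₂ ^ 2) - disp c τ (l₃ ^ 2)) -
        (disp c τ' (l₁ ^ 2) + disp c τ' (l₂ ^ 2) - disp c τ' (l₃ ^ 2)) =
      2 * c * (τ - τ') * (l₁ / S l₁ + l₂ / S l₂ - l₃ / S l₃) := by
    linear_combination hdiff l₁ hl1' + hdiff l₂ hl2' - hdiff l₃ hl3
  rw [e]
  calc 3 / 2 * c ^ 3 / K ^ 3 * (τ - τ') = 2 * c * (τ - τ') * (3 / 4 * c ^ 2 / K ^ 3) := by ring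
    _ ≤ _ := mul_le_mul_of_nonneg_left key (mul_nonneg (by positivity) (by linarith))

end Disp

section Resonance
variable {d : ℕ} {c b : ℝ}

/-- The three-wave resonance function. -/
def reson (c b : ℝ) (ν : Fin d → ℝ) (j k : Freq d) : ℝ :=
  disp c b (symbSq ν k) + disp c b (symbSq ν j) - disp c b (symbSq ν (j + k))

lemma le_symbSq {ν : Fin d → ℝ} {i : Fin d} (hν : 1 ≤ ν i) (j : Freq d) :
    (j i : ℝ) ^ 2 ≤ symbSq ν j := by
  refine le_trans ?_ (Finset.single_le_sum (f := fun i => ν i ^ 2 * (j i : ℝ) ^ 2)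
    (fun i _ => by positivity) (Finset.mem_univ i))
  have : 1 ≤ ν i ^ 2 := one_le_pow₀ hν
  exact le_mul_of_one_le_left (sq_nonneg _) this

lemma symbSq_add_single (ν : Fin d → ℝ) (i : Fin d) (t : ℝ) (j : Freq d) :
    symbSq (ν + Pi.single i t) j = symbSq ν j + ((ν i + t) ^ 2 - ν i ^ 2) * (j i : ℝ) ^ 2 := by
  classical
  have h : ∀ l, (ν + Pi.single i t : Fin d → ℝ) l ^ 2 * (j l : ℝ) ^ 2 = ν l ^ 2 * (j l : ℝ) ^ 2 +
      if l = i then ((ν i + t) ^ 2 - ν i ^ 2) * (j i : ℝ) ^ 2 else 0 := fun l => by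
    by_cases hl : l = i
    · subst hl; simp; ring
    · simp [hl]
  simp only [symbSq, h, Finset.sum_add_distrib, Finset.sum_ite_eq', Finset.mem_univ, if_true]

/-- A shift of `ν_i` changes `|l|_ν²` by `Δ l_i²`. The leading parts combine to `cΔ (k_i² + j_i² -
(j_i + k_i)²) = -2cΔ j_i k_i`, and by `disp_increment` each of the three errors lies in `[0, bΔ]`,
since `|l|_ν² ≥ l_i²`. -/
lemma reson_expansive_coord (hc : 0 < c) (hb : 0 < b) {ν : Fin d → ℝ} {i : Fin d} (hν : 1 ≤ ν i)
    {t : ℝ} (ht : 0 ≤ t) (j k : Freq d) :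
    (2 * c * |(j i : ℝ) * k i| - 2 * b) * ((ν i + t) ^ 2 - ν i ^ 2) ≤
      |reson c b (ν + Pi.single i t) j k - reson c b ν j k| := by
  set Δ := (ν i + t) ^ 2 - ν i ^ 2 with hΔ
  have hΔ0 : 0 ≤ Δ := by nlinarith
  have key : ∀ l : Freq d, ∃ e, 0 ≤ e ∧ e ≤ b * Δ ∧
      disp c b (symbSq (ν + Pi.single i t) l) = disp c b (symbSq ν l) + c * Δ * (l i : ℝ) ^ 2 + e := by
    intro l
    have hle := le_symbSq hν l
    obtain ⟨h1, h2⟩ := disp_increment hc hb (symbSq_nonneg (ν := ν) l)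
      (show symbSq ν l ≤ symbSq ν l + Δ * (l i : ℝ) ^ 2 by nlinarith [sq_nonneg (l i : ℝ), mul_nonneg hΔ0 (sq_nonneg (l i : ℝ))])
    rw [symbSq_add_single, ← hΔ]
    set q := symbSq ν l
    refine ⟨disp c b (q + Δ * (l i : ℝ) ^ 2) - disp c b q - c * Δ * (l i : ℝ) ^ 2, by linarith, ?_, by ring⟩
    by_cases hl : (l i : ℝ) = 0
    · simp [hl]; positivity
    have hl2 : 0 < (l i : ℝ) ^ 2 := by positivity
    refine le_of_mul_le_mul_right ?_ (by positivity : 0 < 2 * (l i : ℝ) ^ 2)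
    have h3 : 0 ≤ disp c b (q + Δ * (l i : ℝ) ^ 2) - disp c b q - c * Δ * (l i : ℝ) ^ 2 := by linarith
    have h4 : 2 * (l i : ℝ) ^ 2 ≤ q + (q + Δ * (l i : ℝ) ^ 2) := by
      nlinarith [mul_nonneg hΔ0 hl2.le]
    refine (mul_le_mul_of_nonneg_left h4 h3).trans ?_
    have e : c * (q + Δ * (l i : ℝ) ^ 2 - q) = c * Δ * (l i : ℝ) ^ 2 := by ring
    rw [e] at h2
    linarith
  obtain ⟨e1, p1, q1, r1⟩ := key k
  obtain ⟨e2, p2, q2, r2⟩ := key j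
  obtain ⟨e3, p3, q3, r3⟩ := key (j + k)
  have e : reson c b (ν + Pi.single i t) j k - reson c b ν j k =
      -(2 * c * Δ * ((j i : ℝ) * k i)) + (e1 + e2 - e3) := by
    simp only [reson, r1, r2, r3, Pi.add_apply]; push_cast; ring
  rw [e]
  have h5 : |2 * c * Δ * ((j i : ℝ) * k i)| = 2 * c * Δ * |(j i : ℝ) * k i| := by
    rw [abs_mul, abs_of_nonneg (by positivity : 0 ≤ 2 * c * Δ)]
  have h6 : |e1 + e2 - e3| ≤ 2 * b * Δ := abs_le.2 ⟨by nlinarith [mul_nonneg hb.le hΔ0], by linarith⟩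
  have h7 : |2 * c * Δ * ((j i : ℝ) * k i)| - |e1 + e2 - e3| ≤
      |-(2 * c * Δ * ((j i : ℝ) * k i)) + (e1 + e2 - e3)| := by
    have := abs_sub_abs_le_abs_sub (2 * c * Δ * ((j i : ℝ) * k i)) (e1 + e2 - e3)
    rw [← abs_neg (-(2 * c * Δ * ((j i : ℝ) * k i)) + (e1 + e2 - e3)), show -(-(2 * c * Δ * ((j i : ℝ) * k i)) + (e1 + e2 - e3)) =
      2 * c * Δ * ((j i : ℝ) * k i) - (e1 + e2 - e3) by ring]
    exact this
  linarith

/-- If the interaction takes place in one direction only, there is no resonance. -/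
lemma le_abs_reson (hc : 0 < c) (hb : 0 < b) {ν : Fin d → ℝ} {i : Fin d} (hν : 1 ≤ ν i)
    {j k : Freq d} (hk : ∀ l, l ≠ i → k l = 0) :
    2 * c * |(j i : ℝ) * k i| - 2 * b ≤ |reson c b ν j k| := by
  classical
  have hq : symbSq ν (j + k) = symbSq ν j + symbSq ν k + 2 * (ν i ^ 2 * ((j i : ℝ) * k i)) := by
    have h : ∀ l, ν l ^ 2 * ((j + k) l : ℝ) ^ 2 = ν l ^ 2 * (j l : ℝ) ^ 2 + ν l ^ 2 * (k l : ℝ) ^ 2 +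
        if l = i then 2 * (ν i ^ 2 * ((j i : ℝ) * k i)) else 0 := fun l => by
      by_cases hl : l = i
      · subst hl; simp; ring
      · simp [hl, hk l hl]
    simp only [symbSq, h, Finset.sum_add_distrib, Finset.sum_ite_eq', Finset.mem_univ, if_true]
  have n1 := symbSq_nonneg (ν := ν) j
  have n2 := symbSq_nonneg (ν := ν) k
  have n3 := symbSq_nonneg (ν := ν) (j + k)
  have a1 := mul_le_disp hc hb n1
  have a2 := mul_le_disp hc hb n2
  have a3 := mul_le_disp hc hb n3
  have b1 := disp_le hc hb n1
  have b2 := disp_le hc hb n2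
  have b3 := disp_le hc hb n3
  have h1 : 1 ≤ ν i ^ 2 := one_le_pow₀ hν
  have h2 : |(j i : ℝ) * k i| ≤ |ν i ^ 2 * ((j i : ℝ) * k i)| := by
    rw [abs_mul (ν i ^ 2), abs_of_nonneg (by positivity : 0 ≤ ν i ^ 2)]
    exact le_mul_of_one_le_left (abs_nonneg _) h1
  set x := ν i ^ 2 * ((j i : ℝ) * k i)
  have e3 : c * symbSq ν (j + k) = c * symbSq ν j + c * symbSq ν k + 2 * c * x := by rw [hq]; ring
  refine (show _ ≤ 2 * c * |x| - 2 * b by nlinarith).trans ?_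
  unfold reson
  rcases abs_cases x with ⟨h, -⟩ | ⟨h, -⟩ <;> rw [h]
  · refine le_trans ?_ (neg_le_abs _); linarith
  · refine le_trans ?_ (le_abs_self _); linarith

lemma sqrt_symbSq_add_le (ν : Fin d → ℝ) (j k : Freq d) :
    Real.sqrt (symbSq ν (j + k)) ≤ Real.sqrt (symbSq ν j) + Real.sqrt (symbSq ν k) := by
  have h : ∀ l : Freq d, Real.sqrt (symbSq ν l) =
      ‖(WithLp.toLp 2 (fun i => ν i * (l i : ℝ)) : EuclideanSpace ℝ (Fin d))‖ := fun l => by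
    rw [EuclideanSpace.norm_eq]
    congr 1
    exact Finset.sum_congr rfl fun i _ => by simp [mul_pow]
  rw [h, h, h]
  refine le_trans (le_of_eq ?_) (norm_add_le _ _)
  congr 1
  ext i; simp [mul_add]

lemma symbSq_smul (r : ℝ) (ν : Fin d → ℝ) (j : Freq d) : symbSq (r • ν) j = r ^ 2 * symbSq ν j := by
  simp only [symbSq, Finset.mul_sum, Pi.smul_apply, smul_eq_mul, mul_pow, mul_assoc]

lemma disp_scale {r : ℝ} (hr : r ≠ 0) (q : ℝ) : disp c b (r ^ 2 * q) = r ^ 2 * disp c (b / r ^ 2) q := by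
  rw [disp, disp, ← Real.sqrt_sq (by positivity : 0 ≤ r ^ 2), ← Real.sqrt_mul (by positivity)]
  congr 1
  rw [Real.sqrt_sq (by positivity : 0 ≤ r ^ 2)]
  field_simp

/-- Dilating `ν` by `r` amounts, up to the factor `r²`, to replacing `b` by `b / r²`, in which the
resonance function is strictly increasing by `disp_param_increment`. This direction works for all
nonzero `j, k`, whatever the size of `j_i k_i`. -/
lemma reson_expansive_scale (hc : 0 < c) (hb : 0 < b) :
    ∃ h₀ : ℝ, 0 < h₀ ∧ ∀ (ν : Fin d → ℝ) (j k : Freq d) (r r' η : ℝ), (∀ i, 1 / 2 ≤ ν i) → j ≠ 0 → k ≠ 0 →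
      1 ≤ r → r ≤ r' → r' ≤ 2 → |reson c b (r • ν) j k| ≤ η → |reson c b (r' • ν) j k| ≤ η →
      h₀ * (r' - r) ≤ η := by
  obtain ⟨h₀, hh, H⟩ := disp_param_increment hc hb
  refine ⟨h₀ * b / 16, by positivity, fun ν j k r r' η hν hj hk hr hrr hr' h1 h2 => ?_⟩
  have hr0 : 0 < r := by linarith
  have hr0' : 0 < r' := by linarith
  have hη : 0 ≤ η := (abs_nonneg _).trans h1
  have hpos : ∀ l : Freq d, l ≠ 0 → 1 / 2 ≤ Real.sqrt (symbSq ν l) := fun l hl => by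
    refine Real.le_sqrt_of_sq_le ?_
    have h1 := one_le_symbSq (ν := (2:ℝ) • ν) (fun i => by
      have := hν i; simp only [Pi.smul_apply, smul_eq_mul]; linarith) hl
    rw [symbSq_smul] at h1
    linarith
  have hsc : ∀ ρ : ℝ, 0 < ρ → reson c b (ρ • ν) j k = ρ ^ 2 * reson c (b / ρ ^ 2) ν j k := fun ρ hρ => by
    simp only [reson, symbSq_smul, disp_scale hρ.ne']; ring
  have hbd : ∀ ρ : ℝ, 1 ≤ ρ → |reson c b (ρ • ν) j k| ≤ η → |reson c (b / ρ ^ 2) ν j k| ≤ η :=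
    fun ρ hρ h => by
      rw [hsc ρ (by linarith), abs_mul, abs_of_nonneg (by positivity : 0 ≤ ρ ^ 2)] at h
      exact le_trans (le_mul_of_one_le_left (abs_nonneg _) (one_le_pow₀ hρ)) h
  have g1 := abs_le.1 (hbd r hr h1)
  have g2 := abs_le.1 (hbd r' (hr.trans hrr) h2)
  have key := H (b / r ^ 2) (b / r' ^ 2) _ _ _ (by positivity) (by gcongr)
    (div_le_self hb.le (one_le_pow₀ hr)) (hpos k hk) (hpos j hj) (Real.sqrt_nonneg _)
    ((sqrt_symbSq_add_le ν j k).trans_eq (add_comm _ _))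
  simp only [Real.sq_sqrt (symbSq_nonneg _)] at key
  have k2 : h₀ * (b / r ^ 2 - b / r' ^ 2) ≤ 2 * η := by
    refine key.trans ?_
    have g1' := g1.2
    have g2' := g2.1
    simp only [reson] at g1' g2'
    linarith
  have k3 : b * (r' - r) / 8 ≤ b / r ^ 2 - b / r' ^ 2 := by
    have e : b / r ^ 2 - b / r' ^ 2 = b * ((r' - r) * (r' + r)) / (r ^ 2 * r' ^ 2) := by
      field_simp; ring
    rw [e, div_le_div_iff₀ (by norm_num) (by positivity), mul_assoc, mul_assoc]
    refine mul_le_mul_of_nonneg_left ?_ hb.le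
    rw [mul_assoc]
    refine mul_le_mul_of_nonneg_left ?_ (by linarith)
    have h3 : r ^ 2 ≤ 4 := by nlinarith
    have h4 : r' ^ 2 ≤ 4 := by nlinarith
    have h5 : r * r' ≤ 4 := by nlinarith
    have h7 : r ^ 2 * r' ^ 2 ≤ r * 16 := by
      have : r * r' ^ 2 ≤ 16 := by nlinarith
      nlinarith
    nlinarith
  have k4 := mul_le_mul_of_nonneg_left k3 hh.le
  linarith

end Resonance

end QHD
end

/-! ### Measure of the parameters close to a resonance -/

noncomputable section

namespace QHD

open scoped ENNReal ComplexConjugate Topology Pointwise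

section Measure

/-- Average over `t` and exchange the integrals: if every orbit `t ↦ T (t, x)` stays in `S` for a
time at most `δ`, then `S` is small, provided `T (t, ·)` does not shrink its preimage by more than
the factor `C`. -/
lemma measure_le_of_fibers {X : Type*} [MeasurableSpace X] (μ : Measure X) [SFinite μ] {S B : Set X}
    (hS : MeasurableSet S) {T : ℝ × X → X} (hT : Measurable T) {C δ : ℝ≥0∞}
    (hvol : ∀ t ∈ Set.Icc (0:ℝ) 1, μ S ≤ C * μ {x | T (t, x) ∈ S})
    (hB : ∀ t ∈ Set.Icc (0:ℝ) 1, ∀ x, T (t, x) ∈ S → x ∈ B)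
    (hf : ∀ x, volume {t | t ∈ Set.Icc (0:ℝ) 1 ∧ T (t, x) ∈ S} ≤ δ) : μ S ≤ C * (δ * μ B) := by
  have hP : MeasurableSet {p : ℝ × X | T p ∈ S} := hT hS
  set ρ := (volume.restrict (Set.Icc (0:ℝ) 1)).prod (μ.restrict B) {p | T p ∈ S} with hρ
  have h1 : μ S ≤ C * ρ := by
    rw [hρ, Measure.prod_apply hP, ← lintegral_const_mul _ (measurable_measure_prodMk_left hP)]
    calc μ S = ∫⁻ _ in Set.Icc (0:ℝ) 1, μ S := by simp
      _ ≤ _ := setLIntegral_mono' measurableSet_Icc fun t ht => ?_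
    refine (hvol t ht).trans (mul_le_mul_right ?_ C)
    rw [Measure.restrict_apply (measurable_prodMk_left hP)]
    exact measure_mono fun x hx => ⟨hx, hB t ht x hx⟩
  have h2 : ρ ≤ δ * μ B := by
    rw [hρ, Measure.prod_apply_symm hP]
    calc _ ≤ ∫⁻ _ in B, δ ∂μ := lintegral_mono fun x => by
            rw [Measure.restrict_apply (measurable_prodMk_right hP)]
            refine (measure_mono ?_).trans (hf x)
            exact fun t ht => ⟨ht.2, ht.1⟩
      _ = _ := by simp
  exact h1.trans (mul_le_mul_right h2 C)

lemma volume_le_of_dist {A : Set ℝ} {δ : ℝ} (h : ∀ t ∈ A, ∀ t' ∈ A, t ≤ t' → t' - t ≤ δ) :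
    volume A ≤ ENNReal.ofReal δ := by
  refine (Real.volume_le_diam A).trans (Metric.ediam_le fun x hx y hy => ?_)
  rw [edist_dist]
  refine ENNReal.ofReal_le_ofReal ?_
  rw [Real.dist_eq]
  rcases le_total x y with hxy | hxy
  · rw [abs_sub_comm, abs_of_nonneg (by linarith)]; exact h x hx y hy hxy
  · rw [abs_of_nonneg (by linarith)]; exact h y hy x hx hxy

variable {d : ℕ} {c b : ℝ}

lemma continuous_reson (j k : Freq d) : Continuous fun ν : Fin d → ℝ => reson c b ν j k := by
  unfold reson disp symbSq
  fun_prop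

/-- Parameters in the unit cube at which the resonance function is small. -/
def nearRes (c b : ℝ) (j k : Freq d) (η : ℝ) : Set (Fin d → ℝ) :=
  {ν | (∀ i, 1 ≤ ν i ∧ ν i ≤ 2) ∧ |reson c b ν j k| < η}

lemma measurableSet_nearRes (j k : Freq d) (η : ℝ) : MeasurableSet (nearRes c b j k η) := by
  have h2 : MeasurableSet {ν : Fin d → ℝ | |reson c b ν j k| < η} :=
    (isOpen_lt (continuous_reson j k).abs continuous_const).measurableSet
  have h1 : MeasurableSet (Set.Icc (fun _ : Fin d => (1:ℝ)) (fun _ => 2)) := measurableSet_Icc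
  have : nearRes c b j k η = Set.Icc (fun _ : Fin d => (1:ℝ)) (fun _ => 2) ∩
      {ν : Fin d → ℝ | |reson c b ν j k| < η} := by
    ext ν
    simp only [nearRes, Set.mem_ofPred_eq, Set.mem_inter_iff, Set.mem_Icc, Pi.le_def, forall_and]
  rw [this]; exact h1.inter h2

lemma volume_cube : volume (Set.Icc (fun _ : Fin d => (0:ℝ)) (fun _ => 2)) = 2 ^ d := by
  rw [Real.volume_Icc_pi]; simp

/-- The flow is the translation of `ν_i`. The hypothesis `2b ≤ c |j_i k_i|` leaves at least `c |j_i
k_i|` in the coefficient of `reson_expansive_coord`, and `ν_i ≥ 1` gives `Δ ≥ 2 (t' - t)`. -/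
lemma volume_nearRes_coord (hc : 0 < c) (hb : 0 < b) (j k : Freq d) (i : Fin d) {η : ℝ}
    (hjk : 2 * b ≤ c * |(j i : ℝ) * k i|) (h0 : 0 < |(j i : ℝ) * k i|) :
    volume (nearRes c b j k η) ≤ ENNReal.ofReal (η / (c * |(j i : ℝ) * k i|)) * 2 ^ d := by
  have := measure_le_of_fibers volume (S := nearRes c b j k η)
    (B := Set.Icc (fun _ : Fin d => (0:ℝ)) (fun _ => 2)) (measurableSet_nearRes j k η)
    (T := fun p => p.2 + Pi.single i p.1) (C := 1) (δ := ENNReal.ofReal (η / (c * |(j i : ℝ) * k i|)))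
    ?_ ?_ ?_ ?_
  · rwa [one_mul, volume_cube] at this
  · refine measurable_snd.add (measurable_pi_iff.2 fun l => ?_)
    by_cases hl : l = i
    · subst hl; simpa using measurable_fst
    · simp [hl]
  · intro t _
    rw [one_mul]
    exact (measure_preimage_add_right volume (Pi.single i t) (nearRes c b j k η)).ge
  · rintro t ⟨ht0, ht1⟩ ν ⟨hν, -⟩
    refine ⟨fun l => ?_, fun l => ?_⟩ <;> have := hν l <;> by_cases hl : l = i
    · subst hl; simp at this ⊢; linarith
    · simp [hl] at this ⊢; linarith
    · subst hl; simp at this ⊢; linarith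
    · simp [hl] at this ⊢; linarith
  · intro ν
    refine volume_le_of_dist ?_
    rintro t ⟨-, hν, hr⟩ t' ⟨-, hν', hr'⟩ htt
    simp only at hν hr hν' hr'
    have hi : 1 ≤ (ν + Pi.single i t : Fin d → ℝ) i := (hν i).1
    have key := reson_expansive_coord hc hb hi (sub_nonneg.2 htt) j k
    have e : (ν + Pi.single i t + Pi.single i (t' - t) : Fin d → ℝ) = ν + Pi.single i t' := by
      rw [add_assoc, ← Pi.single_add]; congr 2; ring
    rw [e] at key
    have h1 := abs_sub (reson c b (ν + Pi.single i t') j k) (reson c b (ν + Pi.single i t) j k)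
    set x := (ν + Pi.single i t : Fin d → ℝ) i
    rw [le_div_iff₀ (by positivity)]
    have h2 : 2 * (t' - t) ≤ (x + (t' - t)) ^ 2 - x ^ 2 := by nlinarith
    have h3 : c * |(j i : ℝ) * k i| * (2 * (t' - t)) ≤
        (2 * c * |(j i : ℝ) * k i| - 2 * b) * ((x + (t' - t)) ^ 2 - x ^ 2) :=
      mul_le_mul (by linarith) h2 (by linarith) (by nlinarith [mul_pos hc h0])
    linarith

/-- The flow is the dilation by `1 + t`; the first factor `2 ^ d` compensates its Jacobian, the
second is the volume of `[0, 2]^d`. Before dilation the parameters are at least `1/2`, as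
`reson_expansive_scale` requires. -/
lemma volume_nearRes_scale (d : ℕ) (hc : 0 < c) (hb : 0 < b) : ∃ h₀ : ℝ, 0 < h₀ ∧ ∀ (j k : Freq d), j ≠ 0 →
    k ≠ 0 → ∀ η : ℝ, volume (nearRes c b j k η) ≤ 2 ^ d * (ENNReal.ofReal (η / h₀) * 2 ^ d) := by
  obtain ⟨h₀, hh, H⟩ := reson_expansive_scale (d := d) hc hb
  refine ⟨h₀, hh, fun j k hj hk η => ?_⟩
  have := measure_le_of_fibers volume (S := nearRes c b j k η)
    (B := Set.Icc (fun _ : Fin d => (0:ℝ)) (fun _ => 2)) (measurableSet_nearRes j k η)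
    (T := fun p => (1 + p.1) • p.2) (C := 2 ^ d) (δ := ENNReal.ofReal (η / h₀)) ?_ ?_ ?_ ?_
  · rwa [volume_cube] at this
  · fun_prop
  · rintro t ⟨ht0, ht1⟩
    have h1 : (1 + t) ≠ 0 := by linarith
    have h2 := Measure.addHaar_preimage_smul (volume : Measure (Fin d → ℝ)) h1 (nearRes c b j k η)
    change _ ≤ 2 ^ d * volume ((fun x => (1 + t) • x) ⁻¹' nearRes c b j k η)
    rw [h2, ← mul_assoc]
    refine le_mul_of_one_le_left zero_le ?_
    rw [show (2:ℝ≥0∞) ^ d = ENNReal.ofReal (2 ^ d) by simp [ENNReal.ofReal_pow],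
      ← ENNReal.ofReal_mul (by positivity), ENNReal.one_le_ofReal, Module.finrank_fintype_fun_eq_card,
      Fintype.card_fin, abs_of_nonneg (by positivity), ← div_eq_mul_inv, one_le_div (by positivity)]
    gcongr; linarith
  · rintro t ⟨ht0, ht1⟩ ν ⟨hν, -⟩
    refine ⟨fun l => ?_, fun l => ?_⟩ <;> have := hν l <;> simp at this ⊢
    · by_contra! h; nlinarith
    · by_contra! h; nlinarith
  · intro ν
    refine volume_le_of_dist ?_
    rintro t ⟨ht, hν, hr⟩ t' ⟨ht', hν', hr'⟩ htt
    simp only at hν hr hν' hr'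
    have := H ν j k (1 + t) (1 + t') η (fun i => ?_) hj hk (by linarith [ht.1]) (by linarith)
      (by linarith [ht'.2]) hr.le hr'.le
    · rw [le_div_iff₀ hh]; linarith
    · have := (hν i).1
      simp at this
      by_contra! h
      nlinarith [ht.1, ht.2]

/-- For large `|j_i|` the coordinate flow gives the decay; for bounded `|j_i|` the dilation suffices
and the power of `1 + |j_i|` is absorbed in the constant. When `k` is supported on `i` alone,
`le_abs_reson` leaves no near resonance at all for large `|j_i|`, so even the square is affordable.
-/
lemma volume_nearRes_le (d : ℕ) (hc : 0 < c) (hb : 0 < b) : ∃ C : ℝ, 0 < C ∧ ∀ (j k : Freq d), j ≠ 0 →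
    k ≠ 0 → ∀ i, k i ≠ 0 → ∀ η, 0 ≤ η →
      volume (nearRes c b j k η) ≤ ENNReal.ofReal (C * η * (1 + |(j i : ℝ)|)⁻¹) ∧
      ((∀ l, l ≠ i → k l = 0) → η ≤ 1 →
        volume (nearRes c b j k η) ≤ ENNReal.ofReal (C * η * ((1 + |(j i : ℝ)|)⁻¹) ^ 2)) := by
  obtain ⟨h₀, hh, H⟩ := volume_nearRes_scale d hc hb
  set C₂ := 2 * b / c + 1
  set C₃ := (2 * b + 1) / (2 * c)
  have h2d : ∀ x : ℝ, 0 ≤ x → ENNReal.ofReal x * 2 ^ d = ENNReal.ofReal (x * 2 ^ d) := fun x hx => by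
    rw [ENNReal.ofReal_mul hx]; simp [ENNReal.ofReal_pow]
  have h2d' : ∀ x : ℝ, 0 ≤ x → 2 ^ d * (ENNReal.ofReal x * 2 ^ d) = ENNReal.ofReal (x * 4 ^ d) := fun x hx => by
    rw [mul_comm, h2d x hx, h2d _ (by positivity)]
    congr 1
    rw [mul_assoc, ← mul_pow]; norm_num
  have hC₂ : 1 ≤ C₂ := by have : 0 ≤ 2 * b / c := by positivity
                          simp only [C₂]; linarith
  have hC₃ : 0 ≤ C₃ := by positivity
  refine ⟨2 * 2 ^ d / c + 4 ^ d / h₀ * (1 + C₂) + 4 ^ d / h₀ * (1 + C₃) ^ 2, by positivity,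
    fun j k hj hk i hki η hη => ⟨?_, fun hkl hη1 => ?_⟩⟩
  · have hk1 : (1:ℝ) ≤ |(k i : ℝ)| := by exact_mod_cast Int.one_le_abs hki
    set x := |(j i : ℝ)|
    have hx0 : 0 ≤ x := abs_nonneg _
    by_cases hx : C₂ ≤ x
    · have h1 : x ≤ |(j i : ℝ) * k i| := by
        rw [abs_mul]; exact le_mul_of_one_le_right (abs_nonneg _) hk1
      have hx1 : 1 ≤ x := hC₂.trans hx
      have h2 : 2 * b ≤ c * x := by
        have : 2 * b / c ≤ x := by simp only [C₂] at hx; linarith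
        rw [div_le_iff₀ hc] at this; linarith
      refine (volume_nearRes_coord hc hb j k i (h2.trans (by gcongr)) (by linarith)).trans ?_
      rw [h2d _ (by positivity)]
      refine ENNReal.ofReal_le_ofReal ?_
      calc η / (c * |(j i : ℝ) * k i|) * 2 ^ d ≤ η / (c * ((1 + x) / 2)) * 2 ^ d := by
            gcongr; linarith
        _ = (2 * 2 ^ d / c) * η * (1 + x)⁻¹ := by field_simp
        _ ≤ _ := by
            gcongr
            have : 0 ≤ 4 ^ d / h₀ * (1 + C₂) + 4 ^ d / h₀ * (1 + C₃) ^ 2 := by positivity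
            linarith
    · refine (H j k hj hk η).trans ?_
      rw [h2d' _ (by positivity)]
      refine ENNReal.ofReal_le_ofReal ?_
      push Not at hx
      calc η / h₀ * 4 ^ d = 4 ^ d / h₀ * (1 + x) * η * (1 + x)⁻¹ := by field_simp
        _ ≤ 4 ^ d / h₀ * (1 + C₂) * η * (1 + x)⁻¹ := by gcongr
        _ ≤ _ := by
            gcongr
            have : 0 ≤ 2 * 2 ^ d / c + 4 ^ d / h₀ * (1 + C₃) ^ 2 := by positivity
            linarith
  · have hk1 : (1:ℝ) ≤ |(k i : ℝ)| := by exact_mod_cast Int.one_le_abs hki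
    set x := |(j i : ℝ)|
    have hx0 : 0 ≤ x := abs_nonneg _
    by_cases hx : C₃ ≤ x
    · have h1 : x ≤ |(j i : ℝ) * k i| := by
        rw [abs_mul]; exact le_mul_of_one_le_right (abs_nonneg _) hk1
      have : nearRes c b j k η = ∅ := by
        refine Set.eq_empty_iff_forall_notMem.2 ?_
        rintro ν ⟨hν, hr⟩
        have h2 := le_abs_reson hc hb (hν i).1 (j := j) hkl
        have h3 : 2 * b + 1 ≤ 2 * c * x := by
          simp only [C₃] at hx
          rw [div_le_iff₀ (by positivity)] at hx; linarith
        have h4 : 2 * c * x ≤ 2 * c * |(j i : ℝ) * k i| := by gcongr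
        linarith
      rw [this]; simp
    · refine (H j k hj hk η).trans ?_
      rw [h2d' _ (by positivity)]
      refine ENNReal.ofReal_le_ofReal ?_
      push Not at hx
      calc η / h₀ * 4 ^ d = 4 ^ d / h₀ * (1 + x) ^ 2 * η * ((1 + x)⁻¹) ^ 2 := by field_simp
        _ ≤ 4 ^ d / h₀ * (1 + C₃) ^ 2 * η * ((1 + x)⁻¹) ^ 2 := by gcongr
        _ ≤ _ := by
            gcongr
            have : 0 ≤ 2 * 2 ^ d / c + 4 ^ d / h₀ * (1 + C₂) := by positivity
            linarith

end Measure

end QHD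
end

/-! ### Small divisors for almost every parameter -/

noncomputable section

namespace QHD

open scoped ENNReal ComplexConjugate Topology Pointwise

section BoxSums
variable {d : ℕ}

/-- The logarithmic factor `1 + log ⟨j⟩`. -/
def logBr (j : Freq d) : ℝ := 1 + Real.log (bracket j)

lemma one_le_logBr (j : Freq d) : 1 ≤ logBr j := by
  have := Real.log_nonneg (one_le_bracket j)
  unfold logBr; linarith

lemma sum_Icc_natAbs_le (f : ℕ → ℝ) (hf : ∀ n, 0 ≤ f n) (R : ℕ) :
    ∑ x ∈ Finset.Icc (-(R:ℤ)) R, f x.natAbs ≤ 2 * ∑ n ∈ Finset.range (R + 1), f n := by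
  classical
  have hsub : Finset.Icc (-(R:ℤ)) R ⊆ (Finset.range (R + 1)).image (fun n : ℕ => (n : ℤ)) ∪
      (Finset.range (R + 1)).image (fun n : ℕ => -(n : ℤ)) := by
    intro x hx
    rw [Finset.mem_Icc] at hx
    simp only [Finset.mem_union, Finset.mem_image, Finset.mem_range]
    rcases le_total 0 x with h | h
    · exact Or.inl ⟨x.natAbs, by omega, by omega⟩
    · exact Or.inr ⟨x.natAbs, by omega, by omega⟩
  refine (Finset.sum_le_sum_of_subset_of_nonneg hsub fun _ _ _ => hf _).trans ?_
  have h1 := Finset.sum_union_inter (s₁ := (Finset.range (R + 1)).image (fun n : ℕ => (n : ℤ)))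
    (s₂ := (Finset.range (R + 1)).image (fun n : ℕ => -(n : ℤ))) (f := fun x : ℤ => f x.natAbs)
  have h2 := Finset.sum_nonneg (s := (Finset.range (R + 1)).image (fun n : ℕ => (n : ℤ)) ∩
    (Finset.range (R + 1)).image (fun n : ℕ => -(n : ℤ))) (f := fun x : ℤ => f x.natAbs) fun _ _ => hf _
  rw [Finset.sum_image (f := fun x : ℤ => f x.natAbs) (fun a _ b _ h => by simpa using h),
    Finset.sum_image (f := fun x : ℤ => f x.natAbs) (fun a _ b _ h => by simpa using h)] at h1
  simp only [Int.natAbs_neg, Int.natAbs_natCast] at h1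
  linarith

lemma abs_eq_natAbs (x : ℤ) : |(x : ℝ)| = (x.natAbs : ℝ) := by
  rw [Nat.cast_natAbs, Int.cast_abs]

lemma sum_one_le (n : ℕ) : ∑ _x ∈ Finset.Icc (-((2 ^ n : ℕ) : ℤ)) (2 ^ n : ℕ), (1:ℝ) ≤ 3 * 2 ^ ((1:ℝ) * n) := by
  rw [Finset.sum_const, Int.card_Icc, one_mul, Real.rpow_natCast, nsmul_eq_mul, mul_one]
  have h1 : (((2 ^ n : ℕ) : ℤ) + 1 - -((2 ^ n : ℕ) : ℤ)).toNat = 2 * 2 ^ n + 1 := by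
    generalize 2 ^ n = a
    omega
  rw [h1]
  push_cast
  have : (1:ℝ) ≤ 2 ^ n := one_le_pow₀ (by norm_num)
  linarith

lemma sum_sq_inv_le (n : ℕ) :
    ∑ x ∈ Finset.Icc (-((2 ^ n : ℕ) : ℤ)) (2 ^ n : ℕ), ((1 + |(x:ℝ)|)⁻¹) ^ 2 ≤ 4 * 2 ^ ((0:ℝ) * n) := by
  simp only [abs_eq_natAbs]
  refine (sum_Icc_natAbs_le (fun n => ((1 + (n:ℝ))⁻¹) ^ 2) (fun n => by positivity) _).trans ?_
  have key : ∀ R : ℕ, ∑ n ∈ Finset.range (R + 1), ((1 + (n:ℝ))⁻¹) ^ 2 ≤ 2 - 1 / (R + 1) := by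
    intro R
    induction R with
    | zero => norm_num
    | succ R ih =>
      rw [Finset.sum_range_succ]
      push_cast
      have : ((1 + ((R:ℝ) + 1))⁻¹) ^ 2 ≤ 1 / (R + 1) - 1 / (R + 1 + 1) := by
        rw [div_sub_div _ _ (by positivity) (by positivity), inv_pow, inv_eq_one_div,
          div_le_div_iff₀ (by positivity) (by positivity)]
        nlinarith [(Nat.cast_nonneg R : (0:ℝ) ≤ R)]
      linarith
  have h1 := key (2 ^ n)
  have h2 : (0:ℝ) ≤ 1 / (((2 ^ n : ℕ) : ℝ) + 1) := by positivity
  rw [zero_mul, Real.rpow_zero]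
  linarith

lemma sum_sqrt_inv_le (n : ℕ) :
    ∑ x ∈ Finset.Icc (-((2 ^ n : ℕ) : ℤ)) (2 ^ n : ℕ), Real.sqrt ((1 + |(x:ℝ)|)⁻¹) ≤
      8 * 2 ^ ((1 / 2:ℝ) * n) := by
  simp only [abs_eq_natAbs]
  refine (sum_Icc_natAbs_le (fun n => Real.sqrt ((1 + (n:ℝ))⁻¹)) (fun n => by positivity) _).trans ?_
  have key : ∀ R : ℕ, ∑ n ∈ Finset.range (R + 1), Real.sqrt ((1 + (n:ℝ))⁻¹) ≤ 2 * Real.sqrt (R + 1) := by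
    intro R
    induction R with
    | zero => norm_num
    | succ R ih =>
      rw [Finset.sum_range_succ]
      push_cast
      have h0 : (0:ℝ) ≤ R := Nat.cast_nonneg R
      set a := Real.sqrt ((R:ℝ) + 1)
      set b := Real.sqrt ((R:ℝ) + 1 + 1) with hb
      have ha2 : a ^ 2 = R + 1 := Real.sq_sqrt (by positivity)
      have hb2 : b ^ 2 = R + 1 + 1 := Real.sq_sqrt (by positivity)
      have hab : a ≤ b := Real.sqrt_le_sqrt (by linarith)
      have hb0 : 0 < b := Real.sqrt_pos.2 (by positivity)
      have : Real.sqrt ((1 + ((R:ℝ) + 1))⁻¹) = b⁻¹ := by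
        rw [Real.sqrt_inv, hb]; congr 2; ring
      rw [this]
      have h3 : b⁻¹ ≤ 2 * (b - a) := by
        rw [inv_eq_one_div, div_le_iff₀ hb0]
        nlinarith
      linarith
  have h1 := key (2 ^ n)
  have h2 : Real.sqrt (((2 ^ n : ℕ) : ℝ) + 1) ≤ 2 * 2 ^ ((1 / 2:ℝ) * n) := by
    rw [mul_comm (1/2 : ℝ), Real.rpow_mul (by norm_num), ← Real.sqrt_eq_rpow, Real.rpow_natCast]
    have h3 : (1:ℝ) ≤ 2 ^ n := one_le_pow₀ (by norm_num)
    rw [show (2:ℝ) * Real.sqrt (2 ^ n) = Real.sqrt (4 * 2 ^ n) by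
      rw [Real.sqrt_mul (by norm_num), show (4:ℝ) = 2 ^ 2 by norm_num, Real.sqrt_sq (by norm_num)]]
    refine Real.sqrt_le_sqrt ?_
    push_cast; linarith
  linarith

/-- The weight `⟨j⟩^{1-d} (1 + log ⟨j⟩)^{-5/4}`. -/
def resWt (j : Freq d) : ℝ := bracket j ^ (1 - d : ℝ) * logBr j ^ (-(5 / 4) : ℝ)

lemma resWt_nonneg (j : Freq d) : 0 ≤ resWt j :=
  mul_nonneg (Real.rpow_nonneg (bracket_pos j).le _)
    (Real.rpow_nonneg (by linarith [one_le_logBr j]) _)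

lemma resWt_le_one (hd : 1 ≤ d) (j : Freq d) : resWt j ≤ 1 := by
  have hd' : (1:ℝ) ≤ d := by exact_mod_cast hd
  refine mul_le_one₀ (Real.rpow_le_one_of_one_le_of_nonpos (one_le_bracket j) (by linarith))
    (Real.rpow_nonneg (by linarith [one_le_logBr j]) _)
    (Real.rpow_le_one_of_one_le_of_nonpos (one_le_logBr j) (by norm_num))

/-- Summability of `resWt` against product weights with total growth exponent `d - 1`. -/
lemma tsum_resWt_mul_prod_le (hd : 1 ≤ d) (C₀ : ℝ) (hC₀ : 0 ≤ C₀) : ∃ K : ℝ, ∀ (f : Fin d → ℤ → ℝ) (θ : Fin d → ℝ),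
    (∀ i x, 0 ≤ f i x) → (∀ i (n : ℕ), ∑ x ∈ Finset.Icc (-((2 ^ n : ℕ) : ℤ)) (2 ^ n : ℕ), f i x ≤
      C₀ * 2 ^ (θ i * n)) → ∑ i, θ i = d - 1 →
    ∑' j : Freq d, ENNReal.ofReal (resWt j * ∏ i, f i (j i)) ≤ ENNReal.ofReal K := by
  classical
  have hsum : Summable fun n : ℕ => (1 + n * Real.log 2) ^ (-(5 / 4) : ℝ) := by
    have h1 : Summable fun n : ℕ => ((n + 1 : ℕ) : ℝ) ^ (-(5 / 4) : ℝ) :=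
      (summable_nat_add_iff 1).2 (Real.summable_nat_rpow.2 (by norm_num))
    have hl : 0 < Real.log 2 := Real.log_pos (by norm_num)
    have hl1 : Real.log 2 ≤ 1 := by linarith [Real.log_two_lt_d9]
    refine (h1.mul_left (Real.log 2 ^ (-(5 / 4) : ℝ))).of_nonneg_of_le
      (fun n => Real.rpow_nonneg (by positivity) _) fun n => ?_
    rw [← Real.mul_rpow hl.le (by positivity)]
    refine Real.rpow_le_rpow_of_nonpos (by positivity) ?_ (by norm_num)
    push_cast; nlinarith
  set S := ∑' n : ℕ, (1 + n * Real.log 2) ^ (-(5 / 4) : ℝ)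
  have hl : 0 < Real.log 2 := Real.log_pos (by norm_num)
  refine ⟨C₀ ^ d * 2 ^ (d - 1 : ℝ) * S, fun f θ hf hfs hθ => ?_⟩
  let B : ℕ → Finset (Freq d) := fun n =>
    Fintype.piFinset fun _ => Finset.Icc (-((2 ^ (n + 1) : ℕ) : ℤ)) (2 ^ (n + 1) : ℕ)
  let a : ℕ → ℝ := fun n => (2:ℝ) ^ ((1 - d : ℝ) * n) * (1 + n * Real.log 2) ^ (-(5 / 4) : ℝ)
  have ha : ∀ n, 0 ≤ a n := fun n => mul_nonneg (by positivity) (Real.rpow_nonneg (by positivity) _)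
  have hd' : (1:ℝ) ≤ d := by exact_mod_cast hd
  have hP : ∀ j : Freq d, 0 ≤ ∏ i, f i (j i) := fun j => Finset.prod_nonneg fun i _ => hf i _
  have h1 : ∀ j : Freq d, ENNReal.ofReal (resWt j * ∏ i, f i (j i)) ≤
      ∑' n, if j ∈ B n then ENNReal.ofReal (a n * ∏ i, f i (j i)) else 0 := by
    intro j
    -- Dyadic shell `2^n ≤ ⟨j⟩ < 2^{n+1}`, contained in the box `B n`. The growth `2^{(d-1)n}` of
    -- the box sum cancels `⟨j⟩^{1-d}`, and only the convergent series of `(1 + n log 2)^{-5/4}` is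
    -- left.
    obtain ⟨n, hn1, hn2⟩ := exists_nat_pow_near (one_le_bracket j) (one_lt_two : (1:ℝ) < 2)
    refine le_trans ?_ (ENNReal.le_tsum n)
    have hj : j ∈ B n := by
      simp only [B, Fintype.mem_piFinset, Finset.mem_Icc]
      intro i
      have h1 := (abs_coord_le_elen j i).trans (elen_le_bracket j)
      have h2 := abs_le.1 (h1.trans hn2.le)
      constructor
      · have := h2.1; exact_mod_cast this
      · have := h2.2; exact_mod_cast this
    rw [if_pos hj]
    refine ENNReal.ofReal_le_ofReal (mul_le_mul_of_nonneg_right ?_ (hP j))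
    have h2 : bracket j ^ (1 - d : ℝ) ≤ (2:ℝ) ^ ((1 - d : ℝ) * n) := by
      rw [mul_comm, Real.rpow_mul (by norm_num), Real.rpow_natCast]
      exact Real.rpow_le_rpow_of_nonpos (by positivity) hn1 (by linarith)
    have h3 : logBr j ^ (-(5 / 4) : ℝ) ≤ (1 + n * Real.log 2) ^ (-(5 / 4) : ℝ) := by
      refine Real.rpow_le_rpow_of_nonpos (by positivity) ?_ (by norm_num)
      have := Real.log_le_log (by positivity) hn1
      rw [Real.log_pow] at this
      unfold logBr; linarith
    exact mul_le_mul h2 h3 (Real.rpow_nonneg (by linarith [one_le_logBr j]) _) (by positivity)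
  calc ∑' j : Freq d, ENNReal.ofReal (resWt j * ∏ i, f i (j i))
      ≤ ∑' j : Freq d, ∑' n, if j ∈ B n then ENNReal.ofReal (a n * ∏ i, f i (j i)) else 0 :=
        ENNReal.tsum_le_tsum h1
    _ = ∑' n, ∑' j : Freq d, if j ∈ B n then ENNReal.ofReal (a n * ∏ i, f i (j i)) else 0 :=
        ENNReal.tsum_comm
    _ ≤ ∑' n : ℕ, ENNReal.ofReal (C₀ ^ d * 2 ^ (d - 1 : ℝ) * (1 + n * Real.log 2) ^ (-(5 / 4) : ℝ)) := by
        refine ENNReal.tsum_le_tsum fun n => ?_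
        rw [tsum_eq_sum (s := B n) (fun j hj => if_neg hj), Finset.sum_congr rfl (fun j hj => if_pos hj),
          ← ENNReal.ofReal_sum_of_nonneg (fun j _ => mul_nonneg (ha n) (hP j)), ← Finset.mul_sum,
          ← Finset.prod_univ_sum]
        refine ENNReal.ofReal_le_ofReal ?_
        have h2 : ∏ i, ∑ x ∈ Finset.Icc (-((2 ^ (n + 1) : ℕ) : ℤ)) (2 ^ (n + 1) : ℕ), f i x ≤
            ∏ i : Fin d, (C₀ * 2 ^ (θ i * (n + 1 : ℕ))) :=
          Finset.prod_le_prod (fun i _ => Finset.sum_nonneg fun x _ => hf i x) fun i _ => hfs i _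
        rw [Finset.prod_mul_distrib, ← Real.rpow_sum_of_pos (by norm_num), ← Finset.sum_mul, hθ,
          Finset.prod_const, Finset.card_univ, Fintype.card_fin] at h2
        refine (mul_le_mul_of_nonneg_left h2 (ha n)).trans (le_of_eq ?_)
        simp only [a]
        have h3 : (2:ℝ) ^ ((1 - d : ℝ) * n) * 2 ^ ((d - 1 : ℝ) * (n + 1 : ℕ)) = 2 ^ (d - 1 : ℝ) := by
          rw [← Real.rpow_add (by norm_num)]; congr 1; push_cast; ring
        rw [← h3]; ring
    _ = _ := by
        rw [← ENNReal.ofReal_tsum_of_nonneg (fun n => mul_nonneg (by positivity)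
          (Real.rpow_nonneg (by positivity) _)) (hsum.mul_left _), tsum_mul_left]

end BoxSums

section SmallDivisors
variable {d : ℕ} {c b : ℝ}

/-- Two coordinates contribute box sums of exponent `1/2` and the other `d - 2` have exponent `1`,
for a total of `d - 1`, which is critical for `resWt`. -/
lemma tsum_resWt_sqrt_le (hd : 1 ≤ d) : ∃ K : ℝ, ∀ i i' : Fin d, i ≠ i' →
    ∑' j : Freq d, ENNReal.ofReal (resWt j *
      (Real.sqrt ((1 + |(j i:ℝ)|)⁻¹) * Real.sqrt ((1 + |(j i':ℝ)|)⁻¹))) ≤ ENNReal.ofReal K := by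
  classical
  obtain ⟨K, hK⟩ := tsum_resWt_mul_prod_le hd 8 (by norm_num)
  refine ⟨K, fun i i' hii => ?_⟩
  have := hK (fun l x => (if l = i then Real.sqrt ((1 + |(x:ℝ)|)⁻¹) else 1) *
      (if l = i' then Real.sqrt ((1 + |(x:ℝ)|)⁻¹) else 1))
    (fun l => 1 - (if l = i then 1 / 2 else 0) - (if l = i' then 1 / 2 else 0)) ?_ ?_ ?_
  · simpa only [Finset.prod_mul_distrib, Finset.prod_ite_eq', Finset.mem_univ, if_true] using this
  · intro l x
    split_ifs <;> positivity
  · intro l n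
    by_cases h1 : l = i
    · have h2 : l ≠ i' := h1 ▸ hii
      simp only [h1, if_true, if_neg hii, mul_one, sub_zero]
      convert sum_sqrt_inv_le n using 3
      norm_num
    · by_cases h2 : l = i'
      · simp only [if_neg h1, if_pos h2, one_mul, sub_zero]
        convert sum_sqrt_inv_le n using 3
        norm_num
      · simp only [if_neg h1, if_neg h2, one_mul, sub_zero]
        refine (sum_one_le n).trans ?_
        rw [one_mul]; gcongr; norm_num
  · simp only [Finset.sum_sub_distrib, Finset.sum_ite_eq', Finset.mem_univ, if_true]
    simp; ring

/-- One coordinate is summable, of exponent `0`, and the others have exponent `1`: the total is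
again `d - 1`. -/
lemma tsum_resWt_sq_le (hd : 1 ≤ d) : ∃ K : ℝ, ∀ i : Fin d,
    ∑' j : Freq d, ENNReal.ofReal (resWt j * ((1 + |(j i:ℝ)|)⁻¹) ^ 2) ≤ ENNReal.ofReal K := by
  classical
  obtain ⟨K, hK⟩ := tsum_resWt_mul_prod_le hd 8 (by norm_num)
  refine ⟨K, fun i => ?_⟩
  have := hK (fun l x => (if l = i then ((1 + |(x:ℝ)|)⁻¹) ^ 2 else 1))
    (fun l => 1 - (if l = i then 1 else 0)) ?_ ?_ ?_
  · simpa only [Finset.prod_ite_eq', Finset.mem_univ, if_true] using this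
  · intro l x
    split_ifs <;> positivity
  · intro l n
    by_cases h1 : l = i
    · simp only [if_pos h1, sub_self]
      refine (sum_sq_inv_le n).trans ?_
      gcongr; norm_num
    · simp only [if_neg h1, sub_zero]
      refine (sum_one_le n).trans ?_
      gcongr; norm_num
  · simp [Finset.sum_sub_distrib]

/-- Small divisor estimate, valid for almost every `ν`. -/
theorem ae_small_divisors (hd : 2 ≤ d) (hc : 0 < c) (hb : 0 < b) :
    ∀ᵐ ν : Fin d → ℝ ∂(volume.restrict (Set.Icc (fun _ => (1 : ℝ)) (fun _ => 2))),
      ∃ γ : ℝ, 0 < γ ∧ ∀ j k : Freq d, j ≠ 0 → k ≠ 0 →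
        γ * (bracket k ^ (-(2 * d : ℝ)) * resWt j) ≤ |reson c b ν j k| := by
  have hd1 : 1 ≤ d := by omega
  obtain ⟨C, hC, hvol⟩ := volume_nearRes_le d hc hb
  obtain ⟨K₁, hK₁⟩ := tsum_resWt_sqrt_le hd1
  obtain ⟨K₂, hK₂⟩ := tsum_resWt_sq_le hd1
  set K := max K₁ K₂
  let ψ : Freq d → Freq d → ℝ := fun j k => bracket k ^ (-(2 * d : ℝ)) * resWt j
  have hψ0 : ∀ j k, 0 ≤ ψ j k := fun j k =>
    mul_nonneg (Real.rpow_nonneg (bracket_pos k).le _) (resWt_nonneg j)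
  have hψ1 : ∀ j k, ψ j k ≤ 1 := fun j k =>
    mul_le_one₀ (Real.rpow_le_one_of_one_le_of_nonpos (one_le_bracket k) (by
      have : (0:ℝ) ≤ d := Nat.cast_nonneg d
      linarith)) (resWt_nonneg j) (resWt_le_one hd1 j)
  have hsumk : ∀ γ : ℝ, 0 ≤ γ → γ ≤ 1 → ∀ k : Freq d, k ≠ 0 →
      ∑' j : Freq d, (if j = 0 then 0 else volume (nearRes c b j k (γ * ψ j k))) ≤
        ENNReal.ofReal (C * γ * bracket k ^ (-(2 * d : ℝ))) * ENNReal.ofReal K := by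
    intro γ hγ hγ1 k hk
    have hbk : 0 ≤ bracket k ^ (-(2 * d : ℝ)) := Real.rpow_nonneg (bracket_pos k).le _
    obtain ⟨i, hi⟩ := Function.ne_iff.1 hk
    -- With two nonzero coordinates of `k` both decay factors are available, and their minimum is
    -- below their geometric mean; otherwise the squared decay of `volume_nearRes_le` is used.
    by_cases h : ∃ i', i' ≠ i ∧ k i' ≠ 0
    · obtain ⟨i', hii, hi'⟩ := h
      refine le_trans ?_ (mul_le_mul_right ((hK₁ i i' hii.symm).trans
        (ENNReal.ofReal_le_ofReal (le_max_left K₁ K₂))) _)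
      rw [← ENNReal.tsum_mul_left]
      refine ENNReal.tsum_le_tsum fun j => ?_
      split_ifs with hj
      · exact zero_le
      rw [← ENNReal.ofReal_mul (by positivity)]
      have h1 := (hvol j k hj hk i hi (γ * ψ j k) (mul_nonneg hγ (hψ0 j k))).1
      have h2 := (hvol j k hj hk i' hi' (γ * ψ j k) (mul_nonneg hγ (hψ0 j k))).1
      have h3 := le_min h1 h2
      rw [← ENNReal.ofReal_min] at h3
      refine h3.trans (ENNReal.ofReal_le_ofReal ?_)
      have hx : 0 ≤ (1 + |(j i:ℝ)|)⁻¹ := by positivity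
      have hy : 0 ≤ (1 + |(j i':ℝ)|)⁻¹ := by positivity
      set x := (1 + |(j i:ℝ)|)⁻¹
      set y := (1 + |(j i':ℝ)|)⁻¹
      have h0 : 0 ≤ C * (γ * ψ j k) := mul_nonneg hC.le (mul_nonneg hγ (hψ0 j k))
      rw [← mul_min_of_nonneg _ _ h0]
      have h4 : min x y ≤ Real.sqrt x * Real.sqrt y := by
        rw [← Real.sqrt_mul hx]
        refine Real.le_sqrt_of_sq_le ?_
        rw [sq]
        exact mul_le_mul (min_le_left _ _) (min_le_right _ _) (le_min hx hy) hx
      refine (mul_le_mul_of_nonneg_left h4 h0).trans (le_of_eq ?_)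
      simp only [ψ]; ring
    · push Not at h
      refine le_trans ?_ (mul_le_mul_right ((hK₂ i).trans
        (ENNReal.ofReal_le_ofReal (le_max_right K₁ K₂))) _)
      rw [← ENNReal.tsum_mul_left]
      refine ENNReal.tsum_le_tsum fun j => ?_
      split_ifs with hj
      · exact zero_le
      rw [← ENNReal.ofReal_mul (by positivity)]
      refine ((hvol j k hj hk i hi (γ * ψ j k) (mul_nonneg hγ (hψ0 j k))).2 h
        (mul_le_one₀ hγ1 (hψ0 j k) (hψ1 j k))).trans (ENNReal.ofReal_le_ofReal (le_of_eq ?_))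
      simp only [ψ]; ring
  -- The parameters for which no `γ` works. Their measure is at most a constant times `γ` for every
  -- `γ ≤ 1`, hence zero; the factor `⟨k⟩^{-2d}` serves to sum over `k`.
  let Bad : Set (Fin d → ℝ) := {ν | ν ∈ Set.Icc (fun _ => (1 : ℝ)) (fun _ => 2) ∧ ∀ γ : ℝ, 0 < γ → ∃ j k : Freq d, j ≠ 0 ∧ k ≠ 0 ∧
    |reson c b ν j k| < γ * ψ j k}
  set S := ∑' k : Freq d, ENNReal.ofReal (bracket k ^ (-(2 * d : ℝ)))
  have hS : S ≠ ⊤ := (summable_bracket (d := d)).tsum_ofReal_ne_top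
  have hbad : ∀ γ : ℝ, 0 < γ → γ ≤ 1 → volume Bad ≤ ENNReal.ofReal γ * (ENNReal.ofReal C * S * ENNReal.ofReal K) := by
    intro γ hγ hγ1
    have hsub : Bad ⊆ ⋃ k : Freq d, ⋃ j : Freq d, if k = 0 then ∅ else if j = 0 then ∅ else nearRes c b j k (γ * ψ j k) := by
      rintro ν ⟨⟨hν1, hν2⟩, h⟩
      obtain ⟨j, k, hj, hk, hjk⟩ := h γ hγ
      refine Set.mem_iUnion.2 ⟨k, Set.mem_iUnion.2 ⟨j, ?_⟩⟩
      rw [if_neg hk, if_neg hj]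
      exact ⟨fun i => ⟨hν1 i, hν2 i⟩, hjk⟩
    refine (measure_mono hsub).trans ((measure_iUnion_le _).trans ?_)
    have e : ENNReal.ofReal γ * (ENNReal.ofReal C * S * ENNReal.ofReal K) =
        ∑' k : Freq d, ENNReal.ofReal (C * γ * bracket k ^ (-(2 * d : ℝ))) * ENNReal.ofReal K := by
      have h1 : ∀ k : Freq d, ENNReal.ofReal (C * γ * bracket k ^ (-(2 * d : ℝ))) =
        ENNReal.ofReal C * ENNReal.ofReal γ * ENNReal.ofReal (bracket k ^ (-(2 * d : ℝ))) := fun k => by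
          rw [ENNReal.ofReal_mul (by positivity), ENNReal.ofReal_mul hC.le]
      simp only [h1]
      rw [ENNReal.tsum_mul_right, ENNReal.tsum_mul_left]
      ring
    rw [e]
    refine ENNReal.tsum_le_tsum fun k => ?_
    by_cases hk : k = 0
    · simp [hk]
    · simp only [if_neg hk]
      refine (measure_iUnion_le _).trans (le_trans (ENNReal.tsum_le_tsum fun j => ?_) (hsumk γ hγ.le hγ1 k hk))
      split_ifs <;> simp
  have hbad0 : volume Bad = 0 := by
    have hfin : ENNReal.ofReal C * S * ENNReal.ofReal K ≠ ⊤ :=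
      ENNReal.mul_ne_top (ENNReal.mul_ne_top ENNReal.ofReal_ne_top hS) ENNReal.ofReal_ne_top
    have hlim : Filter.Tendsto (fun n : ℕ => ENNReal.ofReal (1 / ((n:ℝ) + 1)) * (ENNReal.ofReal C * S * ENNReal.ofReal K))
        Filter.atTop (𝓝 0) := by
      have h1 : Filter.Tendsto (fun n : ℕ => ENNReal.ofReal (1 / ((n:ℝ) + 1))) Filter.atTop (𝓝 0) := by
        have := ENNReal.tendsto_ofReal (tendsto_one_div_add_atTop_nhds_zero_nat (𝕜 := ℝ))
        simpa using this
      simpa using ENNReal.Tendsto.mul_const h1 (Or.inr hfin)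
    refine le_antisymm (ge_of_tendsto' hlim fun n => hbad _ (by positivity) ?_) zero_le
    rw [div_le_one (by positivity)]
    linarith [(Nat.cast_nonneg n : (0:ℝ) ≤ n)]
  rw [ae_restrict_iff' measurableSet_Icc]
  have h1 : ∀ᵐ ν : Fin d → ℝ, ν ∉ Bad := measure_eq_zero_iff_ae_notMem.1 hbad0
  filter_upwards [h1] with ν hν hcube
  by_contra hcon
  refine hν ⟨hcube, fun γ hγ => ?_⟩
  by_contra! h
  exact hcon ⟨γ, hγ, fun j k hj hk => h j k hj hk⟩

end SmallDivisors

end QHD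
end

/-! ### Three-wave dichotomy: removable triples and triples with a gain -/

noncomputable section

namespace QHD

open scoped ENNReal ComplexConjugate Topology Pointwise

section Triples
variable {d : ℕ}

/-- The truncated energy weight as a function of the Japanese bracket. -/
def truncWt (s M x : ℝ) : ℝ := x ^ (2 * s) * max 0 (1 - x / M)

lemma truncWt_nonneg {s M x : ℝ} (hx : 0 ≤ x) : 0 ≤ truncWt s M x :=
  mul_nonneg (Real.rpow_nonneg hx _) (le_max_left _ _)

lemma truncWt_le {s M x : ℝ} (hM : 0 < M) (hx : 0 ≤ x) : truncWt s M x ≤ x ^ (2 * s) := by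
  refine mul_le_of_le_one_right (Real.rpow_nonneg hx _) (max_le zero_le_one ?_)
  have : 0 ≤ x / M := by positivity
  linarith

lemma truncWt_eq_zero {s M x : ℝ} (hM : 0 < M) (hx : M ≤ x) : truncWt s M x = 0 := by
  have : 1 - x / M ≤ 0 := by rw [sub_nonpos, one_le_div hM]; exact hx
  rw [truncWt, max_eq_left this, mul_zero]

/-- The bound is uniform in `M`: the piecewise linear cutoff has slope `1/M`, and it is multiplied
by `x` only where `x ≤ M`, so `x` times its variation is at most `|x - y|`. -/
lemma abs_truncWt_sub_le {s M x y : ℝ} (hs : 1 ≤ s) (hM : 0 < M) (hx : 0 < x) (hy : 0 < y) :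
    |truncWt s M x - truncWt s M y| ≤ (2 * s + 1) * max x y ^ (2 * s - 1) * |x - y| := by
  wlog hxy : x ≤ y generalizing x y
  · rw [abs_sub_comm, max_comm, abs_sub_comm x]
    exact this hy hx (le_of_not_ge hxy)
  set χ : ℝ → ℝ := fun x => max 0 (1 - x / M)
  have hχ1 : |χ y| ≤ 1 := by
    rw [abs_of_nonneg (le_max_left _ _)]
    refine max_le zero_le_one ?_
    have : 0 ≤ y / M := by positivity
    linarith
  have e : truncWt s M x - truncWt s M y = (x ^ (2 * s) - y ^ (2 * s)) * χ y + x ^ (2 * s) * (χ x - χ y) := by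
    simp only [truncWt, χ]; ring
  have h1 : |x ^ (2 * s) - y ^ (2 * s)| ≤ 2 * s * max x y ^ (2 * s - 1) * |x - y| := by
    have := abs_rpow_sub_rpow_le hy hx (by linarith : 1 ≤ 2 * s)
    rwa [max_comm] at this
  have h2 : |x ^ (2 * s) * (χ x - χ y)| ≤ max x y ^ (2 * s - 1) * |x - y| := by
    rw [abs_mul, abs_of_nonneg (Real.rpow_nonneg hx.le _), max_eq_right hxy]
    have h3 : x ^ (2 * s) = x ^ (2 * s - 1) * x := by
      rw [← Real.rpow_add_one hx.ne']; ring_nf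
    have h4 : x * |χ x - χ y| ≤ |x - y| := by
      rcases le_total x M with hxM | hxM
      · have : |χ x - χ y| ≤ |x - y| / M := by
          refine (abs_max_sub_max_le_max 0 (1 - x / M) 0 (1 - y / M)).trans (le_of_eq ?_)
          · rw [sub_self, abs_zero, max_eq_right (abs_nonneg _), show 1 - x / M - (1 - y / M) = -((x - y) / M) by ring, abs_neg, abs_div, abs_of_pos hM]
        calc x * |χ x - χ y| ≤ M * (|x - y| / M) := by gcongr
          _ = _ := by field_simp
      · have e1 : χ x = 0 := max_eq_left (by rw [sub_nonpos, one_le_div hM]; exact hxM)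
        have e2 : χ y = 0 := max_eq_left (by rw [sub_nonpos, one_le_div hM]; exact hxM.trans hxy)
        rw [e1, e2]; simp
    rw [h3, mul_assoc]
    refine mul_le_mul (Real.rpow_le_rpow hx.le hxy (by linarith)) h4 (by positivity)
      (Real.rpow_nonneg hy.le _)
  rw [e]
  refine (abs_add_le _ _).trans ?_
  rw [abs_mul]
  have h5 : |x ^ (2 * s) - y ^ (2 * s)| * |χ y| ≤ 2 * s * max x y ^ (2 * s - 1) * |x - y| :=
    (mul_le_of_le_one_right (abs_nonneg _) hχ1).trans h1
  linarith

/-- The symmetric trilinear weight. -/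
def triWt (θ s : ℝ) (a b c : Freq d) : ℝ :=
  bracket a ^ θ * (bracket b ^ s * bracket c ^ s) + bracket b ^ θ * (bracket a ^ s * bracket c ^ s) +
    bracket c ^ θ * (bracket a ^ s * bracket b ^ s)

lemma triWt_terms (θ s : ℝ) (a b c : Freq d) :
    bracket a ^ θ * (bracket b ^ s * bracket c ^ s) ≤ triWt θ s a b c ∧
    bracket b ^ θ * (bracket a ^ s * bracket c ^ s) ≤ triWt θ s a b c ∧
    bracket c ^ θ * (bracket a ^ s * bracket b ^ s) ≤ triWt θ s a b c := by
  have ha := (bracket_pos a).le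
  have hb := (bracket_pos b).le
  have hc := (bracket_pos c).le
  have h1 : 0 ≤ bracket a ^ θ * (bracket b ^ s * bracket c ^ s) := by positivity
  have h2 : 0 ≤ bracket b ^ θ * (bracket a ^ s * bracket c ^ s) := by positivity
  have h3 : 0 ≤ bracket c ^ θ * (bracket a ^ s * bracket b ^ s) := by positivity
  unfold triWt
  exact ⟨by linarith, by linarith, by linarith⟩

/-- The loss factor `N^{d-2} (1 + log N)^{5/4}`. -/
def lossFac (d : ℕ) (N : ℝ) : ℝ := N ^ ((d : ℝ) - 2) * (1 + Real.log N) ^ (5 / 4 : ℝ)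

lemma one_le_lossFac (hd : 2 ≤ d) {N : ℝ} (hN : 1 ≤ N) : 1 ≤ lossFac d N := by
  have hd' : (2:ℝ) ≤ d := by exact_mod_cast hd
  have := Real.log_nonneg hN
  exact one_le_mul_of_one_le_of_one_le (Real.one_le_rpow hN (by linarith))
    (Real.one_le_rpow (by linarith) (by norm_num))

/-- Hypotheses on a dispersion relation under which three-wave interactions can be removed. -/
structure NonRes (d : ℕ) (c₀ γ : ℝ) (om : Freq d → ℝ) : Prop where
  c_pos : 0 < c₀
  γ_pos : 0 < γ
  lower : ∀ j, j ≠ 0 → c₀ ≤ om j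
  mono : ∀ j k, 4 * elen j ≤ elen k → om j ≤ om k
  even : ∀ j, om (-j) = om j
  small : ∀ j k, j ≠ 0 → k ≠ 0 →
    γ * (bracket k ^ (-(2 * d : ℝ)) * resWt j) ≤ |om k + om j - om (j + k)|

/-- Either the commutator `κ` is controlled by the resonance function `Ω`, with bounded
frequencies, or it gains a factor `1/N`. -/
def Dichotomy (C N M s : ℝ) (a b c : Freq d) (kap Om : ℝ) : Prop :=
  (|kap| ≤ C * lossFac d N * triWt (2 * d + 1) s a b c * |Om| ∧
      bracket a ≤ 8 * M * N ∧ bracket b ≤ 8 * M * N ∧ bracket c ≤ 8 * M * N) ∨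
    |kap| ≤ C * triWt (2 * d + 1) s a b c / N

-- With `|a| ≤ |b|` and signs `(+, +, σ)` two situations arise. If `σ = 1` or `4|c| ≤ |b|`, then `Ω
-- ≥ c₀` by positivity and monotonicity of `ω`. Otherwise `b` and `c` are comparable with opposite
-- signs, so the difference of their weights gains `⟨a⟩ / ⟨b⟩`, and the small divisor bound or the
-- inequality `⟨b⟩ > N` concludes.
set_option maxHeartbeats 1600000 in
lemma dichotomy_sorted (hd : 2 ≤ d) {c₀ γ : ℝ} {om : Freq d → ℝ} (hom : NonRes d c₀ γ om) {s : ℝ}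
    (hs : 1 ≤ s) : ∃ C : ℝ, 0 < C ∧ ∀ (N M : ℝ) (a b c : Freq d) (σ : ℝ), 1 ≤ N → 1 ≤ M → a ≠ 0 → b ≠ 0 → c ≠ 0 →
      a + b + c = 0 → elen a ≤ elen b → (σ = 1 ∨ σ = -1) →
      Dichotomy C N M s a b c
        (truncWt s M (bracket a) + truncWt s M (bracket b) + σ * truncWt s M (bracket c))
        (om a + om b + σ * om c) := by
  have hc0 := hom.c_pos
  have hγ := hom.γ_pos
  set C₁ : ℝ := (2 + 2 ^ (2 * s)) * 4 ^ s with hC₁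
  set C₂ : ℝ := (1 + (2 * s + 1) * 2 ^ (2 * s - 1)) * 4 ^ s with hC₂
  have hC₁0 : 0 < C₁ := by positivity
  have hC₂0 : 0 < C₂ := by positivity
  refine ⟨C₁ / c₀ + 1 + C₂ / γ + C₂, by positivity, ?_⟩
  intro N M a b c σ hN hM ha hb hc habc hab hσ
  have hN0 : 0 < N := by linarith
  have hM0 : 0 < M := by linarith
  have hA := bracket_pos a
  have hB := bracket_pos b
  have hC := bracket_pos c
  have hA1 := one_le_bracket a
  have hB1 := one_le_bracket b
  have hC1 := one_le_bracket c
  have hea := elen_nonneg a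
  have heb := elen_nonneg b
  have hec := elen_nonneg c
  have hsqA := bracket_sq a
  have hsqB := bracket_sq b
  have hsqC := bracket_sq c
  have hAB : bracket a ≤ bracket b :=
    abs_le_of_sq_le_sq' (by rw [hsqA, hsqB]; nlinarith) hB.le |>.2
  have hcab : c = -(a + b) := by rw [eq_neg_iff_add_eq_zero, add_comm]; exact habc
  have hCAB : bracket c ≤ 2 * bracket b := by
    rw [hcab, bracket_neg]; linarith [bracket_add_le a b]
  have hebc : elen b ≤ elen a + elen c := by
    have h1 : b = -a + -c := by rw [hcab]; abel
    have h2 := elen_add_le (-a) (-c)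
    rw [← h1, elen_neg, elen_neg] at h2
    exact h2
  obtain ⟨T1, T2, T3⟩ := triWt_terms (2 * d + 1 : ℝ) s a b c
  have hd0 : (2:ℝ) ≤ d := by exact_mod_cast hd
  have hX0 : 0 < triWt (2 * d + 1 : ℝ) s a b c := lt_of_lt_of_le (by positivity) T1
  set X := triWt (2 * d + 1 : ℝ) s a b c with hX
  have hK := one_le_lossFac hd hN
  set K := lossFac d N with hKdef
  have hWA0 : 0 ≤ truncWt s M (bracket a) := truncWt_nonneg hA.le
  have hWB0 : 0 ≤ truncWt s M (bracket b) := truncWt_nonneg hB.le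
  have hWC0 : 0 ≤ truncWt s M (bracket c) := truncWt_nonneg hC.le
  have hθ : ∀ x : ℝ, 1 ≤ x → 1 ≤ x ^ (2 * d + 1 : ℝ) := fun x hx => Real.one_le_rpow hx (by positivity)
  -- Since `|b| ≤ |a| + |c|`, the largest of `a, b` is comparable either with `c` or with `a`; two
  -- of the three brackets can therefore carry the weight `⟨b⟩^{2s}`.
  have hcomp : elen b < 4 * elen c ∧ bracket b ≤ 4 * bracket c ∨
      4 * elen c ≤ elen b ∧ bracket b ≤ 4 / 3 * bracket a := by
    rcases lt_or_ge (elen b) (4 * elen c) with h | h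
    · refine Or.inl ⟨h, abs_le_of_sq_le_sq' ?_ (by linarith) |>.2⟩
      have h4 := pow_le_pow_left₀ heb h.le 2
      rw [mul_pow] at h4 ⊢
      linarith
    · refine Or.inr ⟨h, abs_le_of_sq_le_sq' ?_ (by linarith) |>.2⟩
      have h4 := pow_le_pow_left₀ heb (show elen b ≤ 4 / 3 * elen a by linarith) 2
      rw [mul_pow] at h4 ⊢
      linarith
  have hσ1 : |σ| = 1 := by rcases hσ with h | h <;> simp [h]
  have hMNM : M ≤ M * N := le_mul_of_one_le_right hM0.le hN
  have hNMN : N ≤ M * N := le_mul_of_one_le_left hN0.le hM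
  by_cases hP : σ = 1 ∨ 4 * elen c ≤ elen b
  · -- nonresonant configurations
    have hΩ : c₀ ≤ |om a + om b + σ * om c| := by
      refine le_trans ?_ (le_abs_self _)
      have h1 := hom.lower a ha
      have h2 := hom.lower b hb
      have h3 := hom.lower c hc
      rcases hσ with h | h
      · rw [h]; linarith
      · have h4 := hom.mono c b (hP.resolve_left (by rw [h]; norm_num))
        rw [h]; linarith
    rcases le_or_gt (bracket b) (4 * M * N) with hBR | hBR
    · left
      have hMN : 0 < M * N := by positivity
      refine ⟨?_, by linarith, by linarith, by linarith⟩
      have h1 : |truncWt s M (bracket a) + truncWt s M (bracket b) + σ * truncWt s M (bracket c)| ≤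
          (2 + 2 ^ (2 * s)) * bracket b ^ (2 * s) := by
        have i1 : truncWt s M (bracket a) ≤ bracket b ^ (2 * s) :=
          (truncWt_le hM0 hA.le).trans (Real.rpow_le_rpow hA.le hAB (by linarith))
        have i2 : truncWt s M (bracket b) ≤ bracket b ^ (2 * s) := truncWt_le hM0 hB.le
        have i3 : truncWt s M (bracket c) ≤ 2 ^ (2 * s) * bracket b ^ (2 * s) := by
          rw [← Real.mul_rpow (by norm_num) hB.le]
          exact (truncWt_le hM0 hC.le).trans (Real.rpow_le_rpow hC.le hCAB (by linarith))
        refine (abs_add_le _ _).trans ?_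
        rw [abs_mul, hσ1, one_mul, abs_of_nonneg hWC0, abs_of_nonneg (add_nonneg hWA0 hWB0)]
        linarith
      have h2 : bracket b ^ (2 * s) ≤ 4 ^ s * X := by
        have e : bracket b ^ (2 * s) = bracket b ^ s * bracket b ^ s := by
          rw [← Real.rpow_add hB]; ring_nf
        rw [e]
        rcases hcomp with ⟨-, h⟩ | ⟨-, h⟩
        · have i1 : bracket b ^ s ≤ 4 ^ s * bracket c ^ s := by
            rw [← Real.mul_rpow (by norm_num) hC.le]; exact Real.rpow_le_rpow hB.le h (by linarith)
          calc bracket b ^ s * bracket b ^ s ≤ bracket b ^ s * (4 ^ s * bracket c ^ s) := by gcongr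
            _ = 4 ^ s * (1 * (bracket b ^ s * bracket c ^ s)) := by ring
            _ ≤ 4 ^ s * (bracket a ^ (2 * d + 1 : ℝ) * (bracket b ^ s * bracket c ^ s)) := by
                gcongr; exact hθ _ hA1
            _ ≤ _ := by gcongr
        · have i1 : bracket b ^ s ≤ 4 ^ s * bracket a ^ s := by
            rw [← Real.mul_rpow (by norm_num) hA.le]; exact Real.rpow_le_rpow hB.le (by linarith) (by linarith)
          calc bracket b ^ s * bracket b ^ s ≤ (4 ^ s * bracket a ^ s) * bracket b ^ s := by gcongr
            _ = 4 ^ s * (1 * (bracket a ^ s * bracket b ^ s)) := by ring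
            _ ≤ 4 ^ s * (bracket c ^ (2 * d + 1 : ℝ) * (bracket a ^ s * bracket b ^ s)) := by
                gcongr; exact hθ _ hC1
            _ ≤ _ := by gcongr
      have h3 : |truncWt s M (bracket a) + truncWt s M (bracket b) + σ * truncWt s M (bracket c)| ≤ C₁ * X :=
        h1.trans (by rw [hC₁, mul_assoc]; gcongr)
      refine h3.trans ?_
      calc C₁ * X = C₁ / c₀ * 1 * X * c₀ := by field_simp
        _ ≤ (C₁ / c₀ + 1 + C₂ / γ + C₂) * K * X * |om a + om b + σ * om c| := by
            gcongr
            have : 0 ≤ 1 + C₂ / γ + C₂ := by positivity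
            linarith
    -- Here `⟨b⟩ > 4MN`: the cutoff annihilates `b` and its comparable partner. The surviving weight
    -- is at most `M^s ⟨·⟩^s`, and `M^s N ≤ ⟨b⟩^s` turns the excess into the gain `1/N`.
    · right
      have hMN : 0 < M * N := by positivity
      have hWB : truncWt s M (bracket b) = 0 := truncWt_eq_zero hM0 (by linarith)
      have hMNs : M ^ s * N ≤ bracket b ^ s := by
        have i1 : M ^ s * N ^ s ≤ bracket b ^ s := by
          rw [← Real.mul_rpow hM0.le hN0.le]
          exact Real.rpow_le_rpow hMN.le (by linarith) (by linarith)
        have i2 : N ≤ N ^ s := by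
          simpa using Real.rpow_le_rpow_of_exponent_le hN hs
        exact le_trans (by gcongr) i1
      have hone : ∀ x : ℝ, 0 < x → truncWt s M x ≤ M ^ s * x ^ s := by
        intro x hx
        rcases le_total M x with h | h
        · rw [truncWt_eq_zero hM0 h]; positivity
        · refine (truncWt_le hM0 hx.le).trans ?_
          rw [show 2 * s = s + s by ring, Real.rpow_add hx]
          gcongr
      have hfin : |truncWt s M (bracket a) + truncWt s M (bracket b) + σ * truncWt s M (bracket c)| * N ≤ X := by
        rcases hcomp with ⟨-, h⟩ | ⟨-, h⟩
        · have hWC : truncWt s M (bracket c) = 0 := truncWt_eq_zero hM0 (by linarith)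
          rw [hWB, hWC, mul_zero, add_zero, add_zero, abs_of_nonneg hWA0]
          calc truncWt s M (bracket a) * N ≤ M ^ s * bracket a ^ s * N := by gcongr; exact hone _ hA
            _ = bracket a ^ s * (M ^ s * N) := by ring
            _ ≤ bracket a ^ s * bracket b ^ s := by gcongr
            _ = 1 * (bracket a ^ s * bracket b ^ s) := by ring
            _ ≤ bracket c ^ (2 * d + 1 : ℝ) * (bracket a ^ s * bracket b ^ s) := by
                gcongr; exact hθ _ hC1
            _ ≤ _ := T3
        · have hWA : truncWt s M (bracket a) = 0 := truncWt_eq_zero hM0 (by linarith)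
          rw [hWB, hWA, zero_add, zero_add, abs_mul, hσ1, one_mul, abs_of_nonneg hWC0]
          calc truncWt s M (bracket c) * N ≤ M ^ s * bracket c ^ s * N := by gcongr; exact hone _ hC
            _ = (M ^ s * N) * bracket c ^ s := by ring
            _ ≤ bracket b ^ s * bracket c ^ s := by gcongr
            _ = 1 * (bracket b ^ s * bracket c ^ s) := by ring
            _ ≤ bracket a ^ (2 * d + 1 : ℝ) * (bracket b ^ s * bracket c ^ s) := by
                gcongr; exact hθ _ hA1
            _ ≤ _ := T1
      rw [le_div_iff₀ hN0]
      refine hfin.trans (le_mul_of_one_le_left hX0.le ?_)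
      have : 0 ≤ C₁ / c₀ + C₂ / γ + C₂ := by positivity
      linarith
  · push Not at hP
    obtain ⟨hσ', hbc⟩ := hP
    have hσm : σ = -1 := hσ.resolve_left hσ'
    have hB4C : bracket b ≤ 4 * bracket c := by
      rcases hcomp with ⟨-, h⟩ | ⟨h, -⟩
      · exact h
      · linarith
    have h1 : |truncWt s M (bracket a) + truncWt s M (bracket b) + σ * truncWt s M (bracket c)| ≤
        (1 + (2 * s + 1) * 2 ^ (2 * s - 1)) * (bracket a * bracket b ^ (2 * s - 1)) := by
      have i1 : truncWt s M (bracket a) ≤ bracket a * bracket b ^ (2 * s - 1) := by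
        refine (truncWt_le hM0 hA.le).trans ?_
        have e : bracket a ^ (2 * s) = bracket a * bracket a ^ (2 * s - 1) := by
          rw [mul_comm (bracket a), ← Real.rpow_add_one hA.ne']; ring_nf
        rw [e]
        gcongr
        linarith
      have i2 := abs_truncWt_sub_le hs hM0 hB hC
      have i3 : |bracket b - bracket c| ≤ bracket a := by
        have := abs_bracket_sub_le b (-c)
        rw [bracket_neg, show b - -c = -a by rw [hcab]; abel, elen_neg] at this
        exact this.trans (elen_le_bracket a)
      have i4 : max (bracket b) (bracket c) ^ (2 * s - 1) ≤ 2 ^ (2 * s - 1) * bracket b ^ (2 * s - 1) := by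
        rw [← Real.mul_rpow (by norm_num) hB.le]
        exact Real.rpow_le_rpow (le_max_of_le_left hB.le) (max_le (by linarith) hCAB) (by linarith)
      have i5 : |truncWt s M (bracket b) - truncWt s M (bracket c)| ≤
          (2 * s + 1) * (2 ^ (2 * s - 1) * bracket b ^ (2 * s - 1)) * bracket a :=
        i2.trans (by gcongr)
      rw [hσm, show truncWt s M (bracket a) + truncWt s M (bracket b) + -1 * truncWt s M (bracket c) =
        truncWt s M (bracket a) + (truncWt s M (bracket b) - truncWt s M (bracket c)) by ring]
      refine (abs_add_le _ _).trans ?_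
      rw [abs_of_nonneg hWA0]
      linarith
    have h2 : bracket a * bracket b ^ (2 * s - 1) ≤
        4 ^ s * (bracket a ^ (-(2 * d : ℝ)) * (bracket b)⁻¹ * X) := by
      have e1 : bracket a = bracket a ^ (-(2 * d : ℝ)) * bracket a ^ (2 * d + 1 : ℝ) := by
        rw [← Real.rpow_add hA]; norm_num
      have e2 : bracket b ^ (2 * s - 1) = (bracket b)⁻¹ * (bracket b ^ s * bracket b ^ s) := by
        rw [← Real.rpow_neg_one, ← Real.rpow_add hB, ← Real.rpow_add hB]; ring_nf
      have i1 : bracket b ^ s ≤ 4 ^ s * bracket c ^ s := by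
        rw [← Real.mul_rpow (by norm_num) hC.le]; exact Real.rpow_le_rpow hB.le hB4C (by linarith)
      calc bracket a * bracket b ^ (2 * s - 1)
          = (bracket a ^ (-(2 * d : ℝ)) * bracket a ^ (2 * d + 1 : ℝ)) *
              ((bracket b)⁻¹ * (bracket b ^ s * bracket b ^ s)) := by rw [← e1, e2]
        _ ≤ (bracket a ^ (-(2 * d : ℝ)) * bracket a ^ (2 * d + 1 : ℝ)) *
              ((bracket b)⁻¹ * (bracket b ^ s * (4 ^ s * bracket c ^ s))) := by gcongr
        _ = 4 ^ s * (bracket a ^ (-(2 * d : ℝ)) * (bracket b)⁻¹ *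
              (bracket a ^ (2 * d + 1 : ℝ) * (bracket b ^ s * bracket c ^ s))) := by ring
        _ ≤ _ := by gcongr
    have h3 : |truncWt s M (bracket a) + truncWt s M (bracket b) + σ * truncWt s M (bracket c)| ≤
        C₂ * (bracket a ^ (-(2 * d : ℝ)) * (bracket b)⁻¹ * X) :=
      h1.trans (by rw [hC₂, mul_assoc _ ((4:ℝ) ^ s)]; gcongr)
    rcases le_or_gt (bracket b) N with hBN | hBN
    · left
      refine ⟨?_, by linarith, by linarith, by linarith⟩
      -- The high frequency `b` takes the role carrying `resWt`, and the low one `a` pays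
      -- `⟨a⟩^{-2d}`. Together with one power of `⟨a⟩` from the commutator this explains the
      -- exponent `2d + 1` in `triWt`.
      have hsm := hom.small b a hb ha
      have e : om (b + a) = om c := by rw [hcab, hom.even, add_comm]
      rw [e, show om a + om b - om c = om a + om b + σ * om c by rw [hσm]; ring] at hsm
      set O := |om a + om b + σ * om c|
      have hl := one_le_logBr b
      have hl0 : 0 < logBr b := by linarith
      have hres : bracket a ^ (-(2 * d : ℝ)) * (bracket b)⁻¹ ≤ O / γ * K := by
        have i1 : (bracket b)⁻¹ = resWt b * (bracket b ^ ((d:ℝ) - 2) * logBr b ^ (5 / 4 : ℝ)) := by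
          unfold resWt
          rw [mul_mul_mul_comm, ← Real.rpow_add hB, ← Real.rpow_add hl0, ← Real.rpow_neg_one]
          norm_num
        have i2 : bracket b ^ ((d:ℝ) - 2) * logBr b ^ (5 / 4 : ℝ) ≤ K := by
          rw [hKdef, lossFac]
          have j1 : logBr b ≤ 1 + Real.log N := by
            unfold logBr; linarith [Real.log_le_log hB hBN]
          have j2 : bracket b ^ ((d:ℝ) - 2) ≤ N ^ ((d:ℝ) - 2) := Real.rpow_le_rpow hB.le hBN (by linarith)
          gcongr
        calc bracket a ^ (-(2 * d : ℝ)) * (bracket b)⁻¹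
            = (γ * (bracket a ^ (-(2 * d : ℝ)) * resWt b)) / γ *
              (bracket b ^ ((d:ℝ) - 2) * logBr b ^ (5 / 4 : ℝ)) := by
              rw [i1]; field_simp
          _ ≤ O / γ * K := by gcongr
      calc _ ≤ C₂ * (bracket a ^ (-(2 * d : ℝ)) * (bracket b)⁻¹ * X) := h3
        _ ≤ C₂ * (O / γ * K * X) := by gcongr
        _ = C₂ / γ * K * X * O := by ring
        _ ≤ _ := by
            gcongr
            have : 0 ≤ C₁ / c₀ + 1 + C₂ := by positivity
            linarith
    · right
      refine h3.trans ?_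
      rw [mul_div_assoc]
      have i1 : bracket a ^ (-(2 * d : ℝ)) ≤ 1 :=
        Real.rpow_le_one_of_one_le_of_nonpos hA1 (by linarith)
      calc C₂ * (bracket a ^ (-(2 * d : ℝ)) * (bracket b)⁻¹ * X) ≤ C₂ * (1 * N⁻¹ * X) := by gcongr
        _ = C₂ * (X / N) := by ring
        _ ≤ _ := by
            gcongr
            have : 0 ≤ C₁ / c₀ + 1 + C₂ / γ := by positivity
            linarith

/-- Indices `(σ, j)`: `(true, j)` stands for `w_j` and `(false, j)` for `conj w_{-j}`. -/
abbrev SFreq (d : ℕ) : Type := Bool × Freq d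

/-- The sign attached to an index. -/
def bsgn (σ : Bool) : ℝ := if σ then 1 else -1

lemma triWt_swap (θ s : ℝ) (a b c : Freq d) : triWt θ s b a c = triWt θ s a b c := by
  unfold triWt; ring

lemma triWt_rot (θ s : ℝ) (a b c : Freq d) : triWt θ s b c a = triWt θ s a b c := by
  unfold triWt; ring

lemma Dichotomy.swap {C N M s : ℝ} {a b c : Freq d} {k k' O O' : ℝ} (h : Dichotomy C N M s a b c k O)
    (hk : k' = k) (hO : O' = O) : Dichotomy C N M s b a c k' O' := by
  subst hk hO
  unfold Dichotomy at *
  rw [triWt_swap]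
  tauto

lemma Dichotomy.rot {C N M s : ℝ} {a b c : Freq d} {k k' O O' : ℝ} (h : Dichotomy C N M s a b c k O)
    (hk : k' = k) (hO : O' = O) : Dichotomy C N M s b c a k' O' := by
  subst hk hO
  unfold Dichotomy at *
  rw [triWt_rot]
  tauto

lemma Dichotomy.flip {C N M s : ℝ} {a b c : Freq d} {k k' O O' : ℝ} (h : Dichotomy C N M s a b c k O)
    (hk : k' = -k) (hO : O' = -O) : Dichotomy C N M s a b c k' O' := by
  subst hk hO
  unfold Dichotomy at *
  rwa [abs_neg, abs_neg]

/-- The three-wave dichotomy for arbitrary signs. -/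
theorem dichotomy (hd : 2 ≤ d) {c₀ γ : ℝ} {om : Freq d → ℝ} (hom : NonRes d c₀ γ om) {s : ℝ}
    (hs : 1 ≤ s) : ∃ C : ℝ, 0 < C ∧ ∀ (N M : ℝ) (x y z : SFreq d), 1 ≤ N → 1 ≤ M → x.2 ≠ 0 → y.2 ≠ 0 →
      z.2 ≠ 0 → x.2 + y.2 + z.2 = 0 →
      Dichotomy C N M s x.2 y.2 z.2
        (bsgn x.1 * truncWt s M (bracket x.2) + bsgn y.1 * truncWt s M (bracket y.2) +
          bsgn z.1 * truncWt s M (bracket z.2))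
        (bsgn x.1 * om x.2 + bsgn y.1 * om y.2 + bsgn z.1 * om z.2) := by
  obtain ⟨C, hC, H⟩ := dichotomy_sorted hd hom hs
  refine ⟨C, hC, ?_⟩
  -- first two signs positive
  have H1 : ∀ (N M : ℝ) (a b c : Freq d) (σ : ℝ), 1 ≤ N → 1 ≤ M → a ≠ 0 → b ≠ 0 → c ≠ 0 →
      a + b + c = 0 → (σ = 1 ∨ σ = -1) →
      Dichotomy C N M s a b c
        (truncWt s M (bracket a) + truncWt s M (bracket b) + σ * truncWt s M (bracket c))
        (om a + om b + σ * om c) := by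
    intro N M a b c σ hN hM ha hb hc habc hσ
    rcases le_total (elen a) (elen b) with h | h
    · exact H N M a b c σ hN hM ha hb hc habc h hσ
    · exact (H N M b a c σ hN hM hb ha hc (by rw [← habc]; abel) h hσ).swap (by ring) (by ring)
  -- first two signs equal
  have H2 : ∀ (N M : ℝ) (a b c : Freq d) (σ τ : Bool), 1 ≤ N → 1 ≤ M → a ≠ 0 → b ≠ 0 → c ≠ 0 →
      a + b + c = 0 →
      Dichotomy C N M s a b c
        (bsgn σ * truncWt s M (bracket a) + bsgn σ * truncWt s M (bracket b) + bsgn τ * truncWt s M (bracket c))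
        (bsgn σ * om a + bsgn σ * om b + bsgn τ * om c) := by
    intro N M a b c σ τ hN hM ha hb hc habc
    cases σ
    · refine (H1 N M a b c (-bsgn τ) hN hM ha hb hc habc ?_).flip ?_ ?_
      · cases τ <;> simp [bsgn]
      · simp [bsgn]; ring
      · simp [bsgn]; ring
    · have := H1 N M a b c (bsgn τ) hN hM ha hb hc habc (by cases τ <;> simp [bsgn])
      simpa [bsgn] using this
  rintro N M ⟨σ, a⟩ ⟨τ, b⟩ ⟨ρ, c⟩ hN hM ha hb hc habc
  simp only at ha hb hc habc ⊢
  by_cases h1 : σ = τ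
  · subst h1; exact H2 N M a b c σ ρ hN hM ha hb hc habc
  by_cases h2 : τ = ρ
  · subst h2
    have := H2 N M b c a τ σ hN hM hb hc ha (by rw [← habc]; abel)
    exact (this.rot rfl rfl).rot (by ring) (by ring)
  · have h3 : ρ = σ := by cases σ <;> cases τ <;> cases ρ <;> simp_all
    subst h3
    have := H2 N M c a b ρ τ hN hM hc ha hb (by rw [← habc]; abel)
    exact this.rot (by ring) (by ring)

end Triples

end QHD
end

/-! ### Nonresonance of `ω` and trilinear estimates -/

noncomputable section

namespace QHD

open scoped ENNReal ComplexConjugate Topology Pointwise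

section OmegaNonRes
variable {d : ℕ} {m κ : ℝ} {g : ℝ → ℝ}

lemma omega_eq_disp (hκ : 0 < κ) (ν : Fin d → ℝ) (j : Freq d) :
    omega ν m κ g j = disp (hbar κ / 2) (offDiag m κ g) (symbSq ν j) := by
  rw [omega, disp, ← hbar_mul_offDiag (g := g) (m := m) hκ]
  congr 1; ring

lemma disp_mono {c b q q' : ℝ} (hc : 0 < c) (hb : 0 < b) (hq : 0 ≤ q) (h : q ≤ q') :
    disp c b q ≤ disp c b q' := Real.sqrt_le_sqrt (by gcongr)

/-- Everything but the small divisors is elementary: `|j|_ν` lies between `|j|` and `2|j|`, so `4|j|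
≤ |k|` implies `|j|_ν ≤ |k|_ν`, and `ω` increases with `|j|_ν`. -/
theorem ae_nonRes (hd : 2 ≤ d) (hm : 0 < m) (hκ : 0 < κ) (hg : 0 < deriv g m) :
    ∀ᵐ ν : Fin d → ℝ ∂(volume.restrict (Set.Icc (fun _ => (1 : ℝ)) (fun _ => 2))),
      (∀ i, 1 ≤ ν i) ∧ (∀ i, ν i ≤ 2) ∧ ∃ γ, NonRes d (hbar κ / 2) γ (omega ν m κ g) := by
  have hc := half_pos (hbar_pos hκ)
  have hb := offDiag_pos hm hκ hg
  filter_upwards [ae_small_divisors (d := d) hd hc hb, ae_restrict_mem measurableSet_Icc] with ν h hν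
  have h1 : ∀ i, 1 ≤ ν i := fun i => hν.1 i
  have h2 : ∀ i, ν i ≤ 2 := fun i => hν.2 i
  refine ⟨h1, h2, ?_⟩
  obtain ⟨γ, hγ, H⟩ := h
  refine ⟨γ, hc, hγ, fun j hj => ?_, fun j k hjk => ?_, fun j => omega_neg .., fun j k hj hk => ?_⟩
  · exact le_trans (le_mul_of_one_le_right hc.le (one_le_symbSq h1 hj))
      (hbar_half_symbSq_le_omega hm hκ hg j)
  · rw [omega_eq_disp hκ, omega_eq_disp hκ]
    refine disp_mono hc hb (symbSq_nonneg j) ?_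
    have i1 := symbSq_le h1 h2 j
    have i2 := elen_sq_le_symbSq h1 k
    have i3 := elen_nonneg j
    nlinarith
  · rw [omega_eq_disp hκ, omega_eq_disp hκ, omega_eq_disp hκ]
    exact H j k hj hk

end OmegaNonRes

section Trilinear
variable {d : ℕ}

/-- One factor is measured in `ℓ¹`; for fixed `a` the other two are paired by Cauchy–Schwarz. -/
lemma tsum_tsum_mul_le (P Q R : Freq d → ℝ≥0∞) :
    ∑' a, ∑' b, P a * (Q b * R (-a - b)) ≤ (∑' a, P a) * (l2 Q * l2 R) := by
  rw [← ENNReal.tsum_mul_right]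
  refine ENNReal.tsum_le_tsum fun a => ?_
  rw [ENNReal.tsum_mul_left]
  gcongr
  refine (tsum_mul_le_l2 _ _).trans (le_of_eq ?_)
  rw [← l2_comp_equiv (Equiv.subLeft (-a)) R]
  rfl

/-- The three-wave form with weight `triWt`, in terms of weighted `ℓ²` norms. -/
lemma tsum_triWt_le {θ s : ℝ} (hθ : θ + d ≤ s) (U V W : Freq d → ℝ≥0∞) :
    ∑' a, ∑' b, ENNReal.ofReal (triWt θ s a b (-a - b)) * (U a * V b * W (-a - b)) ≤
      3 * wienerConst d * (l2 (fun a => wt s a * U a) * l2 (fun a => wt s a * V a) *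
        l2 (fun a => wt s a * W a)) := by
  -- The family carrying the weight of order `θ` goes to `ℓ¹`, at the price of `d` derivatives; this
  -- is where `θ + d ≤ s` enters.
  have hP : ∀ U : Freq d → ℝ≥0∞, ∑' a, wt θ a * U a ≤ wienerConst d * l2 (fun a => wt s a * U a) := by
    intro U
    have h1 : ∀ a, wt θ a * U a = wt (-d) a * (wt (θ + d) a * U a) := fun a => by
      rw [← mul_assoc, wt_mul_wt]; congr 2; ring
    simp only [h1]
    refine (tsum_mul_le_l2 _ _).trans ?_
    unfold wienerConst
    gcongr
    exact l2_mono fun a => by gcongr; exact wt_mono hθ a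
  have hX : ∀ a b c : Freq d, ENNReal.ofReal (triWt θ s a b c) =
      wt θ a * (wt s b * wt s c) + wt θ b * (wt s a * wt s c) + wt θ c * (wt s a * wt s b) := by
    intro a b c
    have ha := (bracket_pos a).le
    have hb := (bracket_pos b).le
    have hc := (bracket_pos c).le
    unfold triWt wt
    rw [ENNReal.ofReal_add (by positivity) (by positivity), ENNReal.ofReal_add (by positivity) (by positivity)]
    simp only [ENNReal.ofReal_mul, Real.rpow_nonneg, ha, hb, hc]
  set u := l2 (fun a => wt s a * U a)
  set v := l2 (fun a => wt s a * V a)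
  set w := l2 (fun a => wt s a * W a)
  have t1 : ∑' a, ∑' b, (wt θ a * U a) * ((wt s b * V b) * (wt s (-a - b) * W (-a - b))) ≤
      wienerConst d * u * (v * w) :=
    (tsum_tsum_mul_le _ (fun b => wt s b * V b) (fun b => wt s b * W b)).trans (by gcongr; exact hP U)
  have t2 : ∑' a, ∑' b, (wt θ b * V b) * ((wt s a * U a) * (wt s (-a - b) * W (-a - b))) ≤
      wienerConst d * v * (u * w) := by
    rw [ENNReal.tsum_comm]
    refine le_trans (le_of_eq ?_) ((tsum_tsum_mul_le (fun b => wt θ b * V b) (fun b => wt s b * U b)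
      (fun b => wt s b * W b)).trans (by gcongr; exact hP V))
    refine tsum_congr fun b => tsum_congr fun a => ?_
    rw [show -a - b = -b - a by abel]
  have t3 : ∑' a, ∑' b, (wt θ (-a - b) * W (-a - b)) * ((wt s a * U a) * (wt s b * V b)) ≤
      wienerConst d * w * (u * v) := by
    have e : ∀ a, ∑' b, (wt θ (-a - b) * W (-a - b)) * ((wt s a * U a) * (wt s b * V b)) =
        ∑' b, (wt θ b * W b) * ((wt s a * U a) * (wt s (-a - b) * V (-a - b))) := fun a => by
      rw [← (Equiv.subLeft (-a)).tsum_eq]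
      refine tsum_congr fun b => ?_
      simp only [Equiv.subLeft_apply, sub_sub_cancel]
    simp only [e]
    rw [ENNReal.tsum_comm]
    refine le_trans (le_of_eq ?_) ((tsum_tsum_mul_le (fun b => wt θ b * W b) (fun b => wt s b * U b)
      (fun b => wt s b * V b)).trans (by gcongr; exact hP W))
    refine tsum_congr fun b => tsum_congr fun a => ?_
    rw [show -a - b = -b - a by abel]
  have e : ∀ a b, ENNReal.ofReal (triWt θ s a b (-a - b)) * (U a * V b * W (-a - b)) =
      (wt θ a * U a) * ((wt s b * V b) * (wt s (-a - b) * W (-a - b))) +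
      (wt θ b * V b) * ((wt s a * U a) * (wt s (-a - b) * W (-a - b))) +
      (wt θ (-a - b) * W (-a - b)) * ((wt s a * U a) * (wt s b * V b)) := fun a b => by
    rw [hX]; ring
  simp only [e, ENNReal.tsum_add]
  refine (add_le_add (add_le_add t1 t2) t3).trans (le_of_eq ?_)
  ring

/-- Triples of signed frequencies. -/
abbrev Tri (d : ℕ) : Type := SFreq d × SFreq d × SFreq d

/-- Zero momentum. -/
def ZeroMom (p : Tri d) : Prop := p.1.2 + p.2.1.2 + p.2.2.2 = 0

instance (p : Tri d) : Decidable (ZeroMom p) := by unfold ZeroMom; infer_instance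

lemma tsum_sfreq_collapse (v : SFreq d → ℝ≥0∞) (f : Freq d → ℝ≥0∞) :
    ∑' x : SFreq d, f x.2 * v x = ∑' a, f a * (v (true, a) + v (false, a)) := by
  rw [ENNReal.tsum_prod', ENNReal.tsum_comm]
  refine tsum_congr fun a => ?_
  rw [tsum_bool]
  ring

/-- Summing over signs replaces each family by the sum of its two components, which at most doubles
each norm: `24 = 3 · 2³`. -/
lemma tsum_tri_le {θ s : ℝ} (hθ : θ + d ≤ s) {u v w : SFreq d → ℝ≥0∞} {e₁ e₂ e₃ : ℝ≥0∞}
    (hu : ∀ σ, l2 (fun a => wt s a * u (σ, a)) ≤ e₁) (hv : ∀ σ, l2 (fun a => wt s a * v (σ, a)) ≤ e₂)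
    (hw : ∀ σ, l2 (fun a => wt s a * w (σ, a)) ≤ e₃) :
    ∑' p : Tri d, (if ZeroMom p then ENNReal.ofReal (triWt θ s p.1.2 p.2.1.2 p.2.2.2) *
      (u p.1 * v p.2.1 * w p.2.2) else 0) ≤ 24 * wienerConst d * (e₁ * e₂ * e₃) := by
  let U : (SFreq d → ℝ≥0∞) → Freq d → ℝ≥0∞ := fun u a => u (true, a) + u (false, a)
  have hU : ∀ {u : SFreq d → ℝ≥0∞} {e : ℝ≥0∞}, (∀ σ, l2 (fun a => wt s a * u (σ, a)) ≤ e) →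
      l2 (fun a => wt s a * U u a) ≤ 2 * e := fun {u e} h => by
    have : (fun a => wt s a * U u a) = fun a => wt s a * u (true, a) + wt s a * u (false, a) := by
      ext a; simp only [U]; ring
    rw [this, two_mul]
    exact (l2_add_le _ _).trans (add_le_add (h _) (h _))
  have key : ∑' p : Tri d, (if ZeroMom p then ENNReal.ofReal (triWt θ s p.1.2 p.2.1.2 p.2.2.2) *
      (u p.1 * v p.2.1 * w p.2.2) else 0) =
      ∑' a, ∑' b, ENNReal.ofReal (triWt θ s a b (-a - b)) * (U u a * U v b * U w (-a - b)) := by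
    rw [ENNReal.tsum_prod']
    let h3 : Freq d → Freq d → ℝ≥0∞ := fun a b => ENNReal.ofReal (triWt θ s a b (-a - b)) * U w (-a - b)
    have e1 : ∀ x y : SFreq d, ∑' z : SFreq d, (if ZeroMom (x, y, z) then
        ENNReal.ofReal (triWt θ s x.2 y.2 z.2) * (u x * v y * w z) else 0) = u x * (v y * h3 x.2 y.2) := by
      intro x y
      have := tsum_sfreq_collapse w (fun c => if x.2 + y.2 + c = 0 then
        ENNReal.ofReal (triWt θ s x.2 y.2 c) * (u x * v y) else 0)
      rw [tsum_eq_single (-x.2 - y.2) (fun c hc => by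
        rw [if_neg (fun h => hc (by rw [← sub_eq_zero, ← h]; abel)), zero_mul])] at this
      rw [if_pos (by abel)] at this
      refine Eq.trans (tsum_congr fun z => ?_) (this.trans ?_)
      · by_cases h : x.2 + y.2 + z.2 = 0
        · rw [if_pos (show ZeroMom (x, y, z) from h), if_pos h]; ring
        · rw [if_neg (show ¬ ZeroMom (x, y, z) from h), if_neg h, zero_mul]
      · simp only [h3, U]; ring
    have e2 : ∀ x : SFreq d, ∑' q : SFreq d × SFreq d, (if ZeroMom (x, q) then
        ENNReal.ofReal (triWt θ s x.2 q.1.2 q.2.2) * (u x * v q.1 * w q.2) else 0) =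
        (∑' b, h3 x.2 b * U v b) * u x := by
      intro x
      rw [ENNReal.tsum_prod']
      simp only [e1]
      rw [ENNReal.tsum_mul_left, mul_comm]
      congr 1
      rw [← tsum_sfreq_collapse v (fun b => h3 x.2 b)]
      exact tsum_congr fun y => mul_comm _ _
    simp only [e2]
    rw [tsum_sfreq_collapse u (fun a => ∑' b, h3 a b * U v b)]
    refine tsum_congr fun a => ?_
    rw [← ENNReal.tsum_mul_right]
    refine tsum_congr fun b => ?_
    simp only [h3, U]; ring
  rw [key]
  refine (tsum_triWt_le hθ _ _ _).trans ?_
  refine (mul_le_mul_right (mul_le_mul' (mul_le_mul' (hU hu) (hU hv)) (hU hw)) _).trans (le_of_eq ?_)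
  ring

lemma summable_of_tsum_enorm_le {ι : Type*} {f : ι → ℂ} {B : ℝ} (hB : 0 ≤ B)
    (h : ∑' i, ‖f i‖ₑ ≤ ENNReal.ofReal B) : Summable f ∧ ‖∑' i, f i‖ ≤ B := by
  have h1 : ∑' i, ‖f i‖ₑ ≠ ⊤ := ne_top_of_le_ne_top ENNReal.ofReal_ne_top h
  have h2 : Summable fun i => ‖f i‖ := by simpa using ENNReal.summable_toReal h1
  refine ⟨h2.of_norm, (norm_tsum_le_tsum_norm h2).trans ?_⟩
  have h3 : ∑' i, ‖f i‖ₑ = ENNReal.ofReal (∑' i, ‖f i‖) := by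
    rw [ENNReal.ofReal_tsum_of_nonneg (fun i => norm_nonneg _) h2]
    exact tsum_congr fun i => (ofReal_norm _).symm
  rw [h3] at h
  exact (ENNReal.ofReal_le_ofReal_iff hB).1 h

end Trilinear

end QHD
end

/-! ### Sums over triples of signed frequencies -/

noncomputable section

namespace QHD

open scoped ENNReal ComplexConjugate Topology Pointwise

section TriSums
variable {d : ℕ}

/-- The constant of the three-wave estimates. -/
def triConst (d : ℕ) : ℝ := 24 * (wienerConst d).toReal

lemma triConst_nonneg : 0 ≤ triConst d := mul_nonneg (by norm_num) ENNReal.toReal_nonneg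

lemma triWt_nonneg (θ s : ℝ) (a b c : Freq d) : 0 ≤ triWt θ s a b c := by
  have ha := (bracket_pos a).le
  have hb := (bracket_pos b).le
  have hc := (bracket_pos c).le
  unfold triWt; positivity

lemma one_le_triWt {θ s : ℝ} (hθ : 0 ≤ θ) (hs : 0 ≤ s) (a b c : Freq d) : 1 ≤ triWt θ s a b c :=
  le_trans (one_le_mul_of_one_le_of_one_le (Real.one_le_rpow (one_le_bracket a) hθ)
    (one_le_mul_of_one_le_of_one_le (Real.one_le_rpow (one_le_bracket b) hs)
      (Real.one_le_rpow (one_le_bracket c) hs))) (triWt_terms θ s a b c).1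

/-- The weight evaluated at a triple of signed frequencies. -/
def triW (θ s : ℝ) (p : Tri d) : ℝ := triWt θ s p.1.2 p.2.1.2 p.2.2.2

/-- The product of three families at a triple. -/
def triProd (u v w : SFreq d → ℂ) (p : Tri d) : ℂ := u p.1 * v p.2.1 * w p.2.2

lemma tsum_tri_bound {θ s : ℝ} (hθ : θ + d ≤ s) {u v w : SFreq d → ℂ} {e₁ e₂ e₃ B : ℝ}
    (h₁ : 0 ≤ e₁) (h₂ : 0 ≤ e₂) (h₃ : 0 ≤ e₃) (hB : 0 ≤ B)
    (hu : ∀ σ, wl2 s (fun a => u (σ, a)) ≤ ENNReal.ofReal e₁)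
    (hv : ∀ σ, wl2 s (fun a => v (σ, a)) ≤ ENNReal.ofReal e₂)
    (hw : ∀ σ, wl2 s (fun a => w (σ, a)) ≤ ENNReal.ofReal e₃) {f : Tri d → ℂ}
    (hf0 : ∀ p, ¬ ZeroMom p → f p = 0)
    (hf : ∀ p, ZeroMom p → ‖f p‖ ≤ B * triW θ s p * ‖triProd u v w p‖) :
    Summable f ∧ ‖∑' p, f p‖ ≤ triConst d * B * (e₁ * e₂ * e₃) := by
  refine summable_of_tsum_enorm_le
    (mul_nonneg (mul_nonneg triConst_nonneg hB) (by positivity)) ?_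
  have key := tsum_tri_le hθ (u := fun x => ‖u x‖ₑ) (v := fun x => ‖v x‖ₑ) (w := fun x => ‖w x‖ₑ) hu hv hw
  have e : ENNReal.ofReal (triConst d * B * (e₁ * e₂ * e₃)) = ENNReal.ofReal B * (24 * wienerConst d *
      (ENNReal.ofReal e₁ * ENNReal.ofReal e₂ * ENNReal.ofReal e₃)) := by
    rw [ENNReal.ofReal_mul (mul_nonneg triConst_nonneg hB), ENNReal.ofReal_mul triConst_nonneg,
      ENNReal.ofReal_mul (by positivity), ENNReal.ofReal_mul h₁, triConst, ENNReal.ofReal_mul (by norm_num),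
      ENNReal.ofReal_toReal wienerConst_ne_top]
    norm_num
    ring
  rw [e]
  refine le_trans ?_ (mul_le_mul_right key _)
  rw [← ENNReal.tsum_mul_left]
  refine ENNReal.tsum_le_tsum fun p => ?_
  by_cases hp : ZeroMom p
  · rw [if_pos hp, ← enorm_mul, ← enorm_mul, ← ofReal_norm, ← ofReal_norm, ← ENNReal.ofReal_mul (triWt_nonneg ..),
      ← ENNReal.ofReal_mul hB]
    refine ENNReal.ofReal_le_ofReal ((hf p hp).trans (le_of_eq ?_))
    rw [mul_assoc]; rfl
  · simp [hf0 p hp]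

lemma sum_tri_bound {θ s : ℝ} (hθ : θ + d ≤ s) {u v w : SFreq d → ℂ} {e₁ e₂ e₃ B : ℝ}
    (h₁ : 0 ≤ e₁) (h₂ : 0 ≤ e₂) (h₃ : 0 ≤ e₃) (hB : 0 ≤ B)
    (hu : ∀ σ, wl2 s (fun a => u (σ, a)) ≤ ENNReal.ofReal e₁)
    (hv : ∀ σ, wl2 s (fun a => v (σ, a)) ≤ ENNReal.ofReal e₂)
    (hw : ∀ σ, wl2 s (fun a => w (σ, a)) ≤ ENNReal.ofReal e₃) {S : Finset (Tri d)} {G : Tri d → ℂ}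
    (hS : ∀ p ∈ S, ZeroMom p ∧ ‖G p‖ ≤ B * triW θ s p) :
    ‖∑ p ∈ S, G p * triProd u v w p‖ ≤ triConst d * B * (e₁ * e₂ * e₃) := by
  classical
  have h := (tsum_tri_bound hθ h₁ h₂ h₃ hB hu hv hw (f := fun p => if p ∈ S then G p * triProd u v w p else 0)
    (fun p hp => if_neg fun h => hp (hS p h).1) (fun p hp => ?_)).2
  · have e : ∑' p, (if p ∈ S then G p * triProd u v w p else 0) = ∑ p ∈ S, G p * triProd u v w p :=
      (tsum_eq_sum (s := S) fun p hp => if_neg hp).trans (Finset.sum_congr rfl fun p hp => if_pos hp)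
    rwa [e] at h
  · split_ifs with h
    · rw [norm_mul]; gcongr; exact (hS p h).2
    · rw [norm_zero]; exact mul_nonneg (mul_nonneg hB (triWt_nonneg ..)) (norm_nonneg _)

/-- Conjugate index. -/
def barx (x : SFreq d) : SFreq d := (!x.1, -x.2)

lemma barx_barx (x : SFreq d) : barx (barx x) = x := by simp [barx]

lemma bsgn_not (σ : Bool) : bsgn (!σ) = -bsgn σ := by cases σ <;> simp [bsgn]

lemma abs_bsgn (σ : Bool) : |bsgn σ| = 1 := by cases σ <;> simp [bsgn]

/-- Bounded cyclically symmetric interaction coefficients. -/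
structure SymCoef (d : ℕ) (CH : ℝ) (H : Tri d → ℝ) : Prop where
  nonneg : 0 ≤ CH
  bound : ∀ p, |H p| ≤ CH
  rot : ∀ x y z, H (y, z, x) = H (x, y, z)

/-- The cubic density. -/
def cubDens (H : Tri d → ℝ) (u : SFreq d → ℂ) (p : Tri d) : ℂ :=
  if ZeroMom p then (H p : ℂ) * triProd u u u p else 0

/-- The quadratic vector field with interaction coefficients `H`. -/
def quadN (H : Tri d → ℝ) (u : SFreq d → ℂ) (x : SFreq d) : ℂ :=
  ∑' q : SFreq d × SFreq d, if ZeroMom (barx x, q) then (H (barx x, q) : ℂ) * (u q.1 * u q.2) else 0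

lemma cubDens_bound {CH : ℝ} {H : Tri d → ℝ} (hH : SymCoef d CH H) {s : ℝ}
    {u : SFreq d → ℂ} {ε : ℝ} (hε : 0 ≤ ε) (hu : ∀ σ, wl2 s (fun a => u (σ, a)) ≤ ENNReal.ofReal ε)
    {c : Tri d → ℝ} {B : ℝ} (hB : 0 ≤ B) {θ : ℝ} (hθ : θ + d ≤ s)
    (hc : ∀ p, ZeroMom p → triProd u u u p ≠ 0 → |c p| ≤ B * triW θ s p) :
    Summable (fun p => (c p : ℂ) * cubDens H u p) ∧
      ‖∑' p, (c p : ℂ) * cubDens H u p‖ ≤ triConst d * (B * CH) * (ε * ε * ε) := by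
  refine tsum_tri_bound hθ hε hε hε (mul_nonneg hB hH.nonneg) hu hu hu (fun p hp => ?_) fun p hp => ?_
  · rw [cubDens, if_neg hp, mul_zero]
  · rw [cubDens, if_pos hp]
    by_cases h0 : triProd u u u p = 0
    · simp [h0]
    rw [← mul_assoc, norm_mul, norm_mul, Complex.norm_real, Complex.norm_real, Real.norm_eq_abs, Real.norm_eq_abs]
    refine mul_le_mul_of_nonneg_right ?_ (norm_nonneg _)
    calc |c p| * |H p| ≤ (B * triW θ s p) * CH :=
          mul_le_mul (hc p hp h0) (hH.bound p) (abs_nonneg _) (mul_nonneg hB (triWt_nonneg ..))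
      _ = _ := by ring

/-- Symmetrization of the cubic sums. -/
lemma tsum_symm {CH : ℝ} {H : Tri d → ℝ} (hH : SymCoef d CH H) {s : ℝ} (hs : 2 * d ≤ s)
    {u : SFreq d → ℂ} {ε : ℝ} (hε : 0 ≤ ε) (hu : ∀ σ, wl2 s (fun a => u (σ, a)) ≤ ENNReal.ofReal ε)
    {c : SFreq d → ℝ} {B : ℝ} (hB : 0 ≤ B) (hc : ∀ x, |c x| ≤ B) :
    ∑' p : Tri d, ((c p.1 + c p.2.1 + c p.2.2 : ℝ) : ℂ) * cubDens H u p =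
      3 * ∑' p : Tri d, (c p.1 : ℂ) * cubDens H u p := by
  have hs0 : 0 ≤ s := le_trans (by positivity) hs
  have hd0 : (0:ℝ) ≤ d := Nat.cast_nonneg d
  have hsum : ∀ f : Tri d → SFreq d, Summable fun p => (c (f p) : ℂ) * cubDens H u p := fun f =>
    (cubDens_bound hH hε hu (c := fun p => c (f p)) hB (θ := 0) (by linarith) fun p _ _ =>
      (hc _).trans (le_mul_of_one_le_right hB (one_le_triWt le_rfl hs0 _ _ _))).1
  -- Cyclic invariance is enough: one or two rotations bring any slot of the triple to the first
  -- place.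
  let e₁ : Tri d ≃ Tri d :=
    { toFun := fun p => (p.2.1, p.2.2, p.1)
      invFun := fun p => (p.2.2, p.1, p.2.1)
      left_inv := fun _ => rfl
      right_inv := fun _ => rfl }
  have hz : ∀ p, ZeroMom (e₁ p) ↔ ZeroMom p := fun p => by
    simp only [ZeroMom, e₁, Equiv.coe_fn_mk]
    rw [show p.2.1.2 + p.2.2.2 + p.1.2 = p.1.2 + p.2.1.2 + p.2.2.2 by abel]
  have hcub : ∀ p, cubDens H u (e₁ p) = cubDens H u p := fun p => by
    unfold cubDens
    by_cases h : ZeroMom p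
    · rw [if_pos h, if_pos ((hz p).2 h)]
      congr 1
      · exact_mod_cast hH.rot p.1 p.2.1 p.2.2
      · simp only [triProd, e₁, Equiv.coe_fn_mk]; ring
    · rw [if_neg h, if_neg (fun h' => h ((hz p).1 h'))]
  have h1 : ∑' p : Tri d, (c p.2.1 : ℂ) * cubDens H u p = ∑' p : Tri d, (c p.1 : ℂ) * cubDens H u p := by
    rw [← e₁.tsum_eq (fun p => (c p.1 : ℂ) * cubDens H u p)]
    exact tsum_congr fun p => by rw [hcub]; rfl
  have h2 : ∑' p : Tri d, (c p.2.2 : ℂ) * cubDens H u p = ∑' p : Tri d, (c p.1 : ℂ) * cubDens H u p := by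
    rw [← h1, ← e₁.tsum_eq (fun p => (c p.2.1 : ℂ) * cubDens H u p)]
    exact tsum_congr fun p => by rw [hcub]; rfl
  have h3 : ∀ p : Tri d, ((c p.1 + c p.2.1 + c p.2.2 : ℝ) : ℂ) * cubDens H u p =
      (c p.1 : ℂ) * cubDens H u p + (c p.2.1 : ℂ) * cubDens H u p + (c p.2.2 : ℂ) * cubDens H u p := fun p => by
    push_cast; ring
  simp only [h3]
  rw [((hsum _).add (hsum _)).tsum_add (hsum _), (hsum _).tsum_add (hsum _), h1, h2]
  ring

/-- `quadN` at `barx x` runs over the pairs that complete `x` to a triple of zero momentum, so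
pairing with `u x` rebuilds the cubic density. The finite set `F` loses nothing, since `c x * u x`
vanishes outside it. -/
lemma sum_quadN {CH : ℝ} {H : Tri d → ℝ} (hH : SymCoef d CH H) {s : ℝ} (hs : 2 * d ≤ s)
    {u : SFreq d → ℂ} {ε : ℝ} (hε : 0 ≤ ε) (hu : ∀ σ, wl2 s (fun a => u (σ, a)) ≤ ENNReal.ofReal ε)
    {c : SFreq d → ℝ} {B : ℝ} (hB : 0 ≤ B) (hc : ∀ x, |c x| ≤ B) {F : Finset (SFreq d)}
    (hF : ∀ x, x ∉ F → (c x : ℂ) * u x = 0) :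
    ∑ x ∈ F, (c x : ℂ) * (u x * quadN H u (barx x)) = ∑' p : Tri d, (c p.1 : ℂ) * cubDens H u p := by
  have hs0 : 0 ≤ s := le_trans (by positivity) hs
  have hd0 : (0:ℝ) ≤ d := Nat.cast_nonneg d
  have hsum : Summable fun p : Tri d => (c p.1 : ℂ) * cubDens H u p :=
    (cubDens_bound hH hε hu (c := fun p => c p.1) hB (θ := 0) (by linarith) fun p _ _ =>
      (hc _).trans (le_mul_of_one_le_right hB (one_le_triWt le_rfl hs0 _ _ _))).1
  have h1 : ∀ x : SFreq d, ∑' q, (c x : ℂ) * cubDens H u (x, q) = (c x : ℂ) * (u x * quadN H u (barx x)) := by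
    intro x
    rw [quadN, barx_barx, ← tsum_mul_left, ← tsum_mul_left]
    refine tsum_congr fun q => ?_
    rw [cubDens]
    split_ifs
    · simp only [triProd]; ring
    · ring
  rw [hsum.tsum_prod, tsum_eq_sum (s := F)]
  · exact Finset.sum_congr rfl fun x _ => (h1 x).symm
  · intro x hx
    rw [h1, ← mul_assoc, hF x hx, zero_mul]

end TriSums

section Finite
variable {d : ℕ}

lemma finite_bracket_le (R : ℝ) : {x : SFreq d | bracket x.2 ≤ R}.Finite := by
  have h : {j : Freq d | bracket j ≤ R}.Finite := by
    refine (Set.finite_Icc (fun _ : Fin d => -⌈R⌉) (fun _ => ⌈R⌉)).subset fun j hj => ?_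
    have h1 : ∀ i, |(j i : ℝ)| ≤ ⌈R⌉ := fun i =>
      (abs_coord_le_elen j i).trans ((elen_le_bracket j).trans (le_trans hj (Int.le_ceil R)))
    refine ⟨fun i => ?_, fun i => ?_⟩
    · have := (abs_le.1 (h1 i)).1; exact_mod_cast this
    · have := (abs_le.1 (h1 i)).2; exact_mod_cast this
  exact (Set.finite_univ.prod h).subset fun x hx => ⟨Set.mem_univ _, hx⟩

/-- Nonzero signed frequencies in a ball. -/
def ballF (d : ℕ) (R : ℝ) : Finset (SFreq d) := by
  classical exact (finite_bracket_le R).toFinset.filter fun x => x.2 ≠ 0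

lemma mem_ballF {R : ℝ} {x : SFreq d} : x ∈ ballF d R ↔ bracket x.2 ≤ R ∧ x.2 ≠ 0 := by
  simp [ballF]

lemma sum_ballF_barx {R : ℝ} (f : SFreq d → ℂ) : ∑ x ∈ ballF d R, f (barx x) = ∑ x ∈ ballF d R, f x := by
  have hm : ∀ x ∈ ballF d R, barx x ∈ ballF d R := fun x hx => by
    rw [mem_ballF] at hx ⊢
    simpa [barx, bracket_neg] using hx
  exact Finset.sum_nbij' barx barx hm hm (fun x _ => barx_barx x) (fun x _ => barx_barx x) fun _ _ => rfl

end Finite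

end QHD
end

/-! ### The modified energy -/

noncomputable section

namespace QHD

open scoped ENNReal ComplexConjugate Topology Pointwise

section Energy
variable {d : ℕ}

/-- The truncated weight at a signed frequency. -/
def twt (s M : ℝ) (x : SFreq d) : ℝ := truncWt s M (bracket x.2)

/-- The truncated quadratic energy. -/
def energy (s M : ℝ) (u : SFreq d → ℂ) : ℝ := ∑ x ∈ ballF d M, twt s M x / 2 * ‖u x‖ ^ 2

lemma twt_barx (s M : ℝ) (x : SFreq d) : twt s M (barx x) = twt s M x := by
  simp [twt, barx, bracket_neg]

lemma twt_nonneg (s M : ℝ) (x : SFreq d) : 0 ≤ twt s M x := truncWt_nonneg (bracket_pos _).le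

lemma twt_le {s M : ℝ} (hs : 0 ≤ s) (hM : 0 < M) (x : SFreq d) : twt s M x ≤ M ^ (2 * s) := by
  rcases le_total M (bracket x.2) with h | h
  · rw [twt, truncWt_eq_zero hM h]; positivity
  · exact (truncWt_le hM (bracket_pos _).le).trans
      (Real.rpow_le_rpow (bracket_pos _).le h (by linarith))

/-- The commutator of the energy weight along a triple. -/
def kapT (s M : ℝ) (p : Tri d) : ℝ :=
  bsgn p.1.1 * twt s M p.1 + bsgn p.2.1.1 * twt s M p.2.1 + bsgn p.2.2.1 * twt s M p.2.2

/-- The resonance function along a triple. -/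
def omT (om : Freq d → ℝ) (p : Tri d) : ℝ :=
  bsgn p.1.1 * om p.1.2 + bsgn p.2.1.1 * om p.2.1.2 + bsgn p.2.2.1 * om p.2.2.2

/-- The indices `x` and `barx x` have opposite signs and the same `ω`, so the linear parts cancel,
while the two nonlinear terms coincide after relabelling and remove the factor `1/2`. -/
lemma hasDerivWithinAt_quadratic {om : Freq d → ℝ} (heven : ∀ j, om (-j) = om j) {s M T t : ℝ}
    {u Nl : ℝ → SFreq d → ℂ}
    (hder : ∀ x : SFreq d, x.2 ≠ 0 → HasDerivWithinAt (fun τ => u τ x)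
      (-(Complex.I * bsgn x.1) * (om x.2 * u t x + Nl t x)) (Set.Ico 0 T) t) :
    HasDerivWithinAt (fun τ => ∑ x ∈ ballF d M, ((twt s M x / 2 : ℝ) : ℂ) * (u τ x * u τ (barx x)))
      (Complex.I * ∑ x ∈ ballF d M, ((bsgn x.1 * twt s M x : ℝ) : ℂ) * (u t x * Nl t (barx x)))
      (Set.Ico 0 T) t := by
  have h1 : HasDerivWithinAt (fun τ => ∑ x ∈ ballF d M, ((twt s M x / 2 : ℝ) : ℂ) * (u τ x * u τ (barx x)))
      (∑ x ∈ ballF d M, ((twt s M x / 2 : ℝ) : ℂ) *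
        ((-(Complex.I * bsgn x.1) * (om x.2 * u t x + Nl t x)) * u t (barx x) +
        u t x * (-(Complex.I * bsgn (barx x).1) * (om (barx x).2 * u t (barx x) + Nl t (barx x)))))
      (Set.Ico 0 T) t := by
    refine HasDerivWithinAt.fun_sum fun x hx => ?_
    have hx0 := (mem_ballF.1 hx).2
    exact ((hder x hx0).mul (hder (barx x) (by simpa [barx] using hx0))).const_mul _
  convert h1 using 1
  have h2 : ∀ x : SFreq d, ((twt s M x / 2 : ℝ) : ℂ) *
        ((-(Complex.I * bsgn x.1) * (om x.2 * u t x + Nl t x)) * u t (barx x) +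
        u t x * (-(Complex.I * bsgn (barx x).1) * (om (barx x).2 * u t (barx x) + Nl t (barx x)))) =
      (fun y => Complex.I / 2 * (((bsgn y.1 * twt s M y : ℝ) : ℂ) * (u t y * Nl t (barx y)))) (barx x) +
      Complex.I / 2 * (((bsgn x.1 * twt s M x : ℝ) : ℂ) * (u t x * Nl t (barx x))) := by
    intro x
    simp only [barx_barx, twt_barx]
    simp only [barx, bsgn_not, heven]
    push_cast
    ring
  have h3 := sum_ballF_barx (R := M)
    (fun y => Complex.I / 2 * (((bsgn y.1 * twt s M y : ℝ) : ℂ) * (u t y * Nl t (barx y))))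
  rw [Finset.sum_congr rfl fun x _ => h2 x, Finset.sum_add_distrib, h3, ← Finset.sum_add_distrib,
    Finset.mul_sum]
  refine Finset.sum_congr rfl fun x _ => ?_
  ring

/-- The linear parts of the three factors add up to the resonance function `omT`; this is the term
designed to cancel the cubic part of the derivative of the quadratic energy. -/
lemma hasDerivWithinAt_cubic {om : Freq d → ℝ} {T t : ℝ} {u Nl : ℝ → SFreq d → ℂ}
    (hder : ∀ x : SFreq d, x.2 ≠ 0 → HasDerivWithinAt (fun τ => u τ x)
      (-(Complex.I * bsgn x.1) * (om x.2 * u t x + Nl t x)) (Set.Ico 0 T) t)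
    {S : Finset (Tri d)} (hS : ∀ p ∈ S, p.1.2 ≠ 0 ∧ p.2.1.2 ≠ 0 ∧ p.2.2.2 ≠ 0) (a : Tri d → ℂ) :
    HasDerivWithinAt (fun τ => ∑ p ∈ S, a p * triProd (u τ) (u τ) (u τ) p)
      (-Complex.I * (∑ p ∈ S, a p * omT om p * triProd (u t) (u t) (u t) p +
        (∑ p ∈ S, (a p * bsgn p.1.1) * triProd (Nl t) (u t) (u t) p +
        ∑ p ∈ S, (a p * bsgn p.2.1.1) * triProd (u t) (Nl t) (u t) p +
        ∑ p ∈ S, (a p * bsgn p.2.2.1) * triProd (u t) (u t) (Nl t) p))) (Set.Ico 0 T) t := by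
  have h1 := HasDerivWithinAt.fun_sum (u := S) (s := Set.Ico 0 T) (x := t)
    (A := fun p τ => a p * triProd (u τ) (u τ) (u τ) p) fun p hp =>
      (((hder p.1 (hS p hp).1).mul (hder p.2.1 (hS p hp).2.1)).mul (hder p.2.2 (hS p hp).2.2)).const_mul (a p)
  refine h1.congr_deriv ?_
  rw [← Finset.sum_add_distrib, ← Finset.sum_add_distrib, ← Finset.sum_add_distrib, Finset.mul_sum]
  refine Finset.sum_congr rfl fun p _ => ?_
  simp only [triProd, omT, Pi.mul_apply]
  push_cast
  ring

/-- The weight is at most `⟨j⟩^{2s}`, which is shared equally between the two factors of a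
Cauchy–Schwarz inequality; the `2` counts the signs. -/
lemma sum_weight_mul_le {s M : ℝ} (hM : 0 < M) {u r : SFreq d → ℂ} {e₁ e₂ : ℝ} (h₁ : 0 ≤ e₁)
    (h₂ : 0 ≤ e₂)
    (hu : ∀ σ, wl2 s (fun a => u (σ, a)) ≤ ENNReal.ofReal e₁)
    (hr : ∀ σ, wl2 s (fun a => r (σ, a)) ≤ ENNReal.ofReal e₂) (F : Finset (SFreq d)) :
    ‖∑ x ∈ F, ((bsgn x.1 * twt s M x : ℝ) : ℂ) * (u x * r (barx x))‖ ≤ 2 * (e₁ * e₂) := by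
  have h1 : ∑' x : SFreq d, (wt s x.2 * ‖u x‖ₑ) * (wt s x.2 * ‖r (barx x)‖ₑ) ≤ ENNReal.ofReal (2 * (e₁ * e₂)) := by
    rw [ENNReal.tsum_prod', tsum_bool]
    have h2 : ∀ σ, ∑' a, (wt s a * ‖u (σ, a)‖ₑ) * (wt s a * ‖r (barx (σ, a))‖ₑ) ≤ ENNReal.ofReal (e₁ * e₂) := fun σ => by
      refine (tsum_mul_le_l2 _ _).trans ?_
      rw [ENNReal.ofReal_mul h₁]
      refine mul_le_mul' (hu σ) (le_trans (le_of_eq ?_) (hr (!σ)))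
      rw [wl2, ← l2_comp_equiv (Equiv.neg (Freq d))]
      congr 1; ext a
      simp only [Equiv.neg_apply, wt_neg, barx, neg_neg]
    rw [two_mul, ENNReal.ofReal_add (by positivity) (by positivity)]
    exact add_le_add (h2 _) (h2 _)
  refine (norm_sum_le _ _).trans ?_
  refine (ENNReal.ofReal_le_ofReal_iff (by positivity)).1 (le_trans ?_ h1)
  rw [ENNReal.ofReal_sum_of_nonneg fun _ _ => norm_nonneg _]
  refine le_trans (Finset.sum_le_sum fun x _ => ?_) (ENNReal.sum_le_tsum F)
  have hb := (bracket_pos x.2)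
  rw [mul_mul_mul_comm, wt_mul_wt, wt, ← enorm_mul, ← ofReal_norm, ← ENNReal.ofReal_mul (Real.rpow_nonneg hb.le _)]
  refine ENNReal.ofReal_le_ofReal ?_
  rw [norm_mul, Complex.norm_real, Real.norm_eq_abs, abs_mul, abs_bsgn, one_mul, abs_of_nonneg (twt_nonneg ..)]
  refine mul_le_mul_of_nonneg_right ?_ (norm_nonneg _)
  rw [← two_mul]
  exact truncWt_le hM hb.le

set_option maxHeartbeats 1000000 in
/-- The modified energy estimate for three-wave systems. -/
theorem energy_estimate (hd : 2 ≤ d) {c₀ γ : ℝ} {om : Freq d → ℝ} (hom : NonRes d c₀ γ om) {s : ℝ}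
    (hs : 3 * d + 1 ≤ s) {CH : ℝ} {H : Tri d → ℝ} (hH : SymCoef d CH H) {B : ℝ} (hB : 0 ≤ B) :
    ∃ C : ℝ, 0 < C ∧ ∀ (ε N M T : ℝ) (u Nl R : ℝ → SFreq d → ℂ), 0 ≤ ε → 1 ≤ N → 1 ≤ M →
      (∀ t ∈ Set.Ico 0 T, ∀ x, u t (barx x) = conj (u t x)) →
      (∀ t ∈ Set.Ico 0 T, ∀ x : SFreq d, x.2 = 0 → u t x = 0) →
      (∀ t ∈ Set.Ico 0 T, ∀ x : SFreq d, x.2 ≠ 0 → HasDerivWithinAt (fun τ => u τ x)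
        (-(Complex.I * bsgn x.1) * (om x.2 * u t x + Nl t x)) (Set.Ico 0 T) t) →
      (∀ t ∈ Set.Ico 0 T, ∀ x : SFreq d, x.2 ≠ 0 → Nl t x = quadN H (u t) x + R t x) →
      (∀ t ∈ Set.Ico 0 T, ∀ σ, wl2 s (fun a => u t (σ, a)) ≤ ENNReal.ofReal ε) →
      (∀ t ∈ Set.Ico 0 T, ∀ σ, wl2 s (fun a => Nl t (σ, a)) ≤ ENNReal.ofReal (B * ε ^ 2)) →
      (∀ t ∈ Set.Ico 0 T, ∀ σ, wl2 s (fun a => R t (σ, a)) ≤ ENNReal.ofReal (B * ε ^ 3)) →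
      ∀ t ∈ Set.Ico 0 T, energy s M (u t) ≤ energy s M (u 0) +
        C * (lossFac d N * ε ^ 3 + T * (ε ^ 3 / N + lossFac d N * ε ^ 4)) := by
  classical
  have hd0 : (2:ℝ) ≤ d := by exact_mod_cast hd
  have hs1 : 1 ≤ s := by linarith
  have hs0 : 0 ≤ s := by linarith
  have hs2 : 2 * (d:ℝ) ≤ s := by linarith
  have hθ : (2 * d + 1 : ℝ) + d ≤ s := by linarith
  obtain ⟨C₀, hC₀, hdich⟩ := dichotomy hd hom hs1
  set A := triConst d * (C₀ * CH) with hA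
  have hA0 : 0 ≤ A := mul_nonneg triConst_nonneg (mul_nonneg hC₀.le hH.nonneg)
  refine ⟨2 * A + A * B + 2 * B + 1, by positivity, ?_⟩
  intro ε N M T u Nl R hε hN hM hbar hzero hder hNl hu hNlb hR t ht
  have hN0 : 0 < N := by linarith
  have hM0 : 0 < M := by linarith
  set K := lossFac d N with hK
  have hK1 : 1 ≤ K := one_le_lossFac hd hN
  have h0T : (0:ℝ) ∈ Set.Ico 0 T := ⟨le_rfl, ht.1.trans_lt ht.2⟩
  -- The triples to be removed: those of the first alternative of `dichotomy`. The frequency bound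
  -- `8MN` makes the set finite, so the correction may be differentiated term by term.
  set S : Finset (Tri d) := (ballF d (8 * M * N) ×ˢ (ballF d (8 * M * N) ×ˢ ballF d (8 * M * N))).filter
    fun p => ZeroMom p ∧ |kapT s M p| ≤ C₀ * K * triW (2 * d + 1) s p * |omT om p| with hSdef
  have hSmem : ∀ p, p ∈ S ↔ ((bracket p.1.2 ≤ 8 * M * N ∧ p.1.2 ≠ 0) ∧ (bracket p.2.1.2 ≤ 8 * M * N ∧ p.2.1.2 ≠ 0) ∧
      (bracket p.2.2.2 ≤ 8 * M * N ∧ p.2.2.2 ≠ 0)) ∧ ZeroMom p ∧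
      |kapT s M p| ≤ C₀ * K * triW (2 * d + 1) s p * |omT om p| := fun p => by
    simp only [hSdef, Finset.mem_filter, Finset.mem_product, mem_ballF]
  -- The coefficient `κ H / (3Ω)`; the `1/3` matches the symmetrization factor in `tsum_symm`.
  let a : Tri d → ℂ := fun p => ((kapT s M p / omT om p * H p / 3 : ℝ) : ℂ)
  have hanorm : ∀ p ∈ S, ‖a p‖ ≤ C₀ * CH * K / 3 * triW (2 * d + 1) s p := by
    intro p hp
    have h1 := ((hSmem p).1 hp).2.2
    have hX : 0 ≤ triW (2 * d + 1) s p := triWt_nonneg ..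
    have h2 : |kapT s M p / omT om p| ≤ C₀ * K * triW (2 * d + 1) s p := by
      rw [abs_div]
      exact div_le_of_le_mul₀ (abs_nonneg _) (by positivity) h1
    simp only [a]
    rw [Complex.norm_real, Real.norm_eq_abs, abs_div, abs_mul, abs_of_pos (by norm_num : (0:ℝ) < 3)]
    calc |kapT s M p / omT om p| * |H p| / 3 ≤ (C₀ * K * triW (2 * d + 1) s p) * CH / 3 := by
          gcongr; exact hH.bound p
      _ = _ := by ring
  have hB' : 0 ≤ C₀ * CH * K / 3 := by have := hH.nonneg; positivity
  let E₂ : ℝ → ℂ := fun τ => ∑ x ∈ ballF d M, ((twt s M x / 2 : ℝ) : ℂ) * (u τ x * u τ (barx x))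
  let E₃ : ℝ → ℂ := fun τ => ∑ p ∈ S, a p * triProd (u τ) (u τ) (u τ) p
  have hE₂ : ∀ τ ∈ Set.Ico 0 T, E₂ τ = (energy s M (u τ) : ℂ) := by
    intro τ hτ
    simp only [E₂, energy]
    rw [Complex.ofReal_sum]
    refine Finset.sum_congr rfl fun x _ => ?_
    rw [hbar τ hτ x, Complex.mul_conj, Complex.normSq_eq_norm_sq]
    push_cast; ring
  have hE₃ : ∀ τ ∈ Set.Ico 0 T, ‖E₃ τ‖ ≤ A * (K * ε ^ 3) := by
    intro τ hτ
    refine (sum_tri_bound hθ hε hε hε hB' (hu τ hτ) (hu τ hτ) (hu τ hτ)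
      fun p hp => ⟨((hSmem p).1 hp).2.1, hanorm p hp⟩).trans ?_
    have : triConst d * (C₀ * CH * K / 3) * (ε * ε * ε) = A * (K * ε ^ 3) / 3 := by rw [hA]; ring
    rw [this]
    have : 0 ≤ A * (K * ε ^ 3) := by positivity
    linarith
  let D₂ : ℝ → ℂ := fun τ => Complex.I * ∑ x ∈ ballF d M, ((bsgn x.1 * twt s M x : ℝ) : ℂ) * (u τ x * Nl τ (barx x))
  let D₃ : ℝ → ℂ := fun τ => -Complex.I * (∑ p ∈ S, a p * omT om p * triProd (u τ) (u τ) (u τ) p +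
        (∑ p ∈ S, (a p * bsgn p.1.1) * triProd (Nl τ) (u τ) (u τ) p +
        ∑ p ∈ S, (a p * bsgn p.2.1.1) * triProd (u τ) (Nl τ) (u τ) p +
        ∑ p ∈ S, (a p * bsgn p.2.2.1) * triProd (u τ) (u τ) (Nl τ) p))
  have hD : ∀ τ ∈ Set.Ico 0 T, HasDerivWithinAt (fun τ => E₂ τ + E₃ τ) (D₂ τ + D₃ τ) (Set.Ico 0 T) τ :=
    fun τ hτ => (hasDerivWithinAt_quadratic hom.even (hder τ hτ)).add
      (hasDerivWithinAt_cubic (hder τ hτ) (fun p hp => by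
        have := ((hSmem p).1 hp).1; exact ⟨this.1.2, this.2.1.2, this.2.2.2⟩) a)
  have hDb : ∀ τ ∈ Set.Ico 0 T, ‖D₂ τ + D₃ τ‖ ≤ (A + A * B + 2 * B) * (ε ^ 3 / N + K * ε ^ 4) := by
    intro τ hτ
    have hsplit : ∑ x ∈ ballF d M, ((bsgn x.1 * twt s M x : ℝ) : ℂ) * (u τ x * Nl τ (barx x)) =
        ∑ x ∈ ballF d M, ((bsgn x.1 * twt s M x : ℝ) : ℂ) * (u τ x * quadN H (u τ) (barx x)) +
        ∑ x ∈ ballF d M, ((bsgn x.1 * twt s M x : ℝ) : ℂ) * (u τ x * R τ (barx x)) := by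
      rw [← Finset.sum_add_distrib]
      refine Finset.sum_congr rfl fun x hx => ?_
      rw [hNl τ hτ (barx x) (by simpa [barx] using (mem_ballF.1 hx).2)]
      ring
    have hcb : ∀ x : SFreq d, |bsgn x.1 * twt s M x| ≤ M ^ (2 * s) := fun x => by
      rw [abs_mul, abs_bsgn, one_mul, abs_of_nonneg (twt_nonneg ..)]
      exact twt_le hs0 hM0 x
    have hout : ∀ x, x ∉ ballF d M → ((bsgn x.1 * twt s M x : ℝ) : ℂ) * u τ x = 0 := by
      intro x hx
      by_cases h : x.2 = 0
      · rw [hzero τ hτ x h, mul_zero]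
      · have h1 : M ≤ bracket x.2 := by
          by_contra! hlt
          exact hx (mem_ballF.2 ⟨hlt.le, h⟩)
        rw [twt, truncWt_eq_zero hM0 h1]; simp
    have hq1 := sum_quadN hH hs2 hε (hu τ hτ) (by positivity) hcb hout
    have hq2 := tsum_symm hH hs2 hε (hu τ hτ) (by positivity) hcb
    have hkapb : ∀ p : Tri d, |kapT s M p| ≤ 3 * M ^ (2 * s) := fun p => by
      refine (abs_add_three _ _ _).trans ?_
      have h1 := hcb p.1
      have h2 := hcb p.2.1
      have h3 := hcb p.2.2
      linarith
    have hksum := (cubDens_bound hH hε (hu τ hτ) (c := kapT s M) (B := 3 * M ^ (2 * s)) (by positivity)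
      (θ := 0) (by linarith) fun p _ _ => (hkapb p).trans
        (le_mul_of_one_le_right (by positivity) (one_le_triWt le_rfl hs0 _ _ _))).1
    -- A triple with nonzero contribution outside `S` falls under the second alternative of
    -- `dichotomy` and so carries the gain `1/N`.
    have hoff := cubDens_bound hH hε (hu τ hτ) (c := fun p => if p ∈ S then 0 else kapT s M p)
      (B := C₀ / N) (by positivity) hθ (fun p hp hp0 => by
        by_cases hpS : p ∈ S
        · simp only [if_pos hpS, abs_zero]
          exact mul_nonneg (by positivity) (triWt_nonneg ..)
        simp only [if_neg hpS]
        have hne : u τ p.1 ≠ 0 ∧ u τ p.2.1 ≠ 0 ∧ u τ p.2.2 ≠ 0 := by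
          simp only [triProd, ne_eq, mul_eq_zero, not_or] at hp0
          exact ⟨hp0.1.1, hp0.1.2, hp0.2⟩
        have n1 : p.1.2 ≠ 0 := fun h => hne.1 (hzero τ hτ _ h)
        have n2 : p.2.1.2 ≠ 0 := fun h => hne.2.1 (hzero τ hτ _ h)
        have n3 : p.2.2.2 ≠ 0 := fun h => hne.2.2 (hzero τ hτ _ h)
        rcases hdich N M p.1 p.2.1 p.2.2 hN hM n1 n2 n3 hp with h | h
        · exact absurd ((hSmem p).2 ⟨⟨⟨h.2.1, n1⟩, ⟨h.2.2.1, n2⟩, ⟨h.2.2.2, n3⟩⟩, hp, h.1⟩) hpS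
        · refine h.trans (le_of_eq ?_)
          rw [mul_div_right_comm]; rfl)
    have hdiff : ∑' p, ((kapT s M p : ℝ) : ℂ) * cubDens H (u τ) p =
        ∑' p, (((if p ∈ S then 0 else kapT s M p : ℝ)) : ℂ) * cubDens H (u τ) p +
        ∑ p ∈ S, ((kapT s M p : ℝ) : ℂ) * cubDens H (u τ) p := by
      have e1 : ∑' p, (if p ∈ S then ((kapT s M p : ℝ) : ℂ) * cubDens H (u τ) p else 0) =
          ∑ p ∈ S, ((kapT s M p : ℝ) : ℂ) * cubDens H (u τ) p :=
        (tsum_eq_sum (s := S) fun p hp => if_neg hp).trans (Finset.sum_congr rfl fun p hp => if_pos hp)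
      have e2 : Summable fun p => (if p ∈ S then ((kapT s M p : ℝ) : ℂ) * cubDens H (u τ) p else 0) :=
        summable_of_ne_finset_zero (s := S) fun p hp => if_neg hp
      rw [← e1, ← hoff.1.tsum_add e2]
      refine tsum_congr fun p => ?_
      split_ifs <;> simp
    have hres : ∑ p ∈ S, a p * omT om p * triProd (u τ) (u τ) (u τ) p =
        (1 / 3) * ∑ p ∈ S, ((kapT s M p : ℝ) : ℂ) * cubDens H (u τ) p := by
      rw [Finset.mul_sum]
      refine Finset.sum_congr rfl fun p hp => ?_
      obtain ⟨-, hz, hk⟩ := (hSmem p).1 hp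
      rw [cubDens, if_pos hz]
      -- On `S` a vanishing `Ω` forces `κ = 0`, so exact resonances are harmless with the convention
      -- `x / 0 = 0`.
      have e : kapT s M p / omT om p * omT om p = kapT s M p := by
        by_cases h0 : omT om p = 0
        · rw [h0, abs_zero, mul_zero] at hk
          rw [h0, mul_zero, abs_eq_zero.1 (le_antisymm hk (abs_nonneg _))]
        · exact div_mul_cancel₀ _ h0
      have e' : a p * omT om p = ((kapT s M p : ℝ) : ℂ) * H p / 3 := by
        simp only [a]
        rw [← Complex.ofReal_mul, show kapT s M p / omT om p * H p / 3 * omT om p =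
          (kapT s M p / omT om p * omT om p) * H p / 3 by ring, e]
        push_cast; ring
      rw [e']; ring
    have hk3 : ∀ p : Tri d, bsgn p.1.1 * twt s M p.1 + bsgn p.2.1.1 * twt s M p.2.1 +
      bsgn p.2.2.1 * twt s M p.2.2 = kapT s M p := fun p => rfl
    simp only [hk3] at hq2
    -- After the cancellation on `S` three contributions remain: the triples not removed, of size
    -- `ε³/N`; the cubic remainder of the equation, of size `ε⁴`; and the nonlinearity inserted in
    -- the correction, of size `K ε⁴`.
    have htot : D₂ τ + D₃ τ = Complex.I / 3 * ∑' p, (((if p ∈ S then 0 else kapT s M p : ℝ)) : ℂ) * cubDens H (u τ) p +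
        Complex.I * ∑ x ∈ ballF d M, ((bsgn x.1 * twt s M x : ℝ) : ℂ) * (u τ x * R τ (barx x)) +
        -Complex.I * (∑ p ∈ S, (a p * bsgn p.1.1) * triProd (Nl τ) (u τ) (u τ) p +
        ∑ p ∈ S, (a p * bsgn p.2.1.1) * triProd (u τ) (Nl τ) (u τ) p +
        ∑ p ∈ S, (a p * bsgn p.2.2.1) * triProd (u τ) (u τ) (Nl τ) p) := by
      simp only [D₂, D₃]
      rw [hsplit, hq1, hres]
      have h1 : ∑' p : Tri d, ((bsgn p.1.1 * twt s M p.1 : ℝ) : ℂ) * cubDens H (u τ) p =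
        (1 / 3) * ∑' p, ((kapT s M p : ℝ) : ℂ) * cubDens H (u τ) p := by rw [hq2]; ring
      rw [h1, hdiff]
      ring
    have hasg : ∀ (p : Tri d) (σ : Bool), p ∈ S → ‖a p * bsgn σ‖ ≤ C₀ * CH * K / 3 * triW (2 * d + 1) s p := by
      intro p σ hp
      have h1 : ‖((bsgn σ : ℝ) : ℂ)‖ = 1 := by rw [Complex.norm_real, Real.norm_eq_abs, abs_bsgn]
      rw [norm_mul, h1, mul_one]
      exact hanorm p hp
    have hBε : 0 ≤ B * ε ^ 2 := by positivity
    have r1 := sum_tri_bound hθ hBε hε hε hB' (hNlb τ hτ) (hu τ hτ) (hu τ hτ) (S := S)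
      (G := fun p => a p * bsgn p.1.1) fun p hp => ⟨((hSmem p).1 hp).2.1, hasg p _ hp⟩
    have r2 := sum_tri_bound hθ hε hBε hε hB' (hu τ hτ) (hNlb τ hτ) (hu τ hτ) (S := S)
      (G := fun p => a p * bsgn p.2.1.1) fun p hp => ⟨((hSmem p).1 hp).2.1, hasg p _ hp⟩
    have r3 := sum_tri_bound hθ hε hε hBε hB' (hu τ hτ) (hu τ hτ) (hNlb τ hτ) (S := S)
      (G := fun p => a p * bsgn p.2.2.1) fun p hp => ⟨((hSmem p).1 hp).2.1, hasg p _ hp⟩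
    have r4 := sum_weight_mul_le hM0 hε (by positivity : 0 ≤ B * ε ^ 3) (hu τ hτ) (hR τ hτ) (ballF d M)
    rw [htot]
    refine (norm_add₃_le).trans ?_
    rw [norm_mul, norm_mul Complex.I, norm_mul (-Complex.I), norm_neg, norm_div, Complex.norm_I, one_mul, one_mul]
    have r5 := (norm_add₃_le (a := ∑ p ∈ S, (a p * bsgn p.1.1) * triProd (Nl τ) (u τ) (u τ) p)
      (b := ∑ p ∈ S, (a p * bsgn p.2.1.1) * triProd (u τ) (Nl τ) (u τ) p)
      (c := ∑ p ∈ S, (a p * bsgn p.2.2.1) * triProd (u τ) (u τ) (Nl τ) p)).trans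
      (add_le_add (add_le_add r1 r2) r3)
    have r6 : (1 / ‖(3:ℂ)‖) * ‖∑' p, (((if p ∈ S then 0 else kapT s M p : ℝ)) : ℂ) * cubDens H (u τ) p‖ ≤
        A * (ε ^ 3 / N) := by
      have h3 : ‖(3:ℂ)‖ = 3 := by simp
      rw [h3]
      have h4 := hoff.2
      have h5 : triConst d * (C₀ / N * CH) * (ε * ε * ε) = A * (ε ^ 3 / N) := by rw [hA]; ring
      rw [h5] at h4
      have h6 : 0 ≤ A * (ε ^ 3 / N) := by positivity
      linarith
    refine (add_le_add (add_le_add r6 r4) r5).trans ?_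
    have e7 : triConst d * (C₀ * CH * K / 3) * (B * ε ^ 2 * ε * ε) +
        triConst d * (C₀ * CH * K / 3) * (ε * (B * ε ^ 2) * ε) +
        triConst d * (C₀ * CH * K / 3) * (ε * ε * (B * ε ^ 2)) = A * B * (K * ε ^ 4) := by rw [hA]; ring
    rw [e7]
    have e8 : 2 * (ε * (B * ε ^ 3)) ≤ 2 * B * (K * ε ^ 4) := by
      have : ε ^ 4 ≤ K * ε ^ 4 := le_mul_of_one_le_left (by positivity) hK1
      nlinarith
    have p1 : 0 ≤ ε ^ 3 / N := by positivity
    have p2 : 0 ≤ K * ε ^ 4 := by positivity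
    have p3 : 0 ≤ A * (K * ε ^ 4) := by positivity
    have p4 : 0 ≤ (A * B + 2 * B) * (ε ^ 3 / N) := by positivity
    linarith
  have hmv := (convex_Ico (0:ℝ) T).norm_image_sub_le_of_norm_hasDerivWithin_le hD hDb h0T ht
  have hE₃t := hE₃ t ht
  have hE₃0 := hE₃ 0 h0T
  rw [hE₂ t ht, hE₂ 0 h0T] at hmv
  have h1 : ((energy s M (u t) - energy s M (u 0) : ℝ) : ℂ) =
      ((energy s M (u t) : ℂ) + E₃ t - ((energy s M (u 0) : ℂ) + E₃ 0)) - E₃ t + E₃ 0 := by push_cast; ring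
  have h2 : |energy s M (u t) - energy s M (u 0)| ≤
      (A + A * B + 2 * B) * (ε ^ 3 / N + K * ε ^ 4) * ‖t - 0‖ + A * (K * ε ^ 3) + A * (K * ε ^ 3) := by
    rw [← Real.norm_eq_abs, ← Complex.norm_real, h1]
    exact (norm_add_le _ _).trans (add_le_add ((norm_sub_le _ _).trans (add_le_add hmv hE₃t)) hE₃0)
  rw [sub_zero, Real.norm_of_nonneg ht.1] at h2
  have h3 := (le_abs_self _).trans h2
  have p1 : 0 ≤ ε ^ 3 / N + K * ε ^ 4 := by positivity
  have p2 : 0 ≤ K * ε ^ 3 := by positivity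
  have hT0 : 0 ≤ T := h0T.2.le
  have p3 : (A + A * B + 2 * B) * (ε ^ 3 / N + K * ε ^ 4) * t ≤
      (2 * A + A * B + 2 * B + 1) * (T * (ε ^ 3 / N + K * ε ^ 4)) := by
    calc (A + A * B + 2 * B) * (ε ^ 3 / N + K * ε ^ 4) * t ≤
        (2 * A + A * B + 2 * B + 1) * (ε ^ 3 / N + K * ε ^ 4) * T :=
          mul_le_mul (mul_le_mul_of_nonneg_right (by linarith) p1) ht.2.le ht.1 (by positivity)
      _ = _ := by ring
  have p4 : A * (K * ε ^ 3) + A * (K * ε ^ 3) ≤ (2 * A + A * B + 2 * B + 1) * (K * ε ^ 3) := by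
    have : 0 ≤ (A * B + 2 * B + 1) * (K * ε ^ 3) := by positivity
    linarith
  linarith

end Energy

end QHD
end

/-! ### Interaction coefficients of the quadratic nonlinearity -/

noncomputable section

namespace QHD

open scoped ENNReal ComplexConjugate Topology Pointwise
open UnitAddTorus

section Interaction
variable {d : ℕ}

/-- The pair `(w, w̄)` as a family indexed by signed frequencies. -/
def dbl (w : Freq d → ℂ) (x : SFreq d) : ℂ := if x.1 then w x.2 else conj (w (-x.2))

lemma dbl_barx (w : Freq d → ℂ) (x : SFreq d) : dbl w (barx x) = conj (dbl w x) := by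
  obtain ⟨σ, j⟩ := x
  cases σ <;> simp [dbl, barx]

lemma wl2_dbl (s : ℝ) (w : Freq d → ℂ) (σ : Bool) : wl2 s (fun a => dbl w (σ, a)) = wl2 s w := by
  cases σ
  · simpa [dbl] using wl2_conj_neg s w
  · simp [dbl]

/-- The entries of a matrix `[[A, -B], [-B, A]]` of Fourier multipliers. -/
def mixC (A B : Freq d → ℝ) (μ σ : Bool) (j : Freq d) : ℝ := if μ = σ then A j else -B j

lemma abs_mixC_le {A B : Freq d → ℝ} {b : ℝ} (h : ∀ j, |A j| ≤ b ∧ |B j| ≤ b) (μ σ : Bool) (j : Freq d) :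
    |mixC A B μ σ j| ≤ b := by
  unfold mixC
  split_ifs
  exacts [(h j).1, (abs_neg _).trans_le (h j).2]

/-- The totally symmetric coefficients of the quadratic nonlinearity `quadF p q`. -/
def quadT (p q : ℝ) (ρ σ τ : Bool) : ℝ := if ρ = σ ∧ σ = τ then q else p + q

lemma abs_quadT_le (p q : ℝ) (ρ σ τ : Bool) : |quadT p q ρ σ τ| ≤ |p| + |q| := by
  unfold quadT
  split_ifs
  exacts [le_add_of_nonneg_left (abs_nonneg _), abs_add_le _ _]

/-- The interaction coefficients of `quadF p q` in the diagonalizing variables. -/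
def interC (A B : Freq d → ℝ) (p q : ℝ) (x : Tri d) : ℝ :=
  tc d ^ 2 * ∑ ρ : Bool, ∑ σ : Bool, ∑ τ : Bool, quadT p q ρ σ τ *
    (mixC A B x.1.1 ρ x.1.2 * mixC A B x.2.1.1 σ x.2.1.2 * mixC A B x.2.2.1 τ x.2.2.2)

/-- There are eight choices of the signs `(ρ, σ, τ)`, each bounded entrywise. Rotation invariance is
inherited from the total symmetry of `quadT`. -/
lemma symCoef_interC {A B : Freq d → ℝ} {b : ℝ} (hb : 0 ≤ b) (h : ∀ j, |A j| ≤ b ∧ |B j| ≤ b) (p q : ℝ) :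
    SymCoef d (tc d ^ 2 * (8 * ((|p| + |q|) * (b * b * b)))) (interC A B p q) where
  nonneg := by positivity
  bound x := by
    rw [interC, abs_mul, abs_of_nonneg (sq_nonneg _)]
    refine mul_le_mul_of_nonneg_left ?_ (sq_nonneg _)
    have h1 : ∀ ρ σ τ, |quadT p q ρ σ τ *
        (mixC A B x.1.1 ρ x.1.2 * mixC A B x.2.1.1 σ x.2.1.2 * mixC A B x.2.2.1 τ x.2.2.2)| ≤
        (|p| + |q|) * (b * b * b) := fun ρ σ τ => by
      rw [abs_mul, abs_mul, abs_mul]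
      gcongr
      exacts [abs_quadT_le .., abs_mixC_le h .., abs_mixC_le h .., abs_mixC_le h ..]
    have h2 : ∀ ρ σ, |∑ τ, quadT p q ρ σ τ *
        (mixC A B x.1.1 ρ x.1.2 * mixC A B x.2.1.1 σ x.2.1.2 * mixC A B x.2.2.1 τ x.2.2.2)| ≤
        2 * ((|p| + |q|) * (b * b * b)) := fun ρ σ => by
      rw [Fintype.sum_bool, two_mul]
      exact (abs_add_le _ _).trans (add_le_add (h1 ..) (h1 ..))
    simp only [Fintype.sum_bool (f := fun ρ => ∑ σ, ∑ τ, quadT p q ρ σ τ *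
        (mixC A B x.1.1 ρ x.1.2 * mixC A B x.2.1.1 σ x.2.1.2 * mixC A B x.2.2.1 τ x.2.2.2)),
      Fintype.sum_bool (f := fun σ => ∑ τ, quadT p q true σ τ *
        (mixC A B x.1.1 true x.1.2 * mixC A B x.2.1.1 σ x.2.1.2 * mixC A B x.2.2.1 τ x.2.2.2)),
      Fintype.sum_bool (f := fun σ => ∑ τ, quadT p q false σ τ *
        (mixC A B x.1.1 false x.1.2 * mixC A B x.2.1.1 σ x.2.1.2 * mixC A B x.2.2.1 τ x.2.2.2))]
    refine ((abs_add_le _ _).trans (add_le_add ((abs_add_le _ _).trans (add_le_add (h2 ..) (h2 ..)))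
      ((abs_add_le _ _).trans (add_le_add (h2 ..) (h2 ..))))).trans (le_of_eq (by ring))
  rot x y z := by
    simp only [interC, Fintype.sum_bool, quadT]
    simp only [Bool.true_eq_false, Bool.false_eq_true, and_self, and_true, and_false, if_true, if_false]
    ring

/-- The resonant sum over `x̄ + y + z = 0` as a convolution. -/
lemma hasSum_quadN {CH : ℝ} {H : Tri d → ℝ} (hH : SymCoef d CH H) {u : SFreq d → ℂ}
    (hu : ∀ σ, Summable fun a => u (σ, a)) (μ : Bool) (j : Freq d) :
    HasSum (fun k => ∑ ρ : Bool, ∑ τ : Bool,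
      (H ((!μ, -j), (ρ, j - k), (τ, k)) : ℂ) * (u (ρ, j - k) * u (τ, k))) (quadN H u (μ, j)) := by
  let e : Freq d × Bool × Bool → SFreq d × SFreq d := fun p => ((p.2.1, j - p.1), (p.2.2, p.1))
  have he : Function.Injective e := fun p p' h => by
    simp only [e, Prod.mk.injEq] at h
    ext1
    · exact h.2.2
    · ext1
      exacts [h.1.1, h.2.1]
  let f : Freq d × Bool × Bool → ℂ := fun p =>
    (H ((!μ, -j), (p.2.1, j - p.1), (p.2.2, p.1)) : ℂ) * (u (p.2.1, j - p.1) * u (p.2.2, p.1))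
  have hB : ∃ K : ℝ, 0 ≤ K ∧ ∀ x, ‖u x‖ ≤ K := by
    refine ⟨∑ σ : Bool, ∑' a, ‖u (σ, a)‖, Finset.sum_nonneg fun σ _ => tsum_nonneg fun a => norm_nonneg _,
      fun x => ?_⟩
    refine ((hu x.1).norm.le_tsum x.2 fun a _ => norm_nonneg _).trans ?_
    exact Finset.single_le_sum (f := fun σ : Bool => ∑' a, ‖u (σ, a)‖)
      (fun σ _ => tsum_nonneg fun a => norm_nonneg _) (Finset.mem_univ x.1)
  obtain ⟨K, hK0, hK⟩ := hB
  have hf : Summable f := by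
    have h1 : Summable fun k => ∑ σ : Bool, ‖u (σ, k)‖ := summable_sum fun σ _ => (hu σ).norm
    have h2 : Summable fun _ : Bool × Bool => CH * K := (hasSum_fintype _).summable
    refine Summable.of_norm_bounded (h1.mul_of_nonneg h2
      (fun k => Finset.sum_nonneg fun σ _ => norm_nonneg _) fun _ => mul_nonneg hH.nonneg hK0) fun p => ?_
    simp only [f]
    rw [norm_mul, norm_mul, Complex.norm_real, Real.norm_eq_abs]
    have h3 : ‖u (p.2.2, p.1)‖ ≤ ∑ σ : Bool, ‖u (σ, p.1)‖ :=
      Finset.single_le_sum (f := fun σ : Bool => ‖u (σ, p.1)‖) (fun σ _ => norm_nonneg _)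
        (Finset.mem_univ p.2.2)
    calc _ ≤ CH * (K * ∑ σ : Bool, ‖u (σ, p.1)‖) :=
          mul_le_mul (hH.bound _) (mul_le_mul (hK _) h3 (norm_nonneg _) hK0) (by positivity) hH.nonneg
      _ = _ := by ring
  have key : quadN H u (μ, j) = ∑' p, f p := by
    rw [quadN, ← he.tsum_eq]
    · refine tsum_congr fun p => ?_
      rw [if_pos]
      · rfl
      · simp only [ZeroMom, barx, e]; abel
    · intro q hq
      rw [Function.mem_support] at hq
      have hz : ZeroMom (barx (μ, j), q) := by
        by_contra hz
        exact hq (if_neg hz)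
      simp only [ZeroMom, barx] at hz
      refine ⟨(q.2.2, q.1.1, q.2.1), ?_⟩
      simp only [e]
      rw [show j - q.2.2 = q.1.2 by rw [← sub_eq_zero, ← neg_eq_zero, ← hz]; abel]
  have hs := hf.hasSum.prod_fiberwise fun k => hasSum_fintype fun b : Bool × Bool => f (k, b)
  rw [key]
  simpa only [f, Fintype.sum_prod_type] using hs

/-- The coefficients of `quadF` as a convolution. -/
lemma hasSum_coef_quadF {z : Freq d → ℂ} (hz : Summable z) (p q : ℝ) (j : Freq d) :
    HasSum (fun k => ∑ ρ : Bool, ∑ τ : Bool, ((tc d ^ 2 * quadT p q false ρ τ : ℝ) : ℂ) *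
      (dbl z (ρ, j - k) * dbl z (τ, k))) (coef (quadF p q (synth z)) j) := by
  have hZ : ∀ k, coef (synth z) k = tc d * dbl z (true, k) := fun k => by rw [coef_synth hz]; simp [dbl]
  have hZs : ∀ k, coef (star (synth z)) k = tc d * dbl z (false, k) := fun k => by
    rw [coef_star, coef_synth hz]; simp [dbl]
  have hs : Summable (coef (synth z)) := by
    rw [show coef (synth z) = fun k => tc d * z k from funext (coef_synth hz)]
    exact hz.mul_left _
  have hss : Summable (coef (star (synth z))) := by
    rw [show coef (star (synth z)) = fun k => conj (tc d * z (-k)) from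
      funext fun k => by rw [coef_star, coef_synth hz]]
    exact (((Equiv.neg (Freq d)).summable_iff.2 hz).mul_left (tc d : ℂ)).star
  have h1 := hasSum_coef_mul hs (synth z) j
  have h2 := hasSum_coef_mul hs (star (synth z)) j
  have h3 := hasSum_coef_mul hss (synth z) j
  have h4 := hasSum_coef_mul hss (star (synth z)) j
  have h := ((h1.add (h2.add h3)).mul_left ((p + q : ℝ) : ℂ)).add (h4.mul_left (q : ℂ))
  have e : quadF p q (synth z) = ((p + q : ℝ) : ℂ) • (synth z * synth z) +
      ((p + q : ℝ) : ℂ) • (synth z * star (synth z)) + ((p + q : ℝ) : ℂ) • (star (synth z) * synth z) +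
      (q : ℂ) • (star (synth z) * star (synth z)) := by
    rw [quadF]
    ext t
    simp only [ContinuousMap.add_apply, ContinuousMap.smul_apply, ContinuousMap.mul_apply, smul_eq_mul]
    push_cast
    ring
  have e' : coef (quadF p q (synth z)) j = ((p + q : ℝ) : ℂ) * (coef (synth z * synth z) j +
      (coef (synth z * star (synth z)) j + coef (star (synth z) * synth z) j)) +
        (q : ℂ) * coef (star (synth z) * star (synth z)) j := by
    rw [e]
    simp only [coef_add, coef_smul]
    ring
  rw [e']
  refine (congrArg (fun f => HasSum f _) (funext fun k => ?_)).mp h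
  simp only [hZ, hZs, Fintype.sum_bool, quadT, Bool.true_eq_false, Bool.false_eq_true, and_self, and_true,
    and_false, if_true, if_false]
  push_cast
  ring

/-- Both sides are convolutions in `k`. Substituting `z` in terms of `w` in the two inputs, and
applying the same mixing matrix to the output, puts all three slots on an equal footing. Evenness of
`A` and `B` is needed because conjugation reverses frequencies. -/
lemma quadN_interC {A B : Freq d → ℝ} {b : ℝ} (hb : 0 ≤ b) (h : ∀ j, |A j| ≤ b ∧ |B j| ≤ b)
    (hA : ∀ j, A (-j) = A j) (hB : ∀ j, B (-j) = B j) (p q : ℝ) {w z : Freq d → ℂ} (hw : Summable w)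
    (hz : Summable z) (hwz : ∀ j, z j = A j * w j - B j * conj (w (-j))) (μ : Bool) (j : Freq d) :
    quadN (interC A B p q) (dbl w) (μ, j) =
      mixC A B μ true j * coef (quadF p q (synth z)) j +
        mixC A B μ false j * conj (coef (quadF p q (synth z)) (-j)) := by
  have hws : ∀ σ, Summable fun a => dbl w (σ, a) := fun σ => by
    cases σ
    · simpa [dbl] using ((Equiv.neg (Freq d)).summable_iff.2 hw).star
    · simpa [dbl] using hw
  have h0 := hasSum_quadN (symCoef_interC hb h p q) hws μ j
  have h1 := hasSum_coef_quadF hz p q j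
  have h2 := (Complex.hasSum_conj'.2 ((Equiv.neg (Freq d)).hasSum_iff.2 (hasSum_coef_quadF hz p q (-j))))
  refine h0.unique ?_
  have h3 := (h1.mul_left (mixC A B μ true j : ℂ)).add (h2.mul_left (mixC A B μ false j : ℂ))
  refine (congrArg (fun f => HasSum f _) (funext fun k => ?_)).mp h3
  have e : ∀ σ k, dbl z (σ, k) = mixC A B true σ k * dbl w (true, k) + mixC A B false σ k * dbl w (false, k) :=
    fun σ k => by
      cases σ
      · simp [dbl, mixC, hwz, hA, hB]; ring
      · simp [dbl, mixC, hwz]; ring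
  have e' : ∀ σ k, conj (dbl z (σ, -k)) = dbl z (!σ, k) := fun σ k => by cases σ <;> simp [dbl]
  have hm : ∀ μ σ j, mixC A B μ σ (-j) = mixC A B μ σ j := fun μ σ j => by simp [mixC, hA, hB]
  have hj : -j - -k = -(j - k) := by abel
  simp only [Function.comp_apply, Equiv.neg_apply, map_sum, map_mul, Complex.conj_ofReal, hj, e']
  simp only [e, interC, hm, Fintype.sum_bool, quadT]
  cases μ <;>
  · simp only [mixC, Bool.true_eq_false, Bool.false_eq_true, and_self, and_true, and_false, if_true,
      if_false, Bool.not_true, Bool.not_false]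
    push_cast
    ring

end Interaction

end QHD
end

/-! ### Removal of the truncation and choice of the parameter `N` -/

noncomputable section

namespace QHD

open scoped ENNReal ComplexConjugate Topology Pointwise
open UnitAddTorus

section Assembly
variable {d : ℕ}

/-- Both signs carry the same norm, which accounts for the factor `1/2` in the weight. -/
lemma hasSum_dbl {s : ℝ} {w : Freq d → ℂ} (h : Summable fun j : Freq d => bracket j ^ (2 * s) * ‖w j‖ ^ 2) :
    HasSum (fun x : SFreq d => bracket x.2 ^ (2 * s) / 2 * ‖dbl w x‖ ^ 2) (sobolevNorm s w ^ 2) := by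
  have hnn : ∀ j : Freq d, 0 ≤ bracket j ^ (2 * s) := fun j => Real.rpow_nonneg (bracket_pos j).le _
  set S := ∑' j : Freq d, bracket j ^ (2 * s) * ‖w j‖ ^ 2 with hS
  have hf : ∀ σ, HasSum (fun j : Freq d => bracket j ^ (2 * s) / 2 * ‖dbl w (σ, j)‖ ^ 2) (S / 2) := fun σ => by
    have h1 := h.hasSum.div_const 2
    cases σ
    · refine (congrArg (fun f => HasSum f _) (funext fun j => ?_)).mp ((Equiv.neg (Freq d)).hasSum_iff.2 h1)
      simp [dbl, bracket_neg]; ring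
    · refine (congrArg (fun f => HasSum f _) (funext fun j => ?_)).mp h1
      simp [dbl]; ring
  have hs : Summable fun x : SFreq d => bracket x.2 ^ (2 * s) / 2 * ‖dbl w x‖ ^ 2 := by
    rw [summable_prod_of_nonneg fun x => mul_nonneg (div_nonneg (hnn _) two_pos.le) (by positivity)]
    exact ⟨fun σ => (hf σ).summable, (hasSum_fintype _).summable⟩
  have e : sobolevNorm s w ^ 2 = S :=
    Real.sq_sqrt (tsum_nonneg fun j => mul_nonneg (hnn j) (by positivity))
  have h2 := hs.hasSum.prod_fiberwise hf
  rw [e, ← (h2.unique (hasSum_fintype _)).trans (by simp; ring : ∑ _ : Bool, S / 2 = S)]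
  exact hs.hasSum

lemma energy_dbl_le {s M : ℝ} (hM : 0 < M) {w : Freq d → ℂ}
    (h : Summable fun j : Freq d => bracket j ^ (2 * s) * ‖w j‖ ^ 2) :
    energy s M (dbl w) ≤ sobolevNorm s w ^ 2 := by
  refine le_trans (Finset.sum_le_sum fun x _ => ?_) (sum_le_hasSum (ballF d M)
    (fun x _ => mul_nonneg (div_nonneg (Real.rpow_nonneg (bracket_pos _).le _) two_pos.le) (by positivity))
    (hasSum_dbl h))
  have := truncWt_le (s := s) hM (bracket_pos x.2).le
  unfold twt
  gcongr

/-- On a finite set of frequencies the truncated weights tend to `⟨j⟩^{2s}` as `M → ∞`, while the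
bound `E` does not depend on `M`. The zero frequency, absent from `ballF`, contributes nothing
because `w 0 = 0`. -/
lemma sobolevNorm_sq_le {s E : ℝ} {w : Freq d → ℂ} (h : MemSobolevZero s w)
    (hE : ∀ M, 1 ≤ M → energy s M (dbl w) ≤ E) : sobolevNorm s w ^ 2 ≤ E := by
  have hnn : ∀ M (x : SFreq d), 0 ≤ twt s M x / 2 * ‖dbl w x‖ ^ 2 := fun M x =>
    mul_nonneg (div_nonneg (twt_nonneg ..) two_pos.le) (by positivity)
  refine hasSum_le_of_sum_le (hasSum_dbl h.2) fun F => ?_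
  have ht : Filter.Tendsto (fun M : ℝ => ∑ x ∈ F, twt s M x / 2 * ‖dbl w x‖ ^ 2) Filter.atTop
      (𝓝 (∑ x ∈ F, bracket x.2 ^ (2 * s) / 2 * ‖dbl w x‖ ^ 2)) := by
    refine tendsto_finsetSum _ fun x _ => ((Filter.Tendsto.div_const ?_ _).mul_const _)
    have h1 : Filter.Tendsto (fun M : ℝ => max 0 (1 - bracket x.2 / M)) Filter.atTop (𝓝 (max 0 (1 - 0))) :=
      (tendsto_const_nhds).max (tendsto_const_nhds.sub (Filter.Tendsto.div_atTop tendsto_const_nhds Filter.tendsto_id))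
    have h2 := h1.const_mul (bracket x.2 ^ (2 * s))
    simpa [twt, truncWt] using h2
  have hev : ∀ᶠ M : ℝ in Filter.atTop, ∀ x ∈ F, bracket x.2 ≤ M :=
    (Filter.eventually_all_finset F).2 fun x _ => Filter.eventually_ge_atTop _
  refine le_of_tendsto ht ?_
  filter_upwards [hev, Filter.eventually_ge_atTop 1] with M hM hM1
  refine le_trans ?_ (hE M hM1)
  classical
  rw [← Finset.sum_filter_of_ne (p := fun x : SFreq d => x.2 ≠ 0) fun x _ hx hx0 => hx ?_]
  · refine Finset.sum_le_sum_of_subset_of_nonneg (fun x hx => ?_) fun x _ _ => hnn M x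
    rw [Finset.mem_filter] at hx
    exact mem_ballF.2 ⟨hM x hx.1, hx.2⟩
  · simp [dbl, hx0, h.1]

/-- Smallness of the losses on the time scale of the theorem. -/
lemma exists_small_loss (hd : 2 ≤ d) {δ : ℝ} (hδ : 0 < δ) :
    ∃ ε₀ : ℝ, 0 < ε₀ ∧ ∀ ε T : ℝ, 0 < ε → ε < ε₀ → 0 < T →
      T ≤ ε ^ (-1 - 1 / ((d : ℝ) - 1)) *
        Real.log (1 + ε ^ (1 / (1 - (d : ℝ)))) ^ (-((d : ℝ) + 1) / 2) →
      1 ≤ ε ^ (1 / (1 - (d : ℝ))) ∧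
      lossFac d (ε ^ (1 / (1 - (d : ℝ)))) * (2 * ε) ^ 3 + T * ((2 * ε) ^ 3 / ε ^ (1 / (1 - (d : ℝ))) +
        lossFac d (ε ^ (1 / (1 - (d : ℝ)))) * (2 * ε) ^ 4) ≤ δ * ε ^ 2 := by
  have hd' : (2 : ℝ) ≤ d := by exact_mod_cast hd
  have hd1 : 0 < (d : ℝ) - 1 := by linarith
  -- The total loss below is at most `40 P q ε²` with `P q ≤ 4 l^{-1/4}` and `l = log N`, whence
  -- `160`. The choice of `ε₀` that follows is equivalent to `log N` exceeding the threshold `X`.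
  have hlim : ∀ᶠ l : ℝ in Filter.atTop, 160 * l ^ (-(1 / 4 : ℝ)) < δ ∧ 1 ≤ l := by
    have h1 := (tendsto_rpow_neg_atTop (by norm_num : (0:ℝ) < 1 / 4)).const_mul 160
    rw [mul_zero] at h1
    exact (h1.eventually_lt_const hδ).and (Filter.eventually_ge_atTop 1)
  obtain ⟨X, hX⟩ := Filter.eventually_atTop.1 hlim
  refine ⟨Real.exp (-((d - 1) * X)), Real.exp_pos _, fun ε T hε hεX hT hTle => ?_⟩
  have hN0 : 0 < ε ^ (1 / (1 - (d : ℝ))) := Real.rpow_pos_of_pos hε _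
  set N := ε ^ (1 / (1 - (d : ℝ))) with hN
  have hlogN : Real.log N = -Real.log ε / (d - 1) := by
    rw [hN, Real.log_rpow hε, show (1 - (d : ℝ)) = -(d - 1) by ring]
    field_simp
  have hlX : X ≤ Real.log N := by
    rw [hlogN, le_div_iff₀ hd1]
    have := (Real.log_lt_log hε hεX).le
    rw [Real.log_exp] at this
    linarith
  obtain ⟨hsm, hl1⟩ := hX _ hlX
  set l := Real.log N with hl
  have hl0 : 0 < l := by linarith
  have hNl : N = Real.exp l := (Real.exp_log hN0).symm
  have hN1 : 1 ≤ N := by rw [hNl]; exact Real.one_le_exp hl0.le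
  refine ⟨hN1, ?_⟩
  have hεN : ε = N ^ (-((d : ℝ) - 1)) := by
    rw [hN, ← Real.rpow_mul hε.le, show 1 / (1 - (d : ℝ)) * -(d - 1) = 1 by
      rw [show (1 - (d : ℝ)) = -(d - 1) by ring]; field_simp, Real.rpow_one]
  have hT1 : ε ^ (-1 - 1 / ((d : ℝ) - 1)) = N / ε := by
    rw [hN, show (1:ℝ) / (1 - d) = -(1 / (d - 1)) by
      rw [show (1 - (d : ℝ)) = -(d - 1) by ring]; field_simp,
      show (-1 - 1 / ((d : ℝ) - 1)) = -(1 / (d - 1)) - 1 by ring, Real.rpow_sub hε, Real.rpow_one]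
  have hK : N * (ε * lossFac d N) = (1 + l) ^ (5 / 4 : ℝ) := by
    have e : N * ε * N ^ ((d : ℝ) - 2) = 1 := by
      nth_rewrite 1 [← Real.rpow_one N]
      rw [hεN, ← Real.rpow_add hN0, ← Real.rpow_add hN0, show (1 + -((d : ℝ) - 1) + (d - 2)) = 0 by ring,
        Real.rpow_zero]
    calc N * (ε * lossFac d N) = (N * ε * N ^ ((d : ℝ) - 2)) * (1 + l) ^ (5 / 4 : ℝ) := by
          rw [lossFac]; ring
      _ = _ := by rw [e, one_mul]
  set P := (1 + l) ^ (5 / 4 : ℝ) with hP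
  have hP1 : 1 ≤ P := Real.one_le_rpow (by linarith) (by norm_num)
  -- For `d ≥ 2` the exponent `-(d+1)/2` is at most `-3/2`, with equality at `d = 2`; this still
  -- beats the growth of order `5/4` of `P`.
  set q := l ^ (-(3 / 2) : ℝ) with hq
  have hq0 : 0 < q := Real.rpow_pos_of_pos hl0 _
  have hPq : P * q ≤ 4 * l ^ (-(1 / 4 : ℝ)) := by
    have h1 : P ≤ (2 * l) ^ (5 / 4 : ℝ) := Real.rpow_le_rpow (by linarith) (by linarith) (by norm_num)
    have h2 : (2:ℝ) ^ (5 / 4 : ℝ) ≤ 4 := by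
      calc (2:ℝ) ^ (5 / 4 : ℝ) ≤ 2 ^ (2 : ℝ) := Real.rpow_le_rpow_of_exponent_le (by norm_num) (by norm_num)
        _ = 4 := by norm_num
    rw [Real.mul_rpow two_pos.le hl0.le] at h1
    calc P * q ≤ (4 * l ^ (5 / 4 : ℝ)) * q := by
          refine mul_le_mul_of_nonneg_right (h1.trans ?_) hq0.le
          gcongr
      _ = 4 * l ^ (-(1 / 4 : ℝ)) := by
          rw [hq, mul_assoc, ← Real.rpow_add hl0]; norm_num
  have hNq : 1 / N ≤ 2 * q := by
    have h1 : l ^ (3 / 2 : ℝ) ≤ l ^ (2 : ℝ) := Real.rpow_le_rpow_of_exponent_le hl1 (by norm_num)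
    have h2 := Real.quadratic_le_exp_of_nonneg hl0.le
    rw [← hNl] at h2
    rw [Real.rpow_two] at h1
    rw [hq, Real.rpow_neg hl0.le, ← div_eq_mul_inv, div_le_div_iff₀ hN0 (Real.rpow_pos_of_pos hl0 _)]
    linarith
  have hTq : T ≤ N / ε * q := by
    refine hTle.trans ?_
    rw [hT1]
    refine mul_le_mul_of_nonneg_left ?_ (by positivity)
    have h1 : l ≤ Real.log (1 + N) := Real.log_le_log hN0 (by linarith)
    calc Real.log (1 + N) ^ (-((d : ℝ) + 1) / 2) ≤ l ^ (-((d : ℝ) + 1) / 2) :=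
          Real.rpow_le_rpow_of_nonpos hl0 h1 (by linarith)
      _ ≤ q := Real.rpow_le_rpow_of_exponent_le hl1 (by linarith)
  have hK0 : 0 ≤ lossFac d N := zero_le_one.trans (one_le_lossFac hd hN1)
  have hεK : ε * lossFac d N = P * (1 / N) := by rw [← hK]; field_simp
  calc lossFac d N * (2 * ε) ^ 3 + T * ((2 * ε) ^ 3 / N + lossFac d N * (2 * ε) ^ 4)
      ≤ lossFac d N * (2 * ε) ^ 3 + (N / ε * q) * ((2 * ε) ^ 3 / N + lossFac d N * (2 * ε) ^ 4) := by gcongr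
    _ = 8 * ε ^ 2 * (ε * lossFac d N) + 8 * ε ^ 2 * q + 16 * ε ^ 2 * q * (N * (ε * lossFac d N)) := by
        field_simp; ring
    _ = ε ^ 2 * (8 * (P * (1 / N)) + 8 * q + 16 * (P * q)) := by rw [hK, hεK]; ring
    _ ≤ ε ^ 2 * (8 * (P * (2 * q)) + 8 * (P * q) + 16 * (P * q)) := by
        gcongr
        exact le_mul_of_one_le_left hq0.le hP1
    _ = ε ^ 2 * (40 * (P * q)) := by ring
    _ ≤ ε ^ 2 * δ := by gcongr; linarith
    _ = δ * ε ^ 2 := mul_comm _ _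

end Assembly

end QHD
end

/-! ### Growth of the Sobolev norm along solutions -/

noncomputable section

namespace QHD

open scoped ENNReal ComplexConjugate Topology Pointwise
open UnitAddTorus

section Main
variable {d : ℕ} {m κ : ℝ} {g : ℝ → ℝ} {ν : Fin d → ℝ}

/-- Long time energy estimate in terms of the Sobolev norm of a solution. -/
theorem sobolevNorm_growth (hd : 2 ≤ d) {γ s : ℝ} (hs : 3 * d + 1 ≤ s) (hm : 0 < m) (hκ : 0 < κ)
    (hgs : ContDiffOn ℝ ∞ g (Set.Ioi 0)) (hgm : g m = 0) (hg : 0 < deriv g m)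
    (hν : ∀ i, 1 ≤ ν i) (hν2 : ∀ i, ν i ≤ 2) (hres : NonRes d (hbar κ / 2) γ (omega ν m κ g)) :
    ∃ C r : ℝ, 0 < C ∧ 0 < r ∧ ∀ (T : ℝ) (w : ℝ → Freq d → ℂ), IsSolution ν m κ g s T w →
      ∀ ε N : ℝ, 0 ≤ ε → ε ≤ r → 1 ≤ N → (∀ t ∈ Set.Ico 0 T, sobolevNorm s (w t) ≤ ε) →
      ∀ t ∈ Set.Ico 0 T, sobolevNorm s (w t) ^ 2 ≤ sobolevNorm s (w 0) ^ 2 +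
        C * (lossFac d N * ε ^ 3 + T * (ε ^ 3 / N + lossFac d N * ε ^ 4)) := by
  have hd0 : (0 : ℝ) ≤ d := Nat.cast_nonneg d
  have hsd : (d : ℝ) ≤ s := by linarith
  obtain ⟨p, q, C₀, r₀, hC₀, hr₀, hexp⟩ := dbar_expansion (ν := ν) (s := s) (by linarith) hm hκ hgs hgm hg hν hν2
  have oZ := bigOrd_synth (d := d) hsd
  have oQ : BigOrd (d := d) s 2 (fun z => quadF p q (synth z)) := by
    have h1 := oZ.add oZ.star
    exact ((BigOrd.smul (ScalOrd.const p) ((oZ.mul hsd oZ.star).add (h1.mul hsd oZ))).mono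
      (by norm_num)).add ((BigOrd.smul (ScalOrd.const q) (h1.mul hsd h1)).mono (by norm_num))
  obtain ⟨CQ, rQ, hCQ, hrQ, hQ⟩ := oQ
  set b := diagBound m κ g with hb
  have hb0 : 0 < b := by
    have h1 := offDiag_pos hm hκ hg
    have h2 := hbar_pos hκ
    rw [hb]; unfold diagBound; positivity
  have hAB : ∀ j : Freq d, |diagA ν m κ g j| ≤ b ∧ |diagB ν m κ g j| ≤ b := abs_diag_le hm hκ hg hν
  set H := interC (diagA ν m κ g) (diagB ν m κ g) p q with hH
  have hsym := symCoef_interC hb0.le hAB p q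
  -- One constant for both the full nonlinearity, bounded by `B ε²`, and its cubic remainder,
  -- bounded by `B ε³`; absorbing `C₀ ε³` into `C₀ ε²` is why `ε ≤ 1` is imposed.
  set B := 2 * b * (CQ * (2 * b) ^ 2) + C₀ with hB
  obtain ⟨C, hC, hen⟩ := energy_estimate hd hres hs hsym (B := B) (by positivity)
  refine ⟨C, min r₀ (min 1 (rQ / (2 * b))), hC, by positivity, fun T w hw ε N hε hεr hN hsob t ht => ?_⟩
  have hεr₀ : ε ≤ r₀ := hεr.trans (min_le_left _ _)
  have hε1 : ε ≤ 1 := hεr.trans ((min_le_right _ _).trans (min_le_left _ _))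
  have hεQ : 2 * b * ε ≤ rQ := by
    have h1 : ε ≤ rQ / (2 * b) := hεr.trans ((min_le_right _ _).trans (min_le_right _ _))
    rw [le_div_iff₀ (by positivity)] at h1
    linarith
  have h0 : (0 : ℝ) ∈ Set.Ico 0 T := ⟨le_rfl, ht.1.trans_lt ht.2⟩
  have hwl : ∀ t ∈ Set.Ico 0 T, wl2 s (w t) ≤ ENNReal.ofReal ε := fun t ht => by
    rw [wl2_eq_ofReal (hw.mem t ht).2]
    exact ENNReal.ofReal_le_ofReal (hsob t ht)
  have hN' := fun t (ht : t ∈ Set.Ico 0 T) => hexp ε (w t) hε hεr₀ (hw.mem t ht).1 (hwl t ht)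
  choose! n hn hdb using hN'
  set z : ℝ → Freq d → ℂ := fun t => undiag ν m κ g (w t) with hz
  have hzl : ∀ t ∈ Set.Ico 0 T, wl2 s (z t) ≤ ENNReal.ofReal (2 * b * ε) := fun t ht =>
    wl2_undiag_le hm hκ hg hν s hε (hwl t ht)
  have hquad : ∀ t ∈ Set.Ico 0 T, ∀ μ j, quadN H (dbl (w t)) (μ, j) =
      mixC (diagA ν m κ g) (diagB ν m κ g) μ true j * coef (quadF p q (synth (z t))) j +
        mixC (diagA ν m κ g) (diagB ν m κ g) μ false j * conj (coef (quadF p q (synth (z t))) (-j)) :=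
    fun t ht μ j => quadN_interC hb0.le hAB (diagA_neg ν m κ g) (diagB_neg ν m κ g) p q
      (summable_of_wl2 hsd (ne_top_of_le_ne_top ENNReal.ofReal_ne_top (hwl t ht)))
      (summable_of_wl2 hsd (ne_top_of_le_ne_top ENNReal.ofReal_ne_top (hzl t ht)))
      (fun j => undiag_apply ..) μ j
  refine sobolevNorm_sq_le (hw.mem t ht) fun M hM => ?_
  refine (hen ε N M T (fun t => dbl (w t)) (fun t x => quadN H (dbl (w t)) x + dbl (n t) x)
    (fun t => dbl (n t)) hε hN hM (fun t _ x => dbl_barx _ _) (fun t ht x hx => ?_) (fun t ht x hx => ?_)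
    (fun t _ x _ => rfl) (fun t ht σ => ?_) (fun t ht σ => ?_) (fun t ht σ => ?_) t ht).trans ?_
  · simp [dbl, hx, (hw.mem t ht).1]
  · obtain ⟨σ, j⟩ := x
    have hval : ∀ j, j ≠ 0 → dbar (hamW ν m κ g) (w t) j = omega ν m κ g j * w t j +
        (quadN H (dbl (w t)) (true, j) + n t j) := fun j hj => by
      rw [hdb t ht j hj, hquad t ht]
      simp only [mixC, Bool.true_eq_false, if_true, if_false, hz]
      push_cast
      ring
    cases σ
    -- The component of sign `false` at `j` is the conjugate of `w` at `-j`, so it solves the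
    -- conjugate of the equation at `-j`.
    · have hj : -j ≠ 0 := neg_ne_zero.2 hx
      have h1 := (hw.eqn t ht (-j) hj).star
      have e : quadN H (dbl (w t)) (false, j) = conj (quadN H (dbl (w t)) (true, -j)) := by
        rw [hquad t ht, hquad t ht]
        simp only [mixC, Bool.true_eq_false, Bool.false_eq_true, if_true, if_false, diagA_neg, diagB_neg,
          map_add, map_mul, Complex.conj_ofReal, Complex.conj_conj, neg_neg]
        ring
      rw [hval (-j) hj] at h1
      have h2 : star (-Complex.I * (omega ν m κ g (-j) * w t (-j) +
          (quadN H (dbl (w t)) (true, -j) + n t (-j)))) = -(Complex.I * bsgn false) *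
          (omega ν m κ g j * dbl (w t) (false, j) + (quadN H (dbl (w t)) (false, j) + dbl (n t) (false, j))) := by
        rw [e, omega_neg]
        simp [dbl, bsgn]
      rw [h2] at h1
      exact h1
    · have h1 := hw.eqn t ht j hx
      rw [hval j hx] at h1
      have h2 : -Complex.I * (omega ν m κ g j * w t j + (quadN H (dbl (w t)) (true, j) + n t j)) =
          -(Complex.I * bsgn true) *
          (omega ν m κ g j * dbl (w t) (true, j) + (quadN H (dbl (w t)) (true, j) + dbl (n t) (true, j))) := by
        simp [dbl, bsgn]
      rw [h2] at h1
      exact h1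
  · rw [wl2_dbl]; exact hwl t ht
  · set F := quadF p q (synth (z t)) with hF
    have hFl : wl2 s (coef F) ≤ ENNReal.ofReal (CQ * (2 * b * ε) ^ 2) :=
      hQ (2 * b * ε) (z t) (by positivity) hεQ (by simp [hz, undiag]) (hzl t ht)
    have h1 := wl2_mul_le (a := s) (fun j => abs_mixC_le hAB σ true j) (coef F)
    have h2 := wl2_mul_le (a := s) (fun j => abs_mixC_le hAB σ false j) (fun j => conj (coef F (-j)))
    rw [wl2_conj_neg] at h2
    have h3 : (fun a => quadN H (dbl (w t)) (σ, a) + dbl (n t) (σ, a)) = fun a =>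
        ((mixC (diagA ν m κ g) (diagB ν m κ g) σ true a * coef F a +
        mixC (diagA ν m κ g) (diagB ν m κ g) σ false a * conj (coef F (-a))) + dbl (n t) (σ, a)) :=
      funext fun a => by rw [hquad t ht]
    rw [h3]
    refine (wl2_add_le _ _ _).trans ((add_le_add ((wl2_add_le _ _ _).trans (add_le_add
      (h1.trans (mul_le_mul_right hFl _)) (h2.trans (mul_le_mul_right hFl _))))
      ((wl2_dbl s (n t) σ).trans_le (hn t ht))).trans ?_)
    rw [← ENNReal.ofReal_mul hb0.le, ← ENNReal.ofReal_add (by positivity) (by positivity),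
      ← ENNReal.ofReal_add (by positivity) (by positivity)]
    refine ENNReal.ofReal_le_ofReal ?_
    have h4 : C₀ * ε ^ 3 ≤ C₀ * ε ^ 2 :=
      mul_le_mul_of_nonneg_left (pow_le_pow_of_le_one hε hε1 (by norm_num)) hC₀
    rw [hB]
    linarith
  · rw [wl2_dbl]
    refine (hn t ht).trans (ENNReal.ofReal_le_ofReal ?_)
    gcongr
    rw [hB]
    exact le_add_of_nonneg_left (by positivity)
  · gcongr
    exact energy_dbl_le (by linarith) (hw.mem 0 h0).2

end Main

end QHD
end

/-! ### Conclusion -/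

theorem lemma4p8 (d : ℕ) (hd : d = 2 ∨ d = 3) :
    ∃ s₀ : ℝ, ∀ (m κ : ℝ) (g : ℝ → ℝ), 0 < m → 0 < κ →
      ContDiffOn ℝ ∞ g (Set.Ioi 0) → g m = 0 → 0 < deriv g m →
      ∀ᵐ ν : Fin d → ℝ ∂(volume.restrict (Set.Icc (fun _ => (1 : ℝ)) (fun _ => 2))),
        ∀ s : ℝ, s₀ ≤ s → ∃ ε₀ : ℝ, 0 < ε₀ ∧
          ∀ (T : ℝ) (w : ℝ → QHD.Freq d → ℂ), 0 < T → QHD.IsSolution ν m κ g s T w →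
            ∀ ε : ℝ, 0 < ε → ε < ε₀ →
              QHD.sobolevNorm s (w 0) ≤ ε →
              (∀ t ∈ Set.Ico 0 T, QHD.sobolevNorm s (w t) ≤ 2 * ε) →
              T ≤ ε ^ (-1 - 1 / ((d : ℝ) - 1)) *
                Real.log (1 + ε ^ (1 / (1 - (d : ℝ)))) ^ (-((d : ℝ) + 1) / 2) →
              ∀ t ∈ Set.Ico 0 T, QHD.sobolevNorm s (w t) ≤ 3 / 2 * ε := by
  have hd2 : 2 ≤ d := by omega
  -- The regularity is `2d + 1` powers on one frequency in `triWt`, plus `d` for the embedding into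
  -- the Wiener algebra.
  refine ⟨3 * d + 1, fun m κ g hm hκ hgs hgm hg => ?_⟩
  filter_upwards [QHD.ae_nonRes hd2 hm hκ hg] with ν ⟨hν, hν2, γ, hres⟩ s hs
  obtain ⟨C, r, hC, hr, hgrow⟩ := QHD.sobolevNorm_growth hd2 hs hm hκ hgs hgm hg hν hν2 hres
  -- The allowed increment is `(5/4) ε²`, because `(3/2)² = 1 + 5/4`.
  obtain ⟨ε₁, hε₁, hloss⟩ := QHD.exists_small_loss hd2 (δ := 5 / 4 / C) (by positivity)
  refine ⟨min ε₁ (r / 2), by positivity, fun T w hT hw ε hε hεlt h0 hsob hTle t ht => ?_⟩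
  obtain ⟨hN, hl⟩ := hloss ε T hε (hεlt.trans_le (min_le_left _ _)) hT hTle
  have hεr : 2 * ε ≤ r := by linarith [hεlt.trans_le (min_le_right _ _)]
  have h1 := hgrow T w hw (2 * ε) _ (by positivity) hεr hN hsob t ht
  have h2 : QHD.sobolevNorm s (w 0) ^ 2 ≤ ε ^ 2 := pow_le_pow_left₀ (Real.sqrt_nonneg _) h0 2
  have h3 := mul_le_mul_of_nonneg_left hl hC.le
  have e : C * (5 / 4 / C * ε ^ 2) = 5 / 4 * ε ^ 2 := by field_simp
  rw [e] at h3
  refine (le_abs_self _).trans (abs_le_of_sq_le_sq (?_ : _ ≤ (3 / 2 * ε) ^ 2) (by positivity))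
  calc _ ≤ ε ^ 2 + 5 / 4 * ε ^ 2 := h1.trans (add_le_add h2 h3)
    _ = (3 / 2 * ε) ^ 2 := by ring
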